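/- Let $p$ be a prime and $\mathbb K$ a field of characteristic $p$. Let $sl_3^+$ be the Lie algebra of strictly upper triangular complex $3\times 3$ matrices with basis $e_\alpha=E_{12}$, $e_\beta=E_{23}$, $e_{\alpha+\beta}=E_{13}$, write $x^{(k)}=x^k/k!$ in its enveloping algebra $\mathfrak U_3^+(\mathbb C)$, let $\mathfrak U_3^+(\mathbb Z)\subset\mathfrak U_3^+(\mathbb C)$ be the Kostant form, i.e. the subring generated by the lattice spanned by the elements $e_\alpha^{(i)}e_{\alpha+\beta}^{(j)}e_\beta^{(k)}$, and let $A=\mathfrak U_3^+(\mathbb K)=\mathbb K\otimes_{\mathbb Z}\mathfrak U_3^+(\mathbb Z)$. The algebra $A$ is graded by the free commutative monoid $S$ on $\alpha,\beta$, with $\deg e_\alpha^{(i)}e_{\alpha+\beta}^{(j)}e_\beta^{(k)}=(i+j)\alpha+(j+k)\beta$, and $\mathbb K$ is the trivial $A$-module in degree $0$, given by the augmentation $\varepsilon:A\to\mathbb K$ that kills $e_\alpha^{(k)},e_{\alpha+\beta}^{(k)},e_\beta^{(k)}$ for $k\ge 1$. Let $Z=\{a_k,b_k : k\ge 0\}$,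 with $a_k\mapsto e_\alpha^{(p^k)}$, $b_k\mapsto e_\beta^{(p^k)}$ defining $\pi:\mathbb K\langle Z^*\rangle\to A$. Give $a_k$, $b_k$ the degrees $p^k\alpha$, $p^k\beta$, let $\mathrm{Deg}$ of a word be the sum of the two coefficients of its degree, and order words first by $\mathrm{Deg}$ and then lexicographically with $a_0<b_0<a_1<b_1<\cdots$. Let $G$ consist of the following elements (all $k\ge0$, and all $l>k$ where $l$ occurs): $$a_lb_k-b_ka_l+(-1)^{l-k}a_k^{p-1}b_ka_k\,a_{k+1}^{p-1}\cdots a_{l-1}^{p-1},\qquad b_la_k-a_kb_l-(-1)^{l-k}b_ka_k\,b_k^{p-1}b_{k+1}^{p-1}\cdots b_{l-1}^{p-1},$$ $$a_la_k-a_ka_l,\quad b_lb_k-b_kb_l,\quad (b_ka_k)^p-(a_kb_k)^p,\quad a_k^p,\quad b_k^p,$$ and, if $p\ge3$, $\ b_k^2a_k-2b_ka_kb_k+a_kb_k^2\ $ and $\ b_ka_k^2-2a_kb_ka_k+a_k^2b_k$. Then $G$ is a reduced Gröbner basis of $\ker\pi$. Let $T_{-1}=\{e\}$, $T_0=Z$,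 let $T_1$ be the set of leading monomials of elements of $G$, and let $P_n$ ($n=-1,0,1$) be the free left $A$-module with basis $\{.t : t\in T_n\}$, graded so that $.t$ has the degree of the word $t$. The first differentials of the Anick resolution of $\mathbb K$ are the $A$-linear maps $d_0:P_0\to P_{-1}$, $d_0(.x)=\pi(x).e$, and $d_1:P_1\to P_0$, $d_1(.t)=\pi(t').x-i_0(d_0(\pi(t').x))$ for $t=t'x$ with $x\in Z$; here $i_0$ is the $\mathbb K$-linear map with $i_0(\pi(uy).e)=\pi(u).y$ for every non-reducible word $uy$ with last letter $y\in Z$ (and $0$ for the empty word). Corollary. The Anick resolution gives the first two steps of the minimal $S$-graded projective resolution of $\mathbb K$. That is: (1) $P_1\xrightarrow{d_1}P_0\xrightarrow{d_0}P_{-1}\xrightarrow{\varepsilon}\mathbb K\to0$, where $\varepsilon(a.e)=\varepsilon(a)$, is an exact sequence of graded $A$-modules and degree-preserving maps, and $P_{-1},P_0,P_1$ are projective graded modules. (2) The image of $d_0$ is small in $P_{-1}$ and the image of $d_1$ is small in $P_0$, where a graded submodule $N$ of $P$ is small if $T+N=P$ implies $T=P$ for every graded submodule $T$. Both images lie in the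 radical, where $\mathrm{Rad}(P_n)$ consists of the elements of $P_n$ all of whose coordinates lie in $\bigoplus_{s\ne0}A_s$. (3) For every minimal graded projective resolution $\cdots\to Q_1\to Q_0\to Q_{-1}\to\mathbb K\to0$ (that is, a resolution by projective graded modules in which the kernel of each map is small) there are isomorphisms of graded modules $P_{-1}\cong Q_{-1}$ and $P_0\cong Q_0$ compatible with the maps $P_0\to P_{-1}\to\mathbb K$ and $Q_0\to Q_{-1}\to\mathbb K$. -/

import Mathlib

open scoped TensorProduct

universe u

/-! ## Kostant form of the enveloping algebra of strictly upper triangular `3 × 3` matrices -/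

namespace Kostant

attribute [local instance] LieRing.ofAssociativeRing

/-- The Lie algebra `sl₃⁺` of strictly upper triangular complex `3 × 3` matrices. -/
def sl3Plus : LieSubalgebra ℂ (Matrix (Fin 3) (Fin 3) ℂ) where
  carrier := {M | ∀ i j, j ≤ i → M i j = 0}
  zero_mem' := by intro i j _; rfl
  add_mem' := by
    intro M N hM hN i j hij
    simp [hM i j hij, hN i j hij]
  smul_mem' := by
    intro c M hM i j hij
    simp [hM i j hij]
  lie_mem' := by
    intro M N hM hN i j hij
    have key : ∀ P Q : Matrix (Fin 3) (Fin 3) ℂ, (∀ i j, j ≤ i → P i j = 0) →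
        (∀ i j, j ≤ i → Q i j = 0) → (P * Q) i j = 0 := by
      intro P Q hP hQ
      rw [Matrix.mul_apply]
      refine Finset.sum_eq_zero fun k _ => ?_
      rcases le_total k i with h | h
      · rw [hP i k h, zero_mul]
      · rw [hQ k j (hij.trans h), mul_zero]
    rw [Ring.lie_def, Matrix.sub_apply, key M N hM hN, key N M hN hM, sub_zero]

/-- The elementary matrix `E i j` with `i < j` as an element of `sl₃⁺`. -/
def elem (i j : Fin 3) (h : i < j) : sl3Plus :=
  ⟨Matrix.single i j 1, by
    intro k l hkl
    rw [Matrix.single_apply, if_neg]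
    rintro ⟨rfl, rfl⟩
    exact absurd hkl (not_le.mpr h)⟩

/-- The universal enveloping algebra `𝔘₃⁺(ℂ)`. -/
abbrev UC : Type := UniversalEnvelopingAlgebra ℂ sl3Plus

/-- `e_α`, the class of `E₁₂`. -/
noncomputable def eAlpha : UC := UniversalEnvelopingAlgebra.ι ℂ (elem 0 1 (by decide))

/-- `e_β`, the class of `E₂₃`. -/
noncomputable def eBeta : UC := UniversalEnvelopingAlgebra.ι ℂ (elem 1 2 (by decide))

/-- `e_{α+β}`, the class of `E₁₃`. -/
noncomputable def eAlphaBeta : UC := UniversalEnvelopingAlgebra.ι ℂ (elem 0 2 (by decide))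

/-- The divided power `x^{(k)} = x ^ k / k!`. -/
noncomputable def divPow (x : UC) (k : ℕ) : UC := ((k.factorial : ℂ)⁻¹) • x ^ k

/-- `e_α^{(i)} e_{α+β}^{(j)} e_β^{(k)}`. -/
noncomputable def divMon (i j k : ℕ) : UC :=
  divPow eAlpha i * divPow eAlphaBeta j * divPow eBeta k

/-- The Kostant form over `ℤ`: the subring of `𝔘₃⁺(ℂ)` generated by the lattice which is spanned
by the elements `e_α^{(i)} e_{α+β}^{(j)} e_β^{(k)}`. -/
def kostantZ : Subalgebra ℤ UC :=
  Algebra.adjoin ℤ (Set.range fun t : ℕ × ℕ × ℕ => divMon t.1 t.2.1 t.2.2)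

/-- `e_α^{(i)} e_{α+β}^{(j)} e_β^{(k)}` in the Kostant form over `ℤ`. -/
noncomputable def divMonZ (i j k : ℕ) : kostantZ :=
  ⟨divMon i j k, Algebra.subset_adjoin ⟨(i, j, k), rfl⟩⟩

/-- The Kostant form `𝔘₃⁺(K) = K ⊗_ℤ 𝔘₃⁺(ℤ)`. -/
abbrev KostantForm (K : Type u) [Field K] : Type u := K ⊗[ℤ] kostantZ

variable (K : Type u) [Field K]

/-- `e_α^{(i)} e_{α+β}^{(j)} e_β^{(k)}` in `𝔘₃⁺(K)`. -/
noncomputable def basisElt (i j k : ℕ) : KostantForm K := (1 : K) ⊗ₜ[ℤ] divMonZ i j k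

/-- The grading of `𝔘₃⁺(K)` by the free commutative monoid on `α, β`, written as `ℕ × ℕ`
(`(m, n)` stands for `m α + n β`): `e_α^{(i)} e_{α+β}^{(j)} e_β^{(k)}` has degree
`(i + j) α + (j + k) β`. -/
noncomputable def grading (s : ℕ × ℕ) : Submodule K (KostantForm K) :=
  Submodule.span K {x | ∃ i j k : ℕ, (i + j, j + k) = s ∧ x = basisElt K i j k}

/-- The augmentation of `𝔘₃⁺(ℂ)`: it kills `sl₃⁺`. -/
noncomputable def augC : UC →ₐ[ℂ] ℂ :=
  UniversalEnvelopingAlgebra.lift ℂ (0 : sl3Plus →ₗ⁅ℂ⁆ ℂ)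

theorem augC_divPow_iota (x : sl3Plus) (k : ℕ) :
    augC (divPow (UniversalEnvelopingAlgebra.ι ℂ x) k) = if k = 0 then 1 else 0 := by
  have h : augC (UniversalEnvelopingAlgebra.ι ℂ x) = 0 := by
    rw [augC, UniversalEnvelopingAlgebra.lift_ι_apply]; rfl
  rw [divPow, map_smul, map_pow, h]
  by_cases hk : k = 0 <;> simp [hk]

theorem augC_mem_bot (x : kostantZ) : augC (x : UC) ∈ (⊥ : Subalgebra ℤ ℂ) := by
  have h : kostantZ ≤ (⊥ : Subalgebra ℤ ℂ).comap (augC.restrictScalars ℤ) := by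
    refine Algebra.adjoin_le ?_
    rintro _ ⟨⟨i, j, k⟩, rfl⟩
    have aux : ∀ (y : sl3Plus) (n : ℕ),
        augC (divPow (UniversalEnvelopingAlgebra.ι ℂ y) n) ∈ (⊥ : Subalgebra ℤ ℂ) := by
      intro y n
      rw [augC_divPow_iota]
      split_ifs
      · exact one_mem _
      · exact zero_mem _
    change augC (divMon i j k) ∈ (⊥ : Subalgebra ℤ ℂ)
    rw [divMon, map_mul, map_mul]
    exact mul_mem (mul_mem (aux _ _) (aux _ _)) (aux _ _)
  exact h x.2

/-- The augmentation of `𝔘₃⁺(ℤ)`, the restriction of that of `𝔘₃⁺(ℂ)`. -/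
noncomputable def augZ : kostantZ →ₐ[ℤ] ℤ :=
  (Algebra.botEquivOfInjective (R := ℤ) (A := ℂ)
      (by intro a b h; simpa using h)).toAlgHom.comp
    (((augC.restrictScalars ℤ).comp kostantZ.val).codRestrict ⊥ augC_mem_bot)

/-- The augmentation `ε : 𝔘₃⁺(K) → K`. -/
noncomputable def aug : KostantForm K →ₐ[K] K :=
  Algebra.TensorProduct.lift (AlgHom.id K K) ((Algebra.ofId ℤ K).comp augZ)
    fun _ _ => Commute.all _ _

/-- The trivial module `K` over `𝔘₃⁺(K)`, on which `a` acts as multiplication by `ε a`. -/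
def TrivialModule : Type u := K

noncomputable instance : AddCommGroup (TrivialModule K) := inferInstanceAs (AddCommGroup K)

noncomputable instance : Module (KostantForm K) (TrivialModule K) :=
  Module.compHom K (aug K).toRingHom

/-- The element `1` of the trivial module. -/
noncomputable def TrivialModule.one : TrivialModule K := (1 : K)

/-- The grading of the trivial module: it is concentrated in degree `0`. -/
noncomputable def trivialGrading (s : ℕ × ℕ) : AddSubgroup (TrivialModule K) := if s = 0 then ⊤ else ⊥

end Kostant

/-! ## Graded modules -/

namespace Graded

section

variable {Γ : Type} [AddCommMonoid Γ] [DecidableEq Γ] {K A : Type u} [Field K] [Ring A]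
  [Algebra K A] (𝒜 : Γ → Submodule K A)

/-- `𝒜` makes `A` a graded algebra. -/
def IsGradedAlgebra : Prop := SetLike.GradedMonoid 𝒜 ∧ DirectSum.IsInternal 𝒜

/-- `ℳ` makes the left `A`-module `M` a graded module. -/
def IsGradedModule {M : Type u} [AddCommGroup M] [Module A M] (ℳ : Γ → AddSubgroup M) : Prop :=
  DirectSum.IsInternal ℳ ∧ ∀ s t, ∀ a ∈ 𝒜 s, ∀ x ∈ ℳ t, a • x ∈ ℳ (s + t)

/-- A morphism of graded modules: an `A`-linear map which preserves degrees. -/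
def IsGradedHom {M N : Type u} [AddCommGroup M] [Module A M] [AddCommGroup N] [Module A N]
    (ℳ : Γ → AddSubgroup M) (𝒩 : Γ → AddSubgroup N) (f : M →ₗ[A] N) : Prop :=
  ∀ s, ∀ x ∈ ℳ s, f x ∈ 𝒩 s

/-- A graded submodule: a submodule generated by its homogeneous elements. -/
def IsGradedSubmodule {M : Type u} [AddCommGroup M] [Module A M] (ℳ : Γ → AddSubgroup M)
    (T : Submodule A M) : Prop :=
  T = Submodule.span A {x | x ∈ T ∧ ∃ s, x ∈ ℳ s}

/-- `N` is a small subobject of the graded module `M`. -/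
def IsSmall {M : Type u} [AddCommGroup M] [Module A M] (ℳ : Γ → AddSubgroup M)
    (N : Submodule A M) : Prop :=
  IsGradedSubmodule ℳ N ∧ ∀ T : Submodule A M, IsGradedSubmodule ℳ T → T ⊔ N = ⊤ → T = ⊤

/-- `Q` is a projective object in the category of graded `A`-modules. -/
def IsProjective {Q : Type u} [AddCommGroup Q] [Module A Q] (𝒬 : Γ → AddSubgroup Q) : Prop :=
  IsGradedModule 𝒜 𝒬 ∧
  ∀ (M N : Type u) [AddCommGroup M] [Module A M] [AddCommGroup N] [Module A N]
    (ℳ : Γ → AddSubgroup M) (𝒩 : Γ → AddSubgroup N),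
    IsGradedModule 𝒜 ℳ → IsGradedModule 𝒜 𝒩 →
    ∀ (f : M →ₗ[A] N) (g : Q →ₗ[A] N), IsGradedHom ℳ 𝒩 f → Function.Surjective f →
      IsGradedHom 𝒬 𝒩 g → ∃ h : Q →ₗ[A] M, IsGradedHom 𝒬 ℳ h ∧ f ∘ₗ h = g

/-- The grading of the free module `⨁_{t : T} A[deg t]`, where
`A[γ]_s` is the sum of the `A_β` with `β + γ = s`. -/
def freeGrading {T : Type} (deg : T → Γ) (s : Γ) : AddSubgroup (T →₀ A) where
  carrier := {f | ∀ t, f t ∈ ⨆ β : Γ, ⨆ _ : β + deg t = s, 𝒜 β}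
  zero_mem' := fun _ => zero_mem _
  add_mem' := fun hf hg t => add_mem (hf t) (hg t)
  neg_mem' := fun hf t => neg_mem (hf t)

/-- `Rad P` for `P = ⨁_{t : T} A[deg t]`: the elements all of whose coordinates lie in the sum of
the components of `A` of non-zero degree. -/
def rad (T : Type) : AddSubgroup (T →₀ A) where
  carrier := {f | ∀ t, f t ∈ ⨆ β : Γ, ⨆ _ : β ≠ 0, 𝒜 β}
  zero_mem' := fun _ => zero_mem _
  add_mem' := fun hf hg t => add_mem (hf t) (hg t)
  neg_mem' := fun hf t => neg_mem (hf t)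

/-- A minimal graded projective resolution
`⋯ → Q 2 → Q 1 → Q 0 → M → 0` of the graded module `M`. -/
structure MinimalResolution {M : Type u} [AddCommGroup M] [Module A M]
    (ℳ : Γ → AddSubgroup M) where
  Q : ℕ → Type u
  [addCommGroup : ∀ n, AddCommGroup (Q n)]
  [module : ∀ n, Module A (Q n)]
  gr : ∀ n, Γ → AddSubgroup (Q n)
  aug : Q 0 →ₗ[A] M
  d : ∀ n, Q (n + 1) →ₗ[A] Q n
  projective : ∀ n, IsProjective 𝒜 (gr n)
  aug_graded : IsGradedHom (gr 0) ℳ aug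
  d_graded : ∀ n, IsGradedHom (gr (n + 1)) (gr n) (d n)
  aug_surjective : Function.Surjective aug
  exact_zero : LinearMap.range (d 0) = LinearMap.ker aug
  exact_succ : ∀ n, LinearMap.range (d (n + 1)) = LinearMap.ker (d n)
  aug_minimal : IsSmall (gr 0) (LinearMap.ker aug)
  d_minimal : ∀ n, IsSmall (gr (n + 1)) (LinearMap.ker (d n))

attribute [instance] MinimalResolution.addCommGroup MinimalResolution.module

end

end Graded

/-! ## Gröbner bases and the beginning of the Anick resolution -/

namespace Anick

/-- The free associative algebra on `X`; its elements are called polynomials. -/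
abbrev Poly (K : Type u) [Field K] (X : Type) : Type u := MonoidAlgebra K (FreeMonoid X)

section

variable {K : Type u} [Field K] {X : Type}

/-- A word as a polynomial. -/
noncomputable def mon (w : FreeMonoid X) : Poly K X := MonoidAlgebra.of K (FreeMonoid X) w

/-- The strict order on words is `lt`; `w` is the leading monomial of `g`. -/
def IsLeading (lt : FreeMonoid X → FreeMonoid X → Prop) (g : Poly K X) (w : FreeMonoid X) : Prop :=
  w ∈ g.coeff.support ∧ ∀ v ∈ g.coeff.support, v ≠ w → lt v w

/-- One reduction step `f → h` by a polynomial `g ∈ S`: a monomial `u m v` of `f`, with `m` the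
leading monomial of `g`, is replaced by means of `g`. -/
def Step (lt : FreeMonoid X → FreeMonoid X → Prop) (S : Set (Poly K X)) (f h : Poly K X) : Prop :=
  ∃ g ∈ S, ∃ m, IsLeading lt g m ∧ ∃ u v : FreeMonoid X, u * m * v ∈ f.coeff.support ∧
    h = f - (f.coeff (u * m * v) / g.coeff m) • (mon u * g * mon v)

/-- `f` is non-reducible with respect to `S`. -/
def NonReducible (lt : FreeMonoid X → FreeMonoid X → Prop) (S : Set (Poly K X))
    (f : Poly K X) : Prop :=
  ∀ h, ¬ Step lt S f h

open Classical in
/-- The normal form `NF(f, S)`: a non-reducible polynomial obtained from `f` by reduction steps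
(it is unique if `S` is a Gröbner basis for a well-founded monomial order). -/
noncomputable def nf (lt : FreeMonoid X → FreeMonoid X → Prop) (S : Set (Poly K X))
    (f : Poly K X) : Poly K X :=
  if h : ∃ f', Relation.ReflTransGen (Step lt S) f f' ∧ NonReducible lt S f' then h.choose else 0

variable {A : Type u} [Ring A] [Algebra K A]

/-- The projection of the free algebra to `A` given by the generators `gen x`. -/
noncomputable def proj (gen : X → A) : Poly K X →ₐ[K] A :=
  MonoidAlgebra.lift K A (FreeMonoid X) (FreeMonoid.lift gen)

/-- `S` is a Gröbner basis of the kernel of the projection to `A`: the projection maps the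
non-reducible polynomials bijectively to `A`. -/
def IsGroebnerBasis (lt : FreeMonoid X → FreeMonoid X → Prop) (gen : X → A)
    (S : Set (Poly K X)) : Prop :=
  (∀ g ∈ S, proj gen g = 0) ∧ Set.BijOn (proj gen) {f | NonReducible lt S f} Set.univ

/-- A reduced Gröbner basis. -/
def IsReducedGroebnerBasis (lt : FreeMonoid X → FreeMonoid X → Prop) (gen : X → A)
    (S : Set (Poly K X)) : Prop :=
  IsGroebnerBasis lt gen S ∧ ∀ g ∈ S, NonReducible lt (S \ {g}) g

/-- `T₁`, the set of leading monomials of elements of `G`. (`T₋₁` is the one-element type `Unit`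
and `T₀` is `X`.) The terms of the resolution are the free left `A`-modules `Tₖ →₀ A`. -/
abbrev T1 (lt : FreeMonoid X → FreeMonoid X → Prop) (G : Set (Poly K X)) : Type :=
  {w : FreeMonoid X // ∃ g ∈ G, IsLeading lt g w}

open Classical in
/-- The non-reducible polynomial which represents `a : A`. -/
noncomputable def rep (lt : FreeMonoid X → FreeMonoid X → Prop) (gen : X → A)
    (G : Set (Poly K X)) (a : A) : Poly K X :=
  if h : ∃ f, NonReducible lt G f ∧ proj gen f = a then h.choose else 0

variable (lt : FreeMonoid X → FreeMonoid X → Prop) (gen : X → A) (G : Set (Poly K X))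

/-- `j₀(ux.e) = u.x` for a word `ux` with last letter `x`; the empty word is sent to `0`. -/
noncomputable def j0 (w : FreeMonoid X) : X →₀ A :=
  if h : w.toList ≠ [] then
    Finsupp.single (w.toList.getLast h)
      (proj gen (mon (K := K) (FreeMonoid.ofList w.toList.dropLast)))
  else 0

/-- The map `i₀`, given on non-reducible words `m` by `i₀(m.e) = j₀(m.e)` and extended linearly. -/
noncomputable def i0 (f : Unit →₀ A) : X →₀ A :=
  (rep lt gen G (f ())).coeff.sum fun w c => algebraMap K A c • j0 (K := K) gen w

/-- `δ₀(.x) = NF(x, G).e`. -/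
noncomputable def delta0 (x : X) : Unit →₀ A :=
  Finsupp.single () (proj gen (nf lt G (mon (FreeMonoid.of x))))

/-- `δ₁(.t) = NF(t', G).x` for a word `t = t'x` with last letter `x`. -/
noncomputable def delta1 (t : FreeMonoid X) : X →₀ A :=
  if h : t.toList ≠ [] then
    Finsupp.single (t.toList.getLast h)
      (proj gen (nf lt G (mon (FreeMonoid.ofList t.toList.dropLast))))
  else 0

/-- The Anick differential `d₀ : P₀ → P₋₁`, `d₀(.x) = δ₀(.x)`. -/
noncomputable def d0 : (X →₀ A) →ₗ[A] (Unit →₀ A) :=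
  Finsupp.linearCombination A (delta0 lt gen G)

/-- The Anick differential `d₁ : P₁ → P₀`, `d₁(.t) = δ₁(.t) - i₀ (d₀ (δ₁(.t)))`. -/
noncomputable def d1 : (T1 lt G →₀ A) →ₗ[A] (X →₀ A) :=
  Finsupp.linearCombination A fun t : T1 lt G =>
    delta1 lt gen G t.1 - i0 lt gen G (d0 lt gen G (delta1 lt gen G t.1))

end

end Anick

/-! ## The small Gröbner basis of the Kostant form -/

namespace Kostant

open Anick

/-- The generators: letters `a k` and `b k` for `k = 0, 1, 2, …`. -/
inductive Gen : Type
  | a : ℕ → Gen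
  | b : ℕ → Gen

/-- The position of a generator in the order `a₀ < b₀ < a₁ < b₁ < ⋯`. -/
def Gen.rank : Gen → ℕ
  | .a k => 2 * k
  | .b k => 2 * k + 1

/-- The degree of a generator: `p ^ k α` for `a k` and `p ^ k β` for `b k`. -/
def Gen.deg (p : ℕ) : Gen → ℕ × ℕ
  | .a k => (p ^ k, 0)
  | .b k => (0, p ^ k)

/-- The degree of a word. -/
def wordDeg (p : ℕ) (w : FreeMonoid Gen) : ℕ × ℕ := (w.toList.map (Gen.deg p)).sum

/-- The total degree `Deg` of a word. -/
def wordTotalDeg (p : ℕ) (w : FreeMonoid Gen) : ℕ := (wordDeg p w).1 + (wordDeg p w).2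

/-- The `Deg`-lexicographic order on words. -/
def wordLT (p : ℕ) (v w : FreeMonoid Gen) : Prop :=
  wordTotalDeg p v < wordTotalDeg p w ∨
    (wordTotalDeg p v = wordTotalDeg p w ∧
      List.Lex (fun x y : Gen => x.rank < y.rank) v.toList w.toList)

section

variable (K : Type u) [Field K]

/-- `a k = e_α^{(p^k)}` and `b k = e_β^{(p^k)}` in `𝔘₃⁺(K)`. -/
noncomputable def genElt (p : ℕ) : Gen → KostantForm K
  | .a k => basisElt K (p ^ k) 0 0
  | .b k => basisElt K 0 0 (p ^ k)

/-- The letter `a k` in the free algebra. -/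
noncomputable def va (k : ℕ) : Poly K Gen := mon (FreeMonoid.of (Gen.a k))

/-- The letter `b k` in the free algebra. -/
noncomputable def vb (k : ℕ) : Poly K Gen := mon (FreeMonoid.of (Gen.b k))

/-- The ordered product `f m * f (m + 1) * ⋯ * f (l - 1)`. -/
noncomputable def orderedProd (f : ℕ → Poly K Gen) (m l : ℕ) : Poly K Gen :=
  ((List.range' m (l - m)).map f).prod

/-- The Gröbner basis `G` of the relations between the generators `a k`, `b k`. -/
inductive G (p : ℕ) : Set (Poly K Gen)
  | ab (k l : ℕ) (h : k < l) : G p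
      (va K l * vb K k - vb K k * va K l + (-1) ^ (l - k) *
        (va K k ^ (p - 1) * vb K k * va K k * orderedProd K (fun s => va K s ^ (p - 1)) (k + 1) l))
  | ba (k l : ℕ) (h : k < l) : G p
      (vb K l * va K k - va K k * vb K l - (-1) ^ (l - k) *
        (vb K k * va K k * orderedProd K (fun s => vb K s ^ (p - 1)) k l))
  | aa (k l : ℕ) (h : k < l) : G p (va K l * va K k - va K k * va K l)
  | bb (k l : ℕ) (h : k < l) : G p (vb K l * vb K k - vb K k * vb K l)
  | braid (k : ℕ) : G p ((vb K k * va K k) ^ p - (va K k * vb K k) ^ p)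
  | powA (k : ℕ) : G p (va K k ^ p)
  | powB (k : ℕ) : G p (vb K k ^ p)
  | serreB (k : ℕ) (h : 3 ≤ p) : G p
      (vb K k ^ 2 * va K k - 2 * (vb K k * va K k * vb K k) + va K k * vb K k ^ 2)
  | serreA (k : ℕ) (h : 3 ≤ p) : G p
      (vb K k * va K k ^ 2 - 2 * (va K k * vb K k * va K k) + va K k ^ 2 * vb K k)

/-- The augmentation `P₋₁ → K` of the Anick resolution, `a.e ↦ a • 1`. -/
noncomputable def augP : (Unit →₀ KostantForm K) →ₗ[KostantForm K] TrivialModule K :=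
  Finsupp.linearCombination (KostantForm K) fun _ => TrivialModule.one K

/-- The Anick differential `d₀ : P₀ → P₋₁` over `𝔘₃⁺(K)` for the Gröbner basis `G`. -/
noncomputable def anickD0 (p : ℕ) :
    (Gen →₀ KostantForm K) →ₗ[KostantForm K] (Unit →₀ KostantForm K) :=
  d0 (wordLT p) (genElt K p) (G K p)

/-- The Anick differential `d₁ : P₁ → P₀` over `𝔘₃⁺(K)` for the Gröbner basis `G`. -/
noncomputable def anickD1 (p : ℕ) :
    (T1 (wordLT p) (G K p) →₀ KostantForm K) →ₗ[KostantForm K] (Gen →₀ KostantForm K) :=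
  d1 (wordLT p) (genElt K p) (G K p)

/-- The grading of `P₋₁`; the basis element `e` has degree `0`. -/
noncomputable def grPm1 : ℕ × ℕ → AddSubgroup (Unit →₀ KostantForm K) :=
  Graded.freeGrading (grading K) fun _ => 0

/-- The grading of `P₀`; the basis element `.x` has the degree of `x`. -/
noncomputable def grP0 (p : ℕ) : ℕ × ℕ → AddSubgroup (Gen →₀ KostantForm K) :=
  Graded.freeGrading (grading K) (Gen.deg p)

/-- The grading of `P₁`; the basis element `.t` has the degree of the word `t`. -/
noncomputable def grP1 (p : ℕ) :
    ℕ × ℕ → AddSubgroup (T1 (wordLT p) (G K p) →₀ KostantForm K) :=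
  Graded.freeGrading (grading K) fun t => wordDeg p t.1

end

end Kostant

namespace Kostant

attribute [local instance] LieRing.ofAssociativeRing

/-! ## Commutation relations in `𝔘₃⁺(ℂ)` -/

/-! Everything rests on the multiplication table of the elements e_α^{(i)} e_{α+β}^{(j)} e_β^{(k)}.
Since e_{α+β} is central, the only work is to reorder e_β^{(k)} e_α^{(i)}, and the resulting table
is integral (`divMon_mul_divMon`). An explicit action on a polynomial ring shows independence, so
these elements form a basis of the Kostant form over ℤ and over `K`. From then on only the table is
used, packaged as `DivPowBasis`.

Gröbner basis: Lucas' congruence turns the table into the relations `G`. Reduction by `G` ends in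
words without leading factors. These are products of blocks a_m^i (b_m a_m)^j b_m^l with i, j, l < p
and m increasing; their exponents, read as base p digits, attach to each such word a basis element
of the same degree. Sending a basis element to the word with its digits defines a degree-preserving
endomorphism of `A`, which is onto because the normal words span. The graded pieces are
finite-dimensional, so it is injective (`normalEnd_injective`). Hence the normal words are
independent, no overlap of leading words has to be resolved, and the kernel of the projection is the
ideal generated by `G` (`ker_proj_le_relSpan`).

Exactness: let `fox` send a word wx to π(w).x and the empty word to 0. Then d₀(fox f) = (π(f) -
f(1)).e with f(1) the constant term, and d₁(.t) = fox g for the element g of `G` with leading word t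
(`d1_single`). Every element of P₀ is fox f for some f without constant term. If d₀ kills it, then f
is a combination of products u g v, and fox(u g v) is π(u) fox(g) for empty v and 0 otherwise
(`range_d1`).

Minimality: the augmentation of the x-coordinate of fox f is the coefficient of the one-letter word
x in f (`augmentation_fox`), and elements of `G` only contain words of length at least two. So the
images lie in the radical, and the graded Nakayama lemma (`isSmall_of_le_rad`) makes them small.
Uniqueness of projective covers (`exists_equiv_of_isSmall_ker`), used for the trivial module and
then for the first syzygy, gives the comparison with any minimal resolution. -/

theorem divPow_zero (x : UC) : divPow x 0 = 1 := by simp [divPow]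

theorem divPow_one (x : UC) : divPow x 1 = x := by simp [divPow]

theorem divPow_mul_divPow (x : UC) (m n : ℕ) :
    divPow x m * divPow x n = ((m + n).choose m : ℤ) • divPow x (m + n) := by
  have h : (((m + n).choose m : ℕ) : ℂ) * (m.factorial * n.factorial) = (m + n).factorial := by
    rw [← mul_assoc, Nat.choose_symm_add]
    exact_mod_cast Nat.add_choose_mul_factorial_mul_factorial m n
  have hm : (m.factorial : ℂ) ≠ 0 := by exact_mod_cast m.factorial_ne_zero
  have hn : (n.factorial : ℂ) ≠ 0 := by exact_mod_cast n.factorial_ne_zero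
  have hmn : ((m + n).factorial : ℂ) ≠ 0 := by exact_mod_cast (m + n).factorial_ne_zero
  rw [divPow, divPow, divPow, smul_mul_smul_comm, ← pow_add, ← Int.cast_smul_eq_zsmul ℂ, smul_smul]
  congr 1
  push_cast
  field_simp
  rw [← h]; ring

theorem eAlpha_mul_eBeta : eAlpha * eBeta = eBeta * eAlpha + eAlphaBeta := by
  have h : ⁅elem 0 1 (by decide), elem 1 2 (by decide)⁆ = elem 0 2 (by decide) := by
    apply Subtype.ext
    change (Matrix.single 0 1 (1 : ℂ)) * Matrix.single 1 2 1
      - (Matrix.single 1 2 (1 : ℂ)) * Matrix.single 0 1 1 = Matrix.single 0 2 1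
    simp
  have h2 := congrArg (UniversalEnvelopingAlgebra.ι ℂ) h
  rw [LieHom.map_lie, Ring.lie_def] at h2
  change eAlpha * eBeta - eBeta * eAlpha = eAlphaBeta at h2
  rw [← h2]; abel

theorem commute_eAlphaBeta_eAlpha : Commute eAlphaBeta eAlpha := by
  have h : ⁅elem 0 2 (by decide), elem 0 1 (by decide)⁆ = 0 := by
    apply Subtype.ext
    change (Matrix.single 0 2 (1 : ℂ)) * Matrix.single 0 1 1
      - (Matrix.single 0 1 (1 : ℂ)) * Matrix.single 0 2 1 = 0
    simp
  have h2 := congrArg (UniversalEnvelopingAlgebra.ι ℂ) h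
  rw [LieHom.map_lie, Ring.lie_def, map_zero] at h2
  exact sub_eq_zero.mp h2

theorem commute_eAlphaBeta_eBeta : Commute eAlphaBeta eBeta := by
  have h : ⁅elem 0 2 (by decide), elem 1 2 (by decide)⁆ = 0 := by
    apply Subtype.ext
    change (Matrix.single 0 2 (1 : ℂ)) * Matrix.single 1 2 1
      - (Matrix.single 1 2 (1 : ℂ)) * Matrix.single 0 2 1 = 0
    simp
  have h2 := congrArg (UniversalEnvelopingAlgebra.ι ℂ) h
  rw [LieHom.map_lie, Ring.lie_def, map_zero] at h2
  exact sub_eq_zero.mp h2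

theorem commute_divPow {x y : UC} (h : Commute x y) (m n : ℕ) :
    Commute (divPow x m) (divPow y n) :=
  ((h.pow_pow m n).smul_left _).smul_right _

/-- Divided powers with integral exponents; those with negative exponents vanish. -/
noncomputable def divPowZ (x : UC) (n : ℤ) : UC := if 0 ≤ n then divPow x n.toNat else 0

theorem divPowZ_natCast (x : UC) (n : ℕ) : divPowZ x n = divPow x n := by simp [divPowZ]

theorem divPowZ_of_neg (x : UC) {n : ℤ} (h : n < 0) : divPowZ x n = 0 := by
  simp [divPowZ, not_le.mpr h]

theorem mul_divPowZ (x : UC) (n : ℤ) : x * divPowZ x n = ((n + 1 : ℤ) : ℂ) • divPowZ x (n + 1) := by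
  rcases lt_trichotomy n (-1) with h | h | h
  · rw [divPowZ_of_neg _ (by omega), divPowZ_of_neg _ (by omega)]; simp
  · subst h; simp [divPowZ]
  · obtain ⟨m, rfl⟩ := Int.eq_ofNat_of_zero_le (show 0 ≤ n by omega)
    have := divPow_mul_divPow x 1 m
    rw [divPow_one] at this
    rw [← Nat.cast_succ, divPowZ_natCast, divPowZ_natCast, this, Int.cast_smul_eq_zsmul]
    simp [add_comm 1 m]

/-- The commutator with e_β acts on powers of e_α as -e_{α+β} d/de_α, because e_{α+β} commutes with
e_α; on divided powers differentiation is an index shift. -/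
theorem eBeta_mul_divPowZ (n : ℤ) :
    eBeta * divPowZ eAlpha n = divPowZ eAlpha n * eBeta - divPowZ eAlpha (n - 1) * eAlphaBeta := by
  rcases lt_or_ge n 0 with h | h
  · rw [divPowZ_of_neg _ h, divPowZ_of_neg _ (by omega)]; simp
  obtain ⟨m, rfl⟩ := Int.eq_ofNat_of_zero_le h
  induction m with
  | zero => rw [divPowZ_of_neg _ (by norm_num : ((0 : ℕ) : ℤ) - 1 < 0), divPowZ_natCast]
            simp [divPow_zero]
  | succ m ih =>
    have ih := ih (by omega)
    have h1 := mul_divPowZ eAlpha m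
    have h2 := mul_divPowZ eAlpha (m - 1)
    rw [sub_add_cancel] at h2
    have h0 : ((m : ℂ) + 1) ≠ 0 := by exact_mod_cast m.succ_ne_zero
    push_cast at h1 h2 ih ⊢
    rw [add_sub_cancel_right]
    have e1 : eBeta * eAlpha = eAlpha * eBeta - eAlphaBeta := by rw [eAlpha_mul_eBeta]; abel
    have hc : eAlphaBeta * divPowZ eAlpha m = divPowZ eAlpha m * eAlphaBeta := by
      rw [divPowZ_natCast]
      have := commute_divPow commute_eAlphaBeta_eAlpha 1 m
      rwa [divPow_one] at this
    -- The identity is proved after multiplication by m + 1, where (m + 1) e_α^{(m+1)} = e_α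
    -- e_α^{(m)} brings in the induction hypothesis; m + 1 is then cancelled over ℂ.
    have key : ((m : ℂ) + 1) • (eBeta * divPowZ eAlpha (m + 1))
        = ((m : ℂ) + 1) • (divPowZ eAlpha (m + 1) * eBeta - divPowZ eAlpha m * eAlphaBeta) := by
      rw [← mul_smul_comm, ← h1, ← mul_assoc, e1, sub_mul, mul_assoc, ih, mul_sub, ← mul_assoc,
        ← mul_assoc, h1, h2, hc, smul_sub, smul_mul_assoc, smul_mul_assoc]
      simp only [add_smul, one_smul]
      abel
    exact smul_right_injective _ h0 key

/-- Integral exponents make the out-of-range terms vanish by themselves, so the number `N` of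
summands can stay fixed during the induction on `k` and no truncated subtraction occurs. -/
theorem divPowZ_mul_divPowZ_eq_sum (k : ℕ) (i : ℤ) (N : ℕ) (hN : k < N) :
    divPowZ eBeta k * divPowZ eAlpha i = ∑ m ∈ Finset.range N, ((-1 : ℂ) ^ m) •
      (divPowZ eAlpha (i - m) * divPowZ eAlphaBeta m * divPowZ eBeta (k - m)) := by
  induction k with
  | zero =>
    rw [Finset.sum_eq_single_of_mem 0 (Finset.mem_range.mpr hN)]
    · rw [divPowZ_natCast, divPow_zero]
      simp [divPowZ, divPow_zero]
    · intro m _ hm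
      rw [divPowZ_of_neg eBeta (by have := Nat.pos_of_ne_zero hm; push_cast; omega)]
      simp
  | succ k ih =>
    have ih := ih (by omega)
    have h0 : ((k : ℂ) + 1) ≠ 0 := by exact_mod_cast k.succ_ne_zero
    have h1 := mul_divPowZ eBeta k
    push_cast at h1 ⊢
    apply smul_right_injective _ h0
    change ((k : ℂ) + 1) • _ = ((k : ℂ) + 1) • _
    -- Moving e_β past e_α^{(i-m)} creates an extra term, which is `U (m + 1)`. Since `U 0` and `U
    -- N` vanish, reindexing turns it into `U m`, and the coefficients (k + 1 - m) and m add up to k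
    -- + 1.
    let U : ℕ → UC := fun m => ((-1 : ℂ) ^ m * m) •
      (divPowZ eAlpha (i - m) * divPowZ eAlphaBeta m * divPowZ eBeta (k + 1 - m))
    have hU : ∑ m ∈ Finset.range N, U (m + 1) = ∑ m ∈ Finset.range N, U m := by
      have h3 := Finset.sum_range_succ' U N
      rw [Finset.sum_range_succ] at h3
      have h4 : U 0 = 0 := by simp [U]
      have h5 : U N = 0 := by
        simp only [U]
        rw [divPowZ_of_neg eBeta (by omega)]; simp
      rw [h4, h5, add_zero, add_zero] at h3
      exact h3.symm
    have hV : ∀ m : ℕ, eBeta * ((-1 : ℂ) ^ m •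
        (divPowZ eAlpha (i - m) * divPowZ eAlphaBeta m * divPowZ eBeta (k - m)))
        = ((-1 : ℂ) ^ m * ((k : ℂ) + 1 - m)) •
          (divPowZ eAlpha (i - m) * divPowZ eAlphaBeta m * divPowZ eBeta (k + 1 - m)) + U (m + 1) := by
      intro m
      have hc : eBeta * divPowZ eAlphaBeta m = divPowZ eAlphaBeta m * eBeta := by
        rw [divPowZ_natCast]
        have := (commute_divPow commute_eAlphaBeta_eBeta m 1).symm
        rwa [divPow_one] at this
      have h6 := mul_divPowZ eBeta (k - m)
      have h7 := mul_divPowZ eAlphaBeta m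
      simp only [U]
      push_cast at h6 h7 ⊢
      rw [show (k : ℤ) - m + 1 = k + 1 - m by ring] at h6
      rw [show (k : ℤ) + 1 - (m + 1) = k - m by ring, mul_smul_comm, ← mul_assoc, ← mul_assoc,
        eBeta_mul_divPowZ, sub_mul, sub_mul, mul_assoc (divPowZ eAlpha (i - m)) eBeta, hc,
        mul_assoc _ (_ * eBeta), mul_assoc _ eBeta, h6, mul_assoc _ eAlphaBeta, h7,
        show i - m - 1 = i - (m + 1) by ring]
      simp only [mul_smul_comm, smul_mul_assoc, smul_sub, smul_smul, mul_assoc]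
      rw [pow_succ, sub_eq_add_neg, ← neg_smul]
      congr 2 <;> ring
    rw [← smul_mul_assoc, ← h1, mul_assoc, ih, Finset.mul_sum, Finset.sum_congr rfl fun m _ => hV m,
      Finset.sum_add_distrib, hU, ← Finset.sum_add_distrib, Finset.smul_sum]
    refine Finset.sum_congr rfl fun m _ => ?_
    simp only [U]
    rw [← add_smul, smul_smul]
    congr 1; ring

theorem divPow_mul_divPow_eq_sum (k i : ℕ) :
    divPow eBeta k * divPow eAlpha i = ∑ m ∈ Finset.range (min k i + 1), ((-1 : ℤ) ^ m) •
      (divPow eAlpha (i - m) * divPow eAlphaBeta m * divPow eBeta (k - m)) := by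
  have h := divPowZ_mul_divPowZ_eq_sum k i (k + 1) (by omega)
  rw [divPowZ_natCast, divPowZ_natCast] at h
  rw [h, ← Finset.sum_subset (Finset.range_subset_range.mpr
    (show min k i + 1 ≤ k + 1 by omega))]
  · refine Finset.sum_congr rfl fun m hm => ?_
    rw [Finset.mem_range] at hm
    rw [← Nat.cast_sub (by omega), ← Nat.cast_sub (by omega), divPowZ_natCast, divPowZ_natCast,
      divPowZ_natCast, ← Int.cast_smul_eq_zsmul ℂ]
    push_cast; rfl
  · intro m hm hm'
    rw [Finset.mem_range] at hm hm'
    rw [divPowZ_of_neg eAlpha (by omega)]; simp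

/-- By centrality of e_{α+β} only the inner factor e_β^{(k)} e_α^{(i')} needs reordering; the
remaining divided powers of equal elements merge with binomial coefficients. As m ≤ min k i', none
of the subtractions truncates. -/
theorem divMon_mul_divMon (i j k i' j' k' : ℕ) :
    divMon i j k * divMon i' j' k' = ∑ m ∈ Finset.range (min k i' + 1),
      ((-1 : ℤ) ^ m * ((i + i' - m).choose i * ((j + j').choose j * (j + j' + m).choose m) *
        (k + k' - m).choose k' : ℕ)) • divMon (i + i' - m) (j + j' + m) (k + k' - m) := by
  have hg := commute_divPow commute_eAlphaBeta_eAlpha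
  have hb := commute_divPow commute_eAlphaBeta_eBeta
  have e : divMon i j k * divMon i' j' k' = divPow eAlpha i * (divPow eBeta k * divPow eAlpha i')
      * (divPow eAlphaBeta j * divPow eAlphaBeta j') * divPow eBeta k' := by
    simp only [divMon, mul_assoc]
    rw [(hb j k).left_comm, (hg j i').left_comm]
  rw [e, divPow_mul_divPow_eq_sum, Finset.mul_sum, Finset.sum_mul, Finset.sum_mul]
  refine Finset.sum_congr rfl fun m hm => ?_
  rw [Finset.mem_range] at hm
  have e2 : divPow eAlpha i * (divPow eAlpha (i' - m) * divPow eAlphaBeta m * divPow eBeta (k - m))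
      * (divPow eAlphaBeta j * divPow eAlphaBeta j') * divPow eBeta k'
      = (divPow eAlpha i * divPow eAlpha (i' - m)) *
        ((divPow eAlphaBeta j * divPow eAlphaBeta j') * divPow eAlphaBeta m)
        * (divPow eBeta (k - m) * divPow eBeta k') := by
    simp only [mul_assoc]
    rw [(hb j (k - m)).symm.left_comm, (hb j' (k - m)).symm.left_comm,
      (commute_divPow (Commute.refl eAlphaBeta) m j).left_comm,
      (commute_divPow (Commute.refl eAlphaBeta) m j').left_comm]
  rw [mul_smul_comm, smul_mul_assoc, smul_mul_assoc, e2, divPow_mul_divPow, divPow_mul_divPow,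
    divPow_mul_divPow, smul_mul_assoc ((_ : ℕ) : ℤ) (divPow eAlphaBeta _), divPow_mul_divPow, divMon,
    show i + (i' - m) = i + i' - m by omega, show k - m + k' = k + k' - m by omega,
    Nat.choose_symm_of_eq_add (show k + k' - m = (k - m) + k' by omega),
    Nat.choose_symm_add (a := j + j') (b := m)]
  simp only [smul_mul_assoc, mul_smul_comm, smul_smul]
  congr 1
  push_cast; ring

end Kostant

namespace Kostant

attribute [local instance] LieRing.ofAssociativeRing

/-! ## The basis of the Kostant form -/

section Representation

open MvPolynomial

/-- The operator `y - z ∂/∂x` on `ℂ[x, z, y]`. -/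
noncomputable def opBeta : Module.End ℂ (MvPolynomial (Fin 3) ℂ) :=
  LinearMap.mulLeft ℂ (X 2) - LinearMap.mulLeft ℂ (X 1) ∘ₗ (pderiv (R := ℂ) (0 : Fin 3)).toLinearMap

theorem opBeta_apply (f : MvPolynomial (Fin 3) ℂ) :
    opBeta f = X 2 * f - X 1 * pderiv 0 f := rfl

/-- The action of `sl₃⁺` on `ℂ[x, z, y]`: `e_α` acts as `x`, `e_{α+β}` as `z`, and `e_β` as
`y - z ∂/∂x`. -/
noncomputable def repLie : sl3Plus →ₗ⁅ℂ⁆ Module.End ℂ (MvPolynomial (Fin 3) ℂ) where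
  toFun M := (M : Matrix (Fin 3) (Fin 3) ℂ) 0 1 • LinearMap.mulLeft ℂ (X 0) +
    (M : Matrix (Fin 3) (Fin 3) ℂ) 1 2 • opBeta +
    (M : Matrix (Fin 3) (Fin 3) ℂ) 0 2 • LinearMap.mulLeft ℂ (X 1)
  map_add' M N := by
    have h (i j) : (M + N).1 i j = M.1 i j + N.1 i j := rfl
    simp only [h, add_smul]; abel
  map_smul' c M := by
    have h (i j) : (c • M).1 i j = c * M.1 i j := rfl
    simp only [h, mul_smul, smul_add, RingHom.id_apply]
  map_lie' := by
    intro M N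
    have hM := M.2
    have hN := N.2
    have e01 : (⁅M, N⁆ : sl3Plus).1 0 1 = 0 := by
      rw [LieSubalgebra.coe_bracket, Ring.lie_def, Matrix.sub_apply, Matrix.mul_apply,
        Matrix.mul_apply, Fin.sum_univ_three, Fin.sum_univ_three, hM 0 0 le_rfl, hN 0 0 le_rfl,
        hM 1 1 le_rfl, hN 1 1 le_rfl, hM 2 1 (by decide), hN 2 1 (by decide)]
      simp
    have e12 : (⁅M, N⁆ : sl3Plus).1 1 2 = 0 := by
      rw [LieSubalgebra.coe_bracket, Ring.lie_def, Matrix.sub_apply, Matrix.mul_apply,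
        Matrix.mul_apply, Fin.sum_univ_three, Fin.sum_univ_three, hM 2 2 le_rfl, hN 2 2 le_rfl,
        hM 1 1 le_rfl, hN 1 1 le_rfl, hM 1 0 (by decide), hN 1 0 (by decide)]
      simp
    have e02 : (⁅M, N⁆ : sl3Plus).1 0 2 = M.1 0 1 * N.1 1 2 - N.1 0 1 * M.1 1 2 := by
      rw [LieSubalgebra.coe_bracket, Ring.lie_def, Matrix.sub_apply, Matrix.mul_apply,
        Matrix.mul_apply, Fin.sum_univ_three, Fin.sum_univ_three, hM 2 2 le_rfl, hN 2 2 le_rfl,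
        hM 0 0 le_rfl, hN 0 0 le_rfl]
      simp
    rw [e01, e12, e02, zero_smul, zero_smul, zero_add, zero_add]
    refine LinearMap.ext fun f => ?_
    rw [Ring.lie_def]
    simp only [LinearMap.smul_apply, LinearMap.add_apply, LinearMap.sub_apply, Module.End.mul_apply,
      LinearMap.mulLeft_apply, opBeta_apply, map_add, map_sub, Derivation.leibniz,
      pderiv_X, smul_eq_mul, MvPolynomial.smul_eq_C_mul, C_mul, pderiv_C]
    simp only [Pi.single_eq_same, show Pi.single (M := fun _ : Fin 3 => MvPolynomial (Fin 3) ℂ) 0 1 1 = 0 from rfl,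
      show Pi.single (M := fun _ : Fin 3 => MvPolynomial (Fin 3) ℂ) 0 1 2 = 0 from rfl]
    ring

/-- The action of `𝔘₃⁺(ℂ)` on `ℂ[x, z, y]`. -/
noncomputable def rep : UC →ₐ[ℂ] Module.End ℂ (MvPolynomial (Fin 3) ℂ) :=
  UniversalEnvelopingAlgebra.lift ℂ repLie

theorem rep_eAlpha : rep eAlpha = LinearMap.mulLeft ℂ (X 0) := by
  rw [rep, eAlpha, UniversalEnvelopingAlgebra.lift_ι_apply]
  simp [repLie, elem]

theorem rep_eBeta : rep eBeta = opBeta := by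
  rw [rep, eBeta, UniversalEnvelopingAlgebra.lift_ι_apply]
  simp [repLie, elem]

theorem rep_eAlphaBeta : rep eAlphaBeta = LinearMap.mulLeft ℂ (X 1) := by
  rw [rep, eAlphaBeta, UniversalEnvelopingAlgebra.lift_ι_apply]
  simp [repLie, elem]

theorem opBeta_pow_one (k : ℕ) : (opBeta ^ k) 1 = X 2 ^ k := by
  induction k with
  | zero => simp
  | succ k ih =>
    rw [pow_succ', Module.End.mul_apply, ih, opBeta_apply, Derivation.leibniz_pow, pderiv_X]
    simp only [show Pi.single (M := fun _ : Fin 3 => MvPolynomial (Fin 3) ℂ) 0 1 2 = 0 from rfl]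
    simp [pow_succ']

/-- The exponent vector of `x^i z^j y^k`. -/
noncomputable def expVec (t : ℕ × ℕ × ℕ) : Fin 3 →₀ ℕ :=
  Finsupp.single 0 t.1 + Finsupp.single 1 t.2.1 + Finsupp.single 2 t.2.2

theorem expVec_injective : Function.Injective expVec := by
  rintro ⟨i, j, k⟩ ⟨i', j', k'⟩ h
  have h0 := DFunLike.congr_fun h 0
  have h1 := DFunLike.congr_fun h 1
  have h2 := DFunLike.congr_fun h 2
  simp [expVec] at h0 h1 h2
  simp [h0, h1, h2]

theorem rep_divMon_one (t : ℕ × ℕ × ℕ) :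
    rep (divMon t.1 t.2.1 t.2.2) 1 =
      ((t.1.factorial : ℂ)⁻¹ * (t.2.1.factorial : ℂ)⁻¹ * (t.2.2.factorial : ℂ)⁻¹) •
        monomial (expVec t) (1 : ℂ) := by
  have h (i j k : ℕ) : X 0 ^ i * (X 1 ^ j * X 2 ^ k) = monomial (expVec (i, j, k)) (1 : ℂ) := by
    simp [X_pow_eq_monomial, monomial_mul, expVec, add_assoc]
  simp only [divMon, divPow, map_mul, map_smul, map_pow, rep_eAlpha, rep_eBeta, rep_eAlphaBeta,
    Module.End.mul_apply, LinearMap.smul_apply, opBeta_pow_one, LinearMap.pow_mulLeft,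
    LinearMap.mulLeft_apply, smul_smul, ← h]
  congr 1
  ring

/-- Applied to the polynomial 1, these elements give non-zero multiples of distinct monomials: the
powers of `opBeta` produce only powers of y, on which ∂/∂x vanishes. -/
theorem linearIndependent_divMon :
    LinearIndependent ℂ fun t : ℕ × ℕ × ℕ => divMon t.1 t.2.1 t.2.2 := by
  let ev : UC →ₗ[ℂ] MvPolynomial (Fin 3) ℂ := (LinearMap.applyₗ (1 : MvPolynomial (Fin 3) ℂ)) ∘ₗ
    rep.toLinearMap
  refine LinearIndependent.of_comp ev ?_
  have h0 (n : ℕ) : (n.factorial : ℂ)⁻¹ ≠ 0 := inv_ne_zero (by exact_mod_cast n.factorial_ne_zero)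
  have h1 : LinearIndependent ℂ fun t : ℕ × ℕ × ℕ => monomial (expVec t) (1 : ℂ) := by
    have := (basisMonomials (Fin 3) ℂ).linearIndependent.comp expVec expVec_injective
    rwa [coe_basisMonomials] at this
  have h2 := h1.units_smul fun t => Units.mk0 _
    (mul_ne_zero (mul_ne_zero (h0 t.1) (h0 t.2.1)) (h0 t.2.2))
  convert h2 using 1
  funext t
  exact rep_divMon_one t

end Representation

theorem linearIndependent_divMonZ :
    LinearIndependent ℤ fun t : ℕ × ℕ × ℕ => divMonZ t.1 t.2.1 t.2.2 := by
  refine LinearIndependent.of_comp kostantZ.val.toLinearMap ?_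
  exact linearIndependent_divMon.restrict_scalars (R := ℤ) (by
    intro a b h; simpa using h)

/-- The multiplication table has integral coefficients, so the lattice is already a subring. -/
theorem span_divMon_eq :
    Submodule.span ℤ (Set.range fun t : ℕ × ℕ × ℕ => divMon t.1 t.2.1 t.2.2)
      = Subalgebra.toSubmodule kostantZ := by
  have hone : (1 : UC) ∈ Submodule.span ℤ
      (Set.range fun t : ℕ × ℕ × ℕ => divMon t.1 t.2.1 t.2.2) :=
    Submodule.subset_span ⟨(0, 0, 0), by simp [divMon, divPow_zero]⟩
  have hmul : ∀ x y : UC, x ∈ Submodule.span ℤ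
      (Set.range fun t : ℕ × ℕ × ℕ => divMon t.1 t.2.1 t.2.2) → y ∈ Submodule.span ℤ
      (Set.range fun t : ℕ × ℕ × ℕ => divMon t.1 t.2.1 t.2.2) → x * y ∈ Submodule.span ℤ
      (Set.range fun t : ℕ × ℕ × ℕ => divMon t.1 t.2.1 t.2.2) := by
    intro x y hx hy
    refine Submodule.span_induction₂ (p := fun a b _ _ => a * b ∈ Submodule.span ℤ
      (Set.range fun t : ℕ × ℕ × ℕ => divMon t.1 t.2.1 t.2.2)) ?_ ?_ ?_ ?_ ?_ ?_ ?_ hx hy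
    · rintro _ _ ⟨s, rfl⟩ ⟨t, rfl⟩
      simp only [divMon_mul_divMon]
      exact Submodule.sum_mem _ fun m _ => Submodule.smul_mem _ _
        (Submodule.subset_span ⟨(_, _, _), rfl⟩)
    · intro y _; rw [zero_mul]; exact zero_mem _
    · intro y _; rw [mul_zero]; exact zero_mem _
    · intro x y z _ _ _ h1 h2; rw [add_mul]; exact add_mem h1 h2
    · intro x y z _ _ _ h1 h2; rw [mul_add]; exact add_mem h1 h2
    · intro r x y _ _ h; rw [smul_mul_assoc]; exact Submodule.smul_mem _ _ h
    · intro r x y _ _ h; rw [mul_smul_comm]; exact Submodule.smul_mem _ _ h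
  apply le_antisymm
  · rw [Submodule.span_le]
    exact Algebra.subset_adjoin
  · have : kostantZ ≤ Submodule.toSubalgebra _ hone hmul :=
      Algebra.adjoin_le Submodule.subset_span
    exact this

/-- The basis `e_α^{(i)} e_{α+β}^{(j)} e_β^{(k)}` of `𝔘₃⁺(ℤ)`. -/
noncomputable def basisZ : Module.Basis (ℕ × ℕ × ℕ) ℤ kostantZ :=
  Module.Basis.mk linearIndependent_divMonZ (by
    intro x _
    have hx : (x : UC) ∈ Submodule.span ℤ
        (Set.range fun t : ℕ × ℕ × ℕ => divMon t.1 t.2.1 t.2.2) := by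
      rw [span_divMon_eq]; exact x.2
    have h2 : Set.range (fun t : ℕ × ℕ × ℕ => divMon t.1 t.2.1 t.2.2) =
        kostantZ.val.toLinearMap '' Set.range fun t : ℕ × ℕ × ℕ => divMonZ t.1 t.2.1 t.2.2 := by
      rw [← Set.range_comp]; rfl
    rw [h2, Submodule.span_image] at hx
    obtain ⟨y, hy, hxy⟩ := hx
    rwa [show x = y from Subtype.ext hxy.symm])

theorem basisZ_apply (t : ℕ × ℕ × ℕ) : basisZ t = divMonZ t.1 t.2.1 t.2.2 := by
  simp [basisZ]

theorem divMonZ_mul_divMonZ (i j k i' j' k' : ℕ) :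
    divMonZ i j k * divMonZ i' j' k' = ∑ m ∈ Finset.range (min k i' + 1),
      ((-1 : ℤ) ^ m * ((i + i' - m).choose i * ((j + j').choose j * (j + j' + m).choose m) *
        (k + k' - m).choose k' : ℕ)) • divMonZ (i + i' - m) (j + j' + m) (k + k' - m) := by
  apply Subtype.ext
  have := divMon_mul_divMon i j k i' j' k'
  rw [AddSubmonoidClass.coe_finsetSum]
  exact this

variable (K : Type u) [Field K]

/-- The basis `e_α^{(i)} e_{α+β}^{(j)} e_β^{(k)}` of `𝔘₃⁺(K)`. -/
noncomputable def basisK : Module.Basis (ℕ × ℕ × ℕ) K (KostantForm K) :=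
  Algebra.TensorProduct.basis K basisZ

theorem basisK_apply (t : ℕ × ℕ × ℕ) : basisK K t = basisElt K t.1 t.2.1 t.2.2 := by
  rw [basisK, Algebra.TensorProduct.basis_apply, basisZ_apply]; rfl

theorem basisElt_zero : basisElt K 0 0 0 = 1 := by
  rw [basisElt, show divMonZ 0 0 0 = 1 from Subtype.ext (by simp [divMonZ, divMon, divPow_zero])]
  rfl

theorem basisElt_mul_basisElt (i j k i' j' k' : ℕ) :
    basisElt K i j k * basisElt K i' j' k' = ∑ m ∈ Finset.range (min k i' + 1),
      ((-1 : K) ^ m * ((i + i' - m).choose i * ((j + j').choose j * (j + j' + m).choose m) *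
        (k + k' - m).choose k' : ℕ)) • basisElt K (i + i' - m) (j + j' + m) (k + k' - m) := by
  rw [basisElt, basisElt, Algebra.TensorProduct.tmul_mul_tmul, mul_one, divMonZ_mul_divMonZ,
    TensorProduct.tmul_sum]
  refine Finset.sum_congr rfl fun m _ => ?_
  rw [← TensorProduct.smul_tmul, basisElt, TensorProduct.smul_tmul', ← Int.cast_smul_eq_zsmul K]
  push_cast
  rfl

theorem aug_basisElt (i j k : ℕ) :
    aug K (basisElt K i j k) = if (i, j, k) = ((0, 0, 0) : ℕ × ℕ × ℕ) then 1 else 0 := by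
  have h : augZ (divMonZ i j k) = if (i, j, k) = ((0, 0, 0) : ℕ × ℕ × ℕ) then 1 else 0 := by
    have h1 : ((augZ (divMonZ i j k) : ℤ) : ℂ) = augC (divMon i j k) := by
      have h2 := (Algebra.botEquivOfInjective (R := ℤ) (A := ℂ)
        (by intro a b h; simpa using h)).symm_apply_apply
        ⟨augC (divMon i j k), augC_mem_bot (divMonZ i j k)⟩
      exact congrArg Subtype.val h2
    have h3 : augC (divMon i j k) = if (i, j, k) = ((0, 0, 0) : ℕ × ℕ × ℕ) then 1 else 0 := by
      rw [divMon, map_mul, map_mul, eAlpha, eBeta, eAlphaBeta, augC_divPow_iota, augC_divPow_iota,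
        augC_divPow_iota]
      by_cases hi : i = 0 <;> by_cases hj : j = 0 <;> by_cases hk : k = 0 <;> simp [hi, hj, hk]
    rw [h3] at h1
    split_ifs at h1 ⊢ <;> exact_mod_cast h1
  rw [aug, basisElt, Algebra.TensorProduct.lift_tmul, map_one, one_mul, AlgHom.comp_apply, h]
  split_ifs <;> simp

end Kostant

namespace Kostant

/-! ## Binomial coefficients modulo `p` -/

section Lucas

variable (K : Type u) [Field K] (p : ℕ) [Fact p.Prime] [CharP K p]

theorem natCast_choose_lucas (n k : ℕ) :
    ((n.choose k : ℕ) : K) = ((n % p).choose (k % p) : ℕ) * ((n / p).choose (k / p) : ℕ) := by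
  rw [← Nat.cast_mul]
  exact (CharP.natCast_eq_natCast K p).mpr Choose.choose_modEq_choose_mod_mul_choose_div_nat

/-- Lucas' congruence, applied once for each of the `k` lowest base p digits. -/
theorem natCast_choose_pow (k m n r s : ℕ) (hr : r < p ^ k) (hs : s < p ^ k) :
    (((m * p ^ k + r).choose (n * p ^ k + s) : ℕ) : K) = (m.choose n : ℕ) * (r.choose s : ℕ) := by
  have hp : 0 < p := (Fact.out : p.Prime).pos
  induction k generalizing r s with
  | zero =>
    obtain rfl : r = 0 := by simpa using hr
    obtain rfl : s = 0 := by simpa using hs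
    simp
  | succ k ih =>
    have hmod (a b : ℕ) : (a * p ^ (k + 1) + b) % p = b % p := by
      rw [pow_succ, ← mul_assoc, Nat.mul_add_mod']
    have hdiv (a b : ℕ) : (a * p ^ (k + 1) + b) / p = a * p ^ k + b / p := by
      rw [pow_succ, ← mul_assoc, add_comm, Nat.add_mul_div_right _ _ hp, add_comm]
    rw [natCast_choose_lucas K p, hmod, hmod, hdiv, hdiv, ih, natCast_choose_lucas K p r s]
    · ring
    · rw [Nat.div_lt_iff_lt_mul hp, ← pow_succ]; exact hr
    · rw [Nat.div_lt_iff_lt_mul hp, ← pow_succ]; exact hs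

theorem natCast_choose_mul_pow (k m n : ℕ) :
    (((m * p ^ k).choose (n * p ^ k) : ℕ) : K) = (m.choose n : ℕ) := by
  have hp : 0 < p ^ k := pow_pos (Fact.out : p.Prime).pos k
  simpa using natCast_choose_pow K p k m n 0 0 hp hp

theorem natCast_factorial_pred : (((p - 1).factorial : ℕ) : K) = -1 := by
  have h := congrArg (ZMod.castHom (dvd_refl p) K) (ZMod.wilsons_lemma p)
  rwa [map_natCast, map_neg, map_one] at h

/-- If `1 ≤ m ≤ q` and `q = p ^ k` then `binom (c q - m) (q - m) = 1` in `K`. -/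
theorem choose_sub_sub (c k m : ℕ) (hc : 0 < c) (hm : 0 < m) (hmq : m ≤ p ^ k) :
    (((c * p ^ k - m).choose (p ^ k - m) : ℕ) : K) = 1 := by
  obtain ⟨c, rfl⟩ := Nat.exists_eq_add_of_le' hc
  -- With c + 1 in place of c, both entries have remainder p ^ k - m modulo p ^ k, which is a proper
  -- remainder because m is positive; the quotients are c and 0.
  have h := natCast_choose_pow K p k c 0 (p ^ k - m) (p ^ k - m) (by omega) (by omega)
  have e : (c + 1) * p ^ k - m = c * p ^ k + (p ^ k - m) := by
    rw [Nat.succ_mul]; omega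
  rw [e]
  simpa using h

/-- Removing the common factor p ^ k leaves binom(p^{l-k}, c) with 0 < c < p ≤ p^{l-k}, which is
divisible by p. -/
theorem natCast_choose_pow_eq_zero (k l c : ℕ) (hkl : k < l) (hc : 0 < c) (hcp : c < p) :
    (((p ^ l).choose (c * p ^ k) : ℕ) : K) = 0 := by
  have h : p ^ l = p ^ (l - k) * p ^ k := by rw [← pow_add]; congr 1; omega
  rw [h, natCast_choose_mul_pow K p, CharP.cast_eq_zero_iff K p]
  refine (Fact.out : p.Prime).dvd_choose_pow hc.ne' fun h => ?_
  have := Nat.le_self_pow (show l - k ≠ 0 by omega) p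
  omega

theorem choose_two_mul_sub (k m : ℕ) (hm : 0 < m) (hmq : m ≤ p ^ k) :
    (((2 * p ^ k - m).choose (p ^ k) : ℕ) : K) = 1 := by
  have h := choose_sub_sub K p 2 k m two_pos hm hmq
  rw [← Nat.choose_symm (by omega)] at h
  rwa [show 2 * p ^ k - m - (p ^ k - m) = p ^ k by omega] at h

end Lucas

/-! ## Sequences of divided powers -/

section DividedPowers

variable {K : Type u} [Field K] {A : Type u} [Ring A] [Algebra K A]

/-- The sequence `x` multiplies like the sequence of divided powers of one element. -/
structure IsDivPowSeq (K : Type u) [Field K] {A : Type u} [Ring A] [Algebra K A] (x : ℕ → A) :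
    Prop where
  zero : x 0 = 1
  mul : ∀ m n, x m * x n = (((m + n).choose m : ℕ) : K) • x (m + n)

variable {x : ℕ → A} (hx : IsDivPowSeq K x)

include hx in
theorem IsDivPowSeq.commute (m n : ℕ) : Commute (x m) (x n) := by
  rw [Commute, SemiconjBy, hx.mul, hx.mul, add_comm n m, Nat.choose_symm_add]

variable (p : ℕ) [hp : Fact p.Prime] [CharP K p]

include hx in
theorem IsDivPowSeq.pow_eq (k n : ℕ) :
    x (p ^ k) ^ n = ((n.factorial : ℕ) : K) • x (n * p ^ k) := by
  induction n with
  | zero => simp [hx.zero]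
  | succ n ih =>
    have h := natCast_choose_mul_pow K p k (n + 1) n
    rw [pow_succ, ih, smul_mul_assoc, hx.mul, smul_smul, ← Nat.succ_mul, h, Nat.factorial_succ,
      Nat.choose_succ_self_right, ← Nat.cast_mul, mul_comm]

include hx in
-- The last multiplication contributes binom(pj, j) = p · binom(pj - 1, j - 1). Indices j that are
-- not powers of p are needed for the powers of e_{α+β} in the braid relation.
theorem IsDivPowSeq.pow_prime {j : ℕ} (hj : j ≠ 0) : x j ^ p = 0 := by
  have h : ∀ n, ∃ c : K, x j ^ n = c • x (n * j) := by
    intro n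
    induction n with
    | zero => exact ⟨1, by simp [hx.zero]⟩
    | succ n ih =>
      obtain ⟨c, hc⟩ := ih
      exact ⟨_, by rw [pow_succ, hc, smul_mul_assoc, hx.mul, smul_smul, ← Nat.succ_mul]⟩
  obtain ⟨c, hc⟩ := h (p - 1)
  have hp1 : p - 1 + 1 = p := Nat.succ_pred_prime hp.out
  have h0 : (((p * j).choose ((p - 1) * j) : ℕ) : K) = 0 := by
    rw [CharP.cast_eq_zero_iff K p]
    have h1 := Nat.add_one_mul_choose_eq (p * j - 1) (j - 1)
    have hpos : 0 < p * j := Nat.mul_pos hp.out.pos (Nat.pos_of_ne_zero hj)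
    rw [Nat.sub_add_cancel hpos, Nat.sub_add_cancel (Nat.pos_of_ne_zero hj), mul_comm p j,
      mul_assoc, mul_comm _ j] at h1
    have h2 := Nat.eq_of_mul_eq_mul_left (Nat.pos_of_ne_zero hj) h1
    have h3 : (p * j).choose ((p - 1) * j) = (j * p).choose j := by
      rw [mul_comm j p]
      apply Nat.choose_symm_of_eq_add
      rw [← Nat.succ_mul, Nat.succ_eq_add_one, hp1]
    rw [h3, ← h2]
    exact dvd_mul_right _ _
  have h4 : (p - 1) * j + j = p * j := by rw [← Nat.succ_mul, Nat.succ_eq_add_one, hp1]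
  rw [← hp1, pow_succ, hc, smul_mul_assoc, hx.mul, h4, h0, zero_smul, smul_zero]

include hx in
-- Wilson's theorem; this is the source of the signs in the relations of `G`.
theorem IsDivPowSeq.pow_pred (k : ℕ) : x (p ^ k) ^ (p - 1) = (-1 : K) • x ((p - 1) * p ^ k) := by
  rw [hx.pow_eq p, natCast_factorial_pred]

include hx in
-- The number p^{k+n} - p^k has digit p - 1 in the positions k, …, k + n - 1 and 0 elsewhere. Adding
-- these digits one at a time causes no carry, so all binomial coefficients are 1 and only the signs
-- from Wilson's theorem remain.
theorem IsDivPowSeq.prod_pow_pred (k n : ℕ) :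
    ((List.range' k n).map fun s => x (p ^ s) ^ (p - 1)).prod =
      (-1 : K) ^ n • x (p ^ (k + n) - p ^ k) := by
  induction n with
  | zero => simp [hx.zero]
  | succ n ih =>
    have hle : p ^ k ≤ p ^ (k + n) := Nat.pow_le_pow_right hp.out.pos (by omega)
    have hpos : 0 < p ^ k := pow_pos hp.out.pos k
    have h1 : p ^ (k + n) - p ^ k + (p - 1) * p ^ (k + n) = p ^ (k + (n + 1)) - p ^ k := by
      have : (p - 1) * p ^ (k + n) + p ^ (k + n) = p ^ (k + (n + 1)) := by
        rw [← Nat.succ_mul, Nat.succ_eq_add_one, Nat.sub_add_cancel hp.out.pos, ← add_assoc,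
          pow_succ, mul_comm]
      omega
    have h2 : (((p ^ (k + (n + 1)) - p ^ k).choose (p ^ (k + n) - p ^ k) : ℕ) : K) = 1 := by
      rw [← h1, add_comm]
      have := natCast_choose_pow K p (k + n) (p - 1) 0 (p ^ (k + n) - p ^ k) (p ^ (k + n) - p ^ k)
        (by omega) (by omega)
      simpa using this
    rw [List.range'_1_concat, List.map_append, List.prod_append, ih]
    simp only [List.map_cons, List.map_nil, List.prod_singleton]
    rw [hx.pow_pred p, smul_mul_smul_comm, hx.mul, h1, h2, one_smul, pow_succ]

end DividedPowers

/-! ## The relations between the generators of `𝔘₃⁺(K)` -/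

section Relations

variable {K : Type u} [Field K] {A : Type u} [Ring A] [Algebra K A]

/-- A basis of `A` which multiplies like the basis `e_α^{(i)} e_{α+β}^{(j)} e_β^{(k)}` of the
Kostant form. -/
structure DivPowBasis (K : Type u) [Field K] (A : Type u) [Ring A] [Algebra K A] where
  /-- The basis. -/
  basis : Module.Basis (ℕ × ℕ × ℕ) K A
  one : basis (0, 0, 0) = 1
  mul : ∀ i j k i' j' k', basis (i, j, k) * basis (i', j', k') =
    ∑ m ∈ Finset.range (min k i' + 1), ((-1 : K) ^ m *
      ((i + i' - m).choose i * ((j + j').choose j * (j + j' + m).choose m) *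
        (k + k' - m).choose k' : ℕ)) • basis (i + i' - m, j + j' + m, k + k' - m)

namespace DivPowBasis

/-- The basis elements. -/
noncomputable def E (H : DivPowBasis K A) (i j k : ℕ) : A := H.basis (i, j, k)

variable (H : DivPowBasis K A)

theorem E_zero : H.E 0 0 0 = 1 := H.one

theorem E_mul_E (i j k i' j' k' : ℕ) :
    H.E i j k * H.E i' j' k' = ∑ m ∈ Finset.range (min k i' + 1),
      ((-1 : K) ^ m * ((i + i' - m).choose i * ((j + j').choose j * (j + j' + m).choose m) *
        (k + k' - m).choose k' : ℕ)) • H.E (i + i' - m) (j + j' + m) (k + k' - m) :=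
  H.mul i j k i' j' k'

include H in
theorem nontrivial : Nontrivial A := ⟨_, _, H.basis.ne_zero (0, 0, 0)⟩

theorem E_mul_of_eq_zero (i j k i' j' k' : ℕ) (h : k = 0 ∨ i' = 0) :
    H.E i j k * H.E i' j' k' =
      (((i + i').choose i * (j + j').choose j * (k + k').choose k' : ℕ) : K) •
        H.E (i + i') (j + j') (k + k') := by
  have : min k i' = 0 := by rcases h with rfl | rfl <;> simp
  rw [H.E_mul_E, this]
  simp [mul_assoc]

theorem E_eq_mul (i j k : ℕ) :
    H.E i j k = H.E i 0 0 * H.E 0 j 0 * H.E 0 0 k := by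
  rw [H.E_mul_of_eq_zero _ _ _ _ _ _ (Or.inl rfl), smul_mul_assoc,
    H.E_mul_of_eq_zero _ _ _ _ _ _ (Or.inl rfl)]
  simp

theorem isDivPowSeq_alpha : IsDivPowSeq K fun n => H.E n 0 0 where
  zero := H.E_zero
  mul m n := by rw [H.E_mul_of_eq_zero _ _ _ _ _ _ (Or.inl rfl)]; simp

theorem isDivPowSeq_gamma : IsDivPowSeq K fun n => H.E 0 n 0 where
  zero := H.E_zero
  mul m n := by rw [H.E_mul_of_eq_zero _ _ _ _ _ _ (Or.inl rfl)]; simp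

theorem isDivPowSeq_beta : IsDivPowSeq K fun n => H.E 0 0 n where
  zero := H.E_zero
  mul m n := by
    rw [H.E_mul_of_eq_zero _ _ _ _ _ _ (Or.inr rfl)]; simp; rw [Nat.choose_symm_add]

theorem alpha_mul_beta (i k : ℕ) : H.E i 0 0 * H.E 0 0 k = H.E i 0 k := by
  rw [H.E_mul_of_eq_zero _ _ _ _ _ _ (Or.inl rfl)]; simp

theorem beta_mul_alpha (k i : ℕ) :
    H.E 0 0 k * H.E i 0 0 = ∑ m ∈ Finset.range (min k i + 1),
      (-1 : K) ^ m • H.E (i - m) m (k - m) := by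
  rw [H.E_mul_E]
  simp

theorem commute_gamma (n i j k : ℕ) : Commute (H.E 0 n 0) (H.E i j k) := by
  rw [Commute, SemiconjBy, H.E_mul_of_eq_zero _ _ _ _ _ _ (Or.inl rfl),
    H.E_mul_of_eq_zero _ _ _ _ _ _ (Or.inr rfl), add_comm n j]
  simp [Nat.choose_symm_add]

/-- When the outer exponents agree, exchanging the two factors merely permutes the binomial
coefficients in the table. -/
theorem commute_weight_zero (n j n' j' : ℕ) :
    Commute (H.E n j n) (H.E n' j' n') := by
  rw [Commute, SemiconjBy, H.E_mul_E, H.E_mul_E, min_comm n' n,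
    add_comm n' n, add_comm j' j]
  refine Finset.sum_congr rfl fun m _ => ?_
  rw [Nat.choose_symm_add]
  congr 3
  ring

variable (p : ℕ) [hp : Fact p.Prime] [CharP K p]

/-- With q = p^k, the product b_k a_k is a_k b_k plus signed terms e_{α+β}^{(m)} e_α^{(q-m)}
e_β^{(q-m)} with m ≥ 1. All of them commute, so the p-th power is additive in characteristic p, and
it kills the terms with m ≥ 1 because (e_{α+β}^{(m)})^p = 0. -/
theorem relation_braid (k : ℕ) :
    (H.E 0 0 (p ^ k) * H.E (p ^ k) 0 0) ^ p =
      (H.E (p ^ k) 0 0 * H.E 0 0 (p ^ k)) ^ p := by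
  have hcomm : ∀ s : Finset ℕ, Commute (H.E (p ^ k) 0 (p ^ k)) (∑ m ∈ s,
      (-1 : K) ^ (m + 1) • H.E (p ^ k - (m + 1)) (m + 1) (p ^ k - (m + 1))) := fun s =>
    Commute.sum_right _ _ _ fun m _ => (H.commute_weight_zero _ _ _ _).smul_right _
  have := H.nontrivial
  have hA : CharP A p := charP_of_injective_algebraMap (algebraMap K A).injective p
  have hz : ∀ n : ℕ, (∑ m ∈ Finset.range n,
      (-1 : K) ^ (m + 1) • H.E (p ^ k - (m + 1)) (m + 1) (p ^ k - (m + 1))) ^ p = 0 := by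
    intro n
    induction n with
    | zero => simp [hp.out.ne_zero]
    | succ n ih =>
      rw [Finset.sum_range_succ, add_pow_char_of_commute p (Commute.sum_left _ _ _ fun m _ =>
        ((H.commute_weight_zero _ _ _ _).smul_right _).smul_left _), ih, zero_add, smul_pow]
      have hg := H.isDivPowSeq_gamma.pow_prime p n.succ_ne_zero
      have e : H.E (p ^ k - (n + 1)) (n + 1) (p ^ k - (n + 1)) =
          H.E 0 (n + 1) 0 * H.E (p ^ k - (n + 1)) 0 (p ^ k - (n + 1)) := by
        rw [H.E_mul_of_eq_zero _ _ _ _ _ _ (Or.inl rfl)]; simp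
      rw [e, (H.commute_gamma _ _ _ _).mul_pow]
      simp only [Nat.succ_eq_add_one] at hg
      rw [hg, zero_mul, smul_zero]
  rw [H.beta_mul_alpha, H.alpha_mul_beta, Finset.sum_range_succ', add_comm]
  simp only [pow_zero, one_smul, Nat.sub_zero]
  rw [add_pow_char_of_commute p (hcomm _), hz, add_zero]

/-- Up to sign the product on the right is e_β^{(p^l - p^k)}. Multiplying the expansion of b_k a_k
by it kills the leading term, since binom(p^l, p^k) vanishes in `K`, and multiplies every other term
by the coefficient 1, which reproduces the commutator. -/
theorem relation_ba (k l : ℕ) (h : k < l) :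
    H.E 0 0 (p ^ l) * H.E (p ^ k) 0 0 - H.E (p ^ k) 0 0 * H.E 0 0 (p ^ l) =
    (-1) ^ (l - k) * (H.E 0 0 (p ^ k) * H.E (p ^ k) 0 0 *
      ((List.range' k (l - k)).map fun s => H.E 0 0 (p ^ s) ^ (p - 1)).prod) := by
  have hle : p ^ k ≤ p ^ l := Nat.pow_le_pow_right hp.out.pos h.le
  have hpos : 0 < p ^ k := pow_pos hp.out.pos k
  rw [H.isDivPowSeq_beta.prod_pow_pred p, mul_smul_comm,
    show ((-1 : A) ^ (l - k)) = algebraMap K _ ((-1) ^ (l - k)) by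
      rw [map_pow, map_neg, map_one],
    ← Algebra.smul_def, smul_smul, ← mul_pow, neg_one_mul, neg_neg, one_pow, one_smul,
    show k + (l - k) = l by omega, H.beta_mul_alpha, H.beta_mul_alpha, H.alpha_mul_beta, min_self,
    min_eq_right hle, Finset.sum_range_succ', Finset.sum_range_succ', add_mul, Finset.sum_mul]
  simp only [pow_zero, one_smul, Nat.sub_zero, add_sub_cancel_right]
  have h0 : H.E (p ^ k) 0 (p ^ k) * H.E 0 0 (p ^ l - p ^ k) = 0 := by
    rw [H.E_mul_of_eq_zero _ _ _ _ _ _ (Or.inr rfl), Nat.add_sub_cancel' hle,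
      Nat.choose_symm hle]
    have := natCast_choose_pow_eq_zero K p k l 1 h one_pos hp.out.one_lt
    rw [one_mul] at this
    simp [this]
  rw [h0, add_zero]
  refine Finset.sum_congr rfl fun m hm => ?_
  rw [Finset.mem_range] at hm
  have e : p ^ l = p ^ (l - k) * p ^ k := by rw [← pow_add]; congr 1; omega
  have h1 := choose_sub_sub K p (p ^ (l - k)) k (m + 1) (pow_pos hp.out.pos _) (by omega) (by omega)
  rw [← e, ← Nat.choose_symm (by omega),
    show p ^ l - (m + 1) - (p ^ k - (m + 1)) = p ^ l - p ^ k by omega] at h1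
  rw [smul_mul_assoc, H.E_mul_of_eq_zero _ _ _ _ _ _ (Or.inr rfl),
    show p ^ k - (m + 1) + (p ^ l - p ^ k) = p ^ l - (m + 1) by omega]
  simp [h1]

/-- The exponent p^l of e_α is divided between both sides of b_k: a_k^{p-1} stands on the left, and
a_k times the product of higher powers on the right. As in `relation_ba`, the leading term
disappears, here by binom(p^l, (p-1)p^k) = 0, and all other coefficients are 1. -/
theorem relation_ab (k l : ℕ) (h : k < l) :
    H.E (p ^ l) 0 0 * H.E 0 0 (p ^ k) - H.E 0 0 (p ^ k) * H.E (p ^ l) 0 0 =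
    -((-1) ^ (l - k) * (H.E (p ^ k) 0 0 ^ (p - 1) * H.E 0 0 (p ^ k) *
      H.E (p ^ k) 0 0 *
      ((List.range' (k + 1) (l - (k + 1))).map fun s => H.E (p ^ s) 0 0 ^ (p - 1)).prod)) := by
  have hle : p ^ (k + 1) ≤ p ^ l := Nat.pow_le_pow_right hp.out.pos h
  have hlt : p ^ k < p ^ (k + 1) := Nat.pow_lt_pow_right hp.out.one_lt (by omega)
  have hpos : 0 < p ^ k := pow_pos hp.out.pos k
  have hp2 := hp.out.two_le
  have hmul : (p - 1) * p ^ k + p ^ k = p ^ (k + 1) := by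
    rw [← Nat.succ_mul, Nat.succ_eq_add_one, Nat.sub_add_cancel hp.out.pos, pow_succ, mul_comm]
  have el : p ^ l = p ^ (l - (k + 1)) * p ^ (k + 1) := by rw [← pow_add]; congr 1; omega
  have el' : p ^ l = p ^ (l - k) * p ^ k := by rw [← pow_add]; congr 1; omega
  have e1 : H.E (p ^ k) 0 0 * H.E (p ^ l - p ^ (k + 1)) 0 0 =
      H.E (p ^ l - p ^ (k + 1) + p ^ k) 0 0 := by
    have h1 : ((((p ^ (l - (k + 1)) - 1) * p ^ (k + 1) + p ^ k).choose (0 * p ^ (k + 1) + p ^ k) : ℕ)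
        : K) = 1 := by
      rw [natCast_choose_pow K p _ _ _ _ _ hlt hlt]; simp
    rw [Nat.sub_mul, ← el, one_mul, zero_mul, zero_add] at h1
    rw [H.E_mul_of_eq_zero _ _ _ _ _ _ (Or.inl rfl), add_comm (p ^ k)]
    simp [h1]
  have e2 : ((-1 : A) ^ (l - k)) * (H.E (p ^ k) 0 0 ^ (p - 1) *
      H.E 0 0 (p ^ k) * H.E (p ^ k) 0 0 *
      ((List.range' (k + 1) (l - (k + 1))).map fun s => H.E (p ^ s) 0 0 ^ (p - 1)).prod) =
      H.E ((p - 1) * p ^ k) 0 0 * (H.E 0 0 (p ^ k) *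
        H.E (p ^ l - p ^ (k + 1) + p ^ k) 0 0) := by
    rw [H.isDivPowSeq_alpha.prod_pow_pred p, H.isDivPowSeq_alpha.pow_pred p,
      show ((-1 : A) ^ (l - k)) = algebraMap K _ ((-1) ^ (l - k)) by
      rw [map_pow, map_neg, map_one],
      ← Algebra.smul_def, mul_smul_comm, smul_smul, mul_assoc, mul_assoc,
      show k + 1 + (l - (k + 1)) = l by omega, e1, smul_mul_assoc, smul_smul]
    have : (-1 : K) ^ (l - k) * (-1) ^ (l - (k + 1)) * (-1) = 1 := by
      have hc : (-1 : K) ^ (l - (k + 1)) * (-1) ^ (l - (k + 1)) = 1 := by rw [← mul_pow]; simp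
      rw [show l - k = l - (k + 1) + 1 by omega, pow_succ]
      linear_combination hc
    rw [this, one_smul]
  rw [e2, H.beta_mul_alpha, H.beta_mul_alpha, H.alpha_mul_beta, min_eq_left (by omega),
    min_eq_left (by omega), Finset.sum_range_succ', Finset.sum_range_succ', mul_add,
    Finset.mul_sum]
  simp only [pow_zero, one_smul, Nat.sub_zero]
  have h0 : H.E ((p - 1) * p ^ k) 0 0 * H.E (p ^ l - p ^ (k + 1) + p ^ k) 0 (p ^ k)
      = 0 := by
    rw [H.E_mul_of_eq_zero _ _ _ _ _ _ (Or.inl rfl),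
      show (p - 1) * p ^ k + (p ^ l - p ^ (k + 1) + p ^ k) = p ^ l by omega]
    have := natCast_choose_pow_eq_zero K p k l (p - 1) h (by omega) (by omega)
    simp [this]
  rw [h0, add_zero, sub_add_cancel_right]
  congr 1
  refine Finset.sum_congr rfl fun m hm => ?_
  rw [Finset.mem_range] at hm
  -- For m < p^k the digit of p^l - (m + 1) in position k is p - 1, so Lucas' congruence gives
  -- binom(p - 1, p - 1).
  have h1 : (((p ^ l - (m + 1)).choose ((p - 1) * p ^ k) : ℕ) : K) = 1 := by
    have h2 := natCast_choose_pow K p k (p ^ (l - k) - 1) (p - 1) (p ^ k - (m + 1)) 0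
      (by omega) hpos
    have h3 := natCast_choose_lucas K p (p ^ (l - k) - 1) (p - 1)
    have e3 : p ^ (l - k) - 1 = (p ^ (l - (k + 1)) - 1) * p + (p - 1) := by
      have h4 : 0 < p ^ (l - (k + 1)) := pow_pos hp.out.pos _
      rw [show l - k = l - (k + 1) + 1 by omega, pow_succ]
      obtain ⟨c, hc⟩ := Nat.exists_eq_add_of_le' h4
      rw [hc, Nat.add_sub_cancel, Nat.succ_mul]
      omega
    have e4 : (p ^ (l - k) - 1) % p = p - 1 := by
      rw [e3, Nat.mul_add_mod', Nat.mod_eq_of_lt (by omega)]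
    rw [e4, Nat.mod_eq_of_lt (by omega), Nat.div_eq_of_lt (show p - 1 < p by omega)] at h3
    rw [h3, Nat.sub_mul, ← el', one_mul, add_zero,
      show p ^ l - p ^ k + (p ^ k - (m + 1)) = p ^ l - (m + 1) by omega] at h2
    rw [h2]; simp
  rw [mul_smul_comm, H.E_mul_of_eq_zero _ _ _ _ _ _ (Or.inl rfl),
    show (p - 1) * p ^ k + (p ^ l - p ^ (k + 1) + p ^ k - (m + 1)) = p ^ l - (m + 1) by omega]
  simp [h1]

/-- With q = p^k, let E be the term without e_{α+β} in e_β^{(2q)} e_α^{(q)} and R the rest. Then b²a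
= 2E + 2R, bab = 2E + R and ab² = 2E, because the coefficient binom(2q, q) is 2 while binom(2q - m,
q) is 1 for 1 ≤ m ≤ q. -/
theorem relation_serreB (k : ℕ) :
    H.E 0 0 (p ^ k) ^ 2 * H.E (p ^ k) 0 0 -
      2 * (H.E 0 0 (p ^ k) * H.E (p ^ k) 0 0 * H.E 0 0 (p ^ k)) +
      H.E (p ^ k) 0 0 * H.E 0 0 (p ^ k) ^ 2 = 0 := by
  have h2 := H.isDivPowSeq_beta.pow_eq p k 2
  simp only [Nat.factorial_two, Nat.cast_ofNat] at h2
  have htwo : (((2 * p ^ k).choose (p ^ k) : ℕ) : K) = 2 := by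
    simpa using natCast_choose_mul_pow K p k 2 1
  rw [h2, smul_mul_assoc, H.beta_mul_alpha, H.beta_mul_alpha, mul_smul_comm, H.alpha_mul_beta, min_self,
    min_eq_right (by omega), Finset.sum_range_succ', Finset.sum_range_succ', add_mul,
    Finset.sum_mul, show (2 : A) = algebraMap K _ 2 from
      (map_ofNat _ 2).symm, ← Algebra.smul_def]
  have h0 : H.E (p ^ k) 0 (p ^ k) * H.E 0 0 (p ^ k) =
      (2 : K) • H.E (p ^ k) 0 (2 * p ^ k) := by
    rw [H.E_mul_of_eq_zero _ _ _ _ _ _ (Or.inr rfl)]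
    simp [← two_mul, htwo]
  have h1 : ∑ m ∈ Finset.range (p ^ k), ((-1 : K) ^ (m + 1) •
      H.E (p ^ k - (m + 1)) (m + 1) (p ^ k - (m + 1))) * H.E 0 0 (p ^ k) =
      ∑ m ∈ Finset.range (p ^ k), (-1 : K) ^ (m + 1) •
      H.E (p ^ k - (m + 1)) (m + 1) (2 * p ^ k - (m + 1)) := by
    refine Finset.sum_congr rfl fun m hm => ?_
    rw [Finset.mem_range] at hm
    have := choose_two_mul_sub K p k (m + 1) (by omega) (by omega)
    rw [smul_mul_assoc, H.E_mul_of_eq_zero _ _ _ _ _ _ (Or.inr rfl),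
      show p ^ k - (m + 1) + p ^ k = 2 * p ^ k - (m + 1) by omega]
    simp [this]
  simp only [pow_zero, one_smul, Nat.sub_zero]
  rw [h1, h0]
  module

theorem relation_serreA (k : ℕ) :
    H.E 0 0 (p ^ k) * H.E (p ^ k) 0 0 ^ 2 -
      2 * (H.E (p ^ k) 0 0 * H.E 0 0 (p ^ k) * H.E (p ^ k) 0 0) +
      H.E (p ^ k) 0 0 ^ 2 * H.E 0 0 (p ^ k) = 0 := by
  have h2 := H.isDivPowSeq_alpha.pow_eq p k 2
  simp only [Nat.factorial_two, Nat.cast_ofNat] at h2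
  have htwo : (((2 * p ^ k).choose (p ^ k) : ℕ) : K) = 2 := by
    simpa using natCast_choose_mul_pow K p k 2 1
  rw [h2, mul_smul_comm, mul_assoc (H.E (p ^ k) 0 0), H.beta_mul_alpha, H.beta_mul_alpha,
    smul_mul_assoc, H.alpha_mul_beta, min_self,
    min_eq_left (by omega), Finset.sum_range_succ', Finset.sum_range_succ', mul_add,
    Finset.mul_sum, show (2 : A) = algebraMap K _ 2 from
      (map_ofNat _ 2).symm, ← Algebra.smul_def]
  have h0 : H.E (p ^ k) 0 0 * H.E (p ^ k) 0 (p ^ k) =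
      (2 : K) • H.E (2 * p ^ k) 0 (p ^ k) := by
    rw [H.E_mul_of_eq_zero _ _ _ _ _ _ (Or.inl rfl), ← two_mul]
    simp [htwo]
  have h1 : ∑ m ∈ Finset.range (p ^ k), H.E (p ^ k) 0 0 * ((-1 : K) ^ (m + 1) •
      H.E (p ^ k - (m + 1)) (m + 1) (p ^ k - (m + 1))) =
      ∑ m ∈ Finset.range (p ^ k), (-1 : K) ^ (m + 1) •
      H.E (2 * p ^ k - (m + 1)) (m + 1) (p ^ k - (m + 1)) := by
    refine Finset.sum_congr rfl fun m hm => ?_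
    rw [Finset.mem_range] at hm
    have := choose_two_mul_sub K p k (m + 1) (by omega) (by omega)
    rw [mul_smul_comm, H.E_mul_of_eq_zero _ _ _ _ _ _ (Or.inl rfl),
      show p ^ k + (p ^ k - (m + 1)) = 2 * p ^ k - (m + 1) by omega]
    simp [this]
  simp only [pow_zero, one_smul, Nat.sub_zero]
  rw [h1, h0]
  module

end DivPowBasis

end Relations

end Kostant

namespace Kostant

/-! ## Normal words -/

section Words

/-- The index `k` of a generator `a k` or `b k`. -/
def Gen.level : Gen → ℕ
  | .a k => k
  | .b k => k

/-- The word `a_k^i (b_k a_k)^j b_k^l`. -/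
def block (k i j l : ℕ) : List Gen :=
  List.replicate i (.a k) ++ ((List.replicate j [Gen.b k, Gen.a k]).flatten ++
    List.replicate l (.b k))

theorem block_succ (k i j l : ℕ) : block k (i + 1) j l = .a k :: block k i j l := by
  simp [block, List.replicate_succ]

theorem block_zero_succ (k j l : ℕ) :
    block k 0 (j + 1) l = .b k :: .a k :: block k 0 j l := by
  simp [block, List.replicate_succ]

theorem block_zero_zero_succ (k l : ℕ) : block k 0 0 (l + 1) = .b k :: block k 0 0 l := by
  simp [block, List.replicate_succ]

theorem block_zero (k : ℕ) : block k 0 0 0 = [] := rfl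

theorem level_of_mem_block {k i j l : ℕ} {x : Gen} (h : x ∈ block k i j l) : x.level = k := by
  simp only [block, List.mem_append, List.mem_replicate, List.mem_flatten] at h
  rcases h with h | ⟨y, ⟨_, rfl⟩, h⟩ | h
  · rw [h.2]; rfl
  · simp at h
    rcases h with rfl | rfl <;> rfl
  · rw [h.2]; rfl

/-- Induction along the letters of a block. -/
theorem block_induction {p k : ℕ} (hp : 1 < p) {P : List Gen → Prop} (nil : P [])
    (a : ∀ i j l, i + 1 < p → j < p → l < p → P (block k i j l) → P (.a k :: block k i j l))
    (ba : ∀ j l, j + 1 < p → l < p → P (block k 1 j l) → P (.b k :: block k 1 j l))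
    (b : ∀ l, l + 1 < p → P (block k 0 0 l) → P (.b k :: block k 0 0 l)) :
    ∀ i j l, i < p → j < p → l < p → P (block k i j l) := by
  have h0 : ∀ l, l < p → P (block k 0 0 l) := by
    intro l
    induction l with
    | zero => intro _; exact nil
    | succ l ih =>
      intro hl
      rw [block_zero_zero_succ]
      exact b l hl (ih (by omega))
  have h1 : ∀ j l, j < p → l < p → P (block k 0 j l) := by
    intro j l
    induction j with
    | zero => intro _ hl; exact h0 l hl
    | succ j ih =>
      intro hj hl
      rw [block_zero_succ, ← block_succ]
      refine ba j l hj hl ?_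
      rw [block_succ]
      exact a 0 j l hp (by omega) hl (ih (by omega) hl)
  intro i j l
  induction i with
  | zero => intro _ hj hl; exact h1 j l hj hl
  | succ i ih =>
    intro hi hj hl
    rw [block_succ]
    exact a i j l hi hj hl (ih (by omega) hj hl)

/-- Cutting inside a factor b_k a_k leaves a single a_k in front of the remaining factors, which is
again a block, with i = 1; 1 < p makes this exponent admissible. -/
theorem block_of_suffix {p k : ℕ} (hp : 1 < p) {i j l : ℕ} (hi : i < p) (hj : j < p) (hl : l < p)
    {s : List Gen} (hs : s <:+ block k i j l) :
    ∃ i' j' l', i' < p ∧ j' < p ∧ l' < p ∧ s = block k i' j' l' := by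
  revert s
  refine block_induction (P := fun w => ∀ {s}, s <:+ w →
    ∃ i' j' l', i' < p ∧ j' < p ∧ l' < p ∧ s = block k i' j' l') hp ?_ ?_ ?_ ?_ i j l hi hj hl
  · intro s hs
    exact ⟨0, 0, 0, by omega, by omega, by omega, List.suffix_nil.mp hs⟩
  · intro i j l hi hj hl ih s hs
    rcases List.suffix_cons_iff.mp hs with rfl | hs
    · exact ⟨i + 1, j, l, hi, hj, hl, (block_succ _ _ _ _).symm⟩
    · exact ih hs
  · intro j l hj hl ih s hs
    rcases List.suffix_cons_iff.mp hs with rfl | hs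
    · exact ⟨0, j + 1, l, by omega, hj, hl, by rw [block_zero_succ, block_succ]⟩
    · exact ih hs
  · intro l hl ih s hs
    rcases List.suffix_cons_iff.mp hs with rfl | hs
    · exact ⟨0, 0, l + 1, by omega, by omega, hl, (block_zero_zero_succ _ _).symm⟩
    · exact ih hs

theorem a_not_prefix_block_zero (k j l : ℕ) (w : List Gen) : ¬ .a k :: w <+: block k 0 j l := by
  intro h
  cases j with
  | succ j => rw [block_zero_succ, List.cons_prefix_cons] at h; simp at h
  | zero =>
    cases l with
    | zero => simp [block_zero] at h
    | succ l => rw [block_zero_zero_succ, List.cons_prefix_cons] at h; simp at h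

theorem b_prefix_block {k i j l : ℕ} {w : List Gen} (h : .b k :: w <+: block k i j l) :
    i = 0 ∧ ((∃ j', j = j' + 1 ∧ w <+: block k 1 j' l) ∨
      (j = 0 ∧ ∃ l', l = l' + 1 ∧ w <+: block k 0 0 l')) := by
  cases i with
  | succ i => rw [block_succ, List.cons_prefix_cons] at h; simp at h
  | zero =>
    refine ⟨rfl, ?_⟩
    cases j with
    | succ j =>
      rw [block_zero_succ, ← block_succ, List.cons_prefix_cons] at h
      exact Or.inl ⟨j, rfl, h.2⟩
    | zero =>
      cases l with
      | zero => simp [block_zero] at h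
      | succ l =>
        rw [block_zero_zero_succ, List.cons_prefix_cons] at h
        exact Or.inr ⟨rfl, l, rfl, h.2⟩

theorem replicate_a_prefix_block {k n i j l : ℕ}
    (h : List.replicate n (.a k) <+: block k i j l) : n ≤ i := by
  induction n generalizing i with
  | zero => omega
  | succ n ih =>
    rw [List.replicate_succ] at h
    cases i with
    | zero => exact absurd h (a_not_prefix_block_zero _ _ _ _)
    | succ i =>
      rw [block_succ, List.cons_prefix_cons] at h
      have := ih h.2
      omega

theorem replicate_b_prefix_block {k n l : ℕ}
    (h : List.replicate n (.b k) <+: block k 0 0 l) : n ≤ l := by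
  simpa [block] using h.length_le

theorem replicate_ba_prefix_block {k n j l : ℕ}
    (h : (List.replicate n [Gen.b k, Gen.a k]).flatten <+: block k 0 j l) : n ≤ j := by
  induction n generalizing j with
  | zero => omega
  | succ n ih =>
    rw [List.replicate_succ, List.flatten_cons, List.cons_append, List.cons_append,
      List.nil_append] at h
    rcases (b_prefix_block h).2 with ⟨j, rfl, h'⟩ | ⟨_, l, rfl, h'⟩
    · rw [block_succ, List.cons_prefix_cons] at h'
      have := ih h'.2
      omega
    · exact absurd h' (a_not_prefix_block_zero _ _ _ _)

/-- The index type of the Gröbner basis. -/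
inductive Rel (p : ℕ) : Type
  | ab (k l : ℕ) (h : k < l)
  | ba (k l : ℕ) (h : k < l)
  | aa (k l : ℕ) (h : k < l)
  | bb (k l : ℕ) (h : k < l)
  | braid (k : ℕ)
  | powA (k : ℕ)
  | powB (k : ℕ)
  | serreB (k : ℕ) (h : 3 ≤ p)
  | serreA (k : ℕ) (h : 3 ≤ p)

/-- The leading word of an element of the Gröbner basis. -/
def Rel.lead {p : ℕ} : Rel p → List Gen
  | .ab k l _ => [.a l, .b k]
  | .ba k l _ => [.b l, .a k]
  | .aa k l _ => [.a l, .a k]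
  | .bb k l _ => [.b l, .b k]
  | .braid k => (List.replicate p [Gen.b k, Gen.a k]).flatten
  | .powA k => List.replicate p (.a k)
  | .powB k => List.replicate p (.b k)
  | .serreB k _ => [.b k, .b k, .a k]
  | .serreA k _ => [.b k, .a k, .a k]

/-- A word is normal if it has no leading word of the Gröbner basis as a factor. -/
def Normal (p : ℕ) (w : List Gen) : Prop := ∀ r : Rel p, ¬ r.lead <:+: w

theorem Normal.of_infix {p : ℕ} {v w : List Gen} (h : Normal p w) (hv : v <:+: w) : Normal p v :=
  fun r hr => h r (hr.trans hv)

theorem exists_rel_of_level_lt (p : ℕ) {x y : Gen} (h : y.level < x.level) :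
    ∃ r : Rel p, r.lead = [x, y] := by
  cases x <;> cases y
  · exact ⟨.aa _ _ h, rfl⟩
  · exact ⟨.ab _ _ h, rfl⟩
  · exact ⟨.ba _ _ h, rfl⟩
  · exact ⟨.bb _ _ h, rfl⟩

/-- Every pair of adjacent letters with decreasing levels is the leading word of a commutation
relation. -/
theorem Normal.pairwise_level {p : ℕ} {w : List Gen} (h : Normal p w) :
    w.Pairwise fun x y => x.level ≤ y.level := by
  induction w with
  | nil => exact List.Pairwise.nil
  | cons x w ih =>
    have hw := ih (h.of_infix (List.suffix_cons x w).isInfix)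
    refine List.Pairwise.cons ?_ hw
    cases w with
    | nil => simp
    | cons y w =>
      have hxy : x.level ≤ y.level := by
        by_contra hlt
        obtain ⟨r, hr⟩ := exists_rel_of_level_lt p (not_le.mp hlt)
        exact h r (hr ▸ (List.prefix_append [x, y] w).isInfix)
      intro z hz
      rcases List.mem_cons.mp hz with rfl | hz
      · exact hxy
      · exact hxy.trans (List.rel_of_pairwise_cons hw hz)

/-- `NF p k w (I, J, L)`: the word `w` is the product over `m = k, k + 1, …` of the blocks
`a_m^i (b_m a_m)^j b_m^l`, where `i, j, l < p` run through the digits to base `p` of `I, J, L`. -/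
inductive NF (p : ℕ) : ℕ → List Gen → ℕ × ℕ × ℕ → Prop
  | nil (k : ℕ) : NF p k [] (0, 0, 0)
  | block (k i j l : ℕ) (w : List Gen) (I J L : ℕ) (hi : i < p) (hj : j < p) (hl : l < p) :
      NF p (k + 1) w (I, J, L) → NF p k (block k i j l ++ w) (i + p * I, j + p * J, l + p * L)

theorem NF.exists_of_le {p : ℕ} (hp : 0 < p) {m k : ℕ} (hmk : m ≤ k) {w : List Gen}
    (h : ∃ t, NF p k w t) : ∃ t, NF p m w t := by
  induction hmk with
  | refl => exact h
  | step _ ih =>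
    obtain ⟨⟨I, J, L⟩, h⟩ := h
    exact ih ⟨_, NF.block _ 0 0 0 w I J L hp hp hp h⟩

/-- For k = 0 this is the degree of the basis element with index t, so matching words with basis
elements preserves degrees. -/
theorem NF.wordDeg {p k : ℕ} {w : List Gen} {t : ℕ × ℕ × ℕ} (h : NF p k w t) :
    wordDeg p (FreeMonoid.ofList w) = (p ^ k * (t.1 + t.2.1), p ^ k * (t.2.1 + t.2.2)) := by
  simp only [Kostant.wordDeg, FreeMonoid.toList_ofList]
  induction h with
  | nil k => simp; rfl
  | block k i j l w I J L hi hj hl _ ih =>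
    have hb : ((Kostant.block k i j l).map (Gen.deg p)).sum = (p ^ k * (i + j), p ^ k * (j + l)) := by
      simp [Kostant.block, Gen.deg, List.map_flatten, List.sum_flatten]
      constructor <;> ring
    rw [List.map_append, List.sum_append, ih, hb]
    simp only [Prod.mk_add_mk, pow_succ]
    congr 1 <;> ring

theorem NF.eq_nil {p k : ℕ} (hp : 0 < p) {w : List Gen} {t : ℕ × ℕ × ℕ} (h : NF p k w t) :
    t = (0, 0, 0) → w = [] := by
  induction h with
  | nil k => intro _; rfl
  | block k i j l w I J L hi hj hl _ ih =>
    intro h0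
    simp only [Prod.mk.injEq, Nat.add_eq_zero_iff, Nat.mul_eq_zero] at h0
    obtain ⟨⟨rfl, hI⟩, ⟨rfl, hJ⟩, rfl, hL⟩ := h0
    rw [ih (by simp; omega)]
    rfl

theorem digit_eq {p i i' I I' : ℕ} (hi : i < p) (hi' : i' < p) (h : i + p * I = i' + p * I') :
    i = i' ∧ I = I' := by
  have h1 := congrArg (· % p) h
  simp only [Nat.add_mul_mod_self_left, Nat.mod_eq_of_lt hi, Nat.mod_eq_of_lt hi'] at h1
  subst h1
  exact ⟨rfl, Nat.eq_of_mul_eq_mul_left (by omega) (Nat.add_left_cancel h)⟩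

theorem NF.eq_of_eq {p : ℕ} (hp : 0 < p) {k : ℕ} {w : List Gen} {t : ℕ × ℕ × ℕ}
    (h : NF p k w t) : ∀ {w' : List Gen} {t' : ℕ × ℕ × ℕ}, NF p k w' t' → t = t' → w = w' := by
  induction h with
  | nil k => intro w' t' h' e; exact (h'.eq_nil hp e.symm).symm
  | block k i j l w I J L hi hj hl h ih =>
    intro w' t' h' e
    cases h' with
    | nil => exact (NF.block k i j l w I J L hi hj hl h).eq_nil hp e
    | block _ i' j' l' w' I' J' L' hi' hj' hl' h' =>
      simp only [Prod.mk.injEq] at e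
      obtain ⟨rfl, rfl⟩ := digit_eq hi hi' e.1
      obtain ⟨rfl, rfl⟩ := digit_eq hj hj' e.2.1
      obtain ⟨rfl, rfl⟩ := digit_eq hl hl' e.2.2
      rw [ih h' rfl]

/-- Letters are prepended one at a time. A letter either enlarges the first block or creates a
forbidden prefix: exponents reaching p are excluded by a^p, b^p and (ba)^p, and the shapes bba and
baa by the Serre words. -/
theorem Normal.exists_NF {p : ℕ} (hp : 1 < p) {w : List Gen} (h : Normal p w) :
    ∀ k, (∀ x ∈ w, k ≤ x.level) → ∃ t, NF p k w t := by
  induction w with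
  | nil => intro k _; exact ⟨_, NF.nil k⟩
  | cons x w ih =>
    intro k hk
    have hsort := List.pairwise_cons.mp h.pairwise_level
    -- It suffices to start at the level of the first letter; empty blocks fill the lower levels.
    refine NF.exists_of_le (by omega) (hk x List.mem_cons_self) ?_
    obtain ⟨t, ht⟩ := ih (h.of_infix (List.suffix_cons x w).isInfix) _ hsort.1
    have hpre : ∀ r : Rel p, ¬ r.lead <+: x :: w := fun r hr => h r hr.isInfix
    generalize hm : x.level = m at ht
    cases ht with
    | nil =>
      cases x with
      | a m' =>
        obtain rfl : m' = m := hm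
        exact ⟨_, NF.block m' 1 0 0 [] 0 0 0 hp (by omega) (by omega) (NF.nil _)⟩
      | b m' =>
        obtain rfl : m' = m := hm
        exact ⟨_, NF.block m' 0 0 1 [] 0 0 0 (by omega) (by omega) hp (NF.nil _)⟩
    | block _ i j l w I J L hi hj hl hw =>
      cases x with
      | a m' =>
        obtain rfl : m' = m := hm
        have hi' : i + 1 < p := by
          by_contra hge
          obtain rfl : p = i + 1 := by omega
          refine hpre (.powA m') ?_
          rw [Rel.lead, ← List.cons_append, ← block_succ, block, List.append_assoc]
          exact List.prefix_append _ _
        have := NF.block m' (i + 1) j l w I J L hi' hj hl hw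
        rw [block_succ, List.cons_append] at this
        exact ⟨_, this⟩
      | b m' =>
        obtain rfl : m' = m := hm
        match i, j with
        | 0, 0 =>
          have hl' : l + 1 < p := by
            by_contra hge
            obtain rfl : p = l + 1 := by omega
            refine hpre (.powB m') ?_
            rw [Rel.lead, ← List.cons_append, ← block_zero_zero_succ, block]
            exact List.prefix_append _ _
          have := NF.block m' 0 0 (l + 1) w I J L hi hj hl' hw
          rw [block_zero_zero_succ, List.cons_append] at this
          exact ⟨_, this⟩
        | 0, j + 1 =>
          exfalso
          rw [block_zero_succ] at hpre
          -- For p = 2 there is no Serre relation, but then bba already begins with b^p.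
          rcases Nat.lt_or_ge 2 p with h3 | h3
          · exact hpre (.serreB m' h3) (List.prefix_append [_, _, _] _)
          · obtain rfl : p = 2 := by omega
            exact hpre (.powB m') (List.prefix_append [_, _] _)
        | 1, j =>
          have hj' : j + 1 < p := by
            by_contra hge
            obtain rfl : p = j + 1 := by omega
            refine hpre (.braid m') ?_
            rw [Rel.lead, block_succ, ← List.cons_append, ← block_zero_succ, block, List.append_assoc,
              List.append_assoc]
            exact List.prefix_append _ _
          have := NF.block m' 0 (j + 1) l w I J L (by omega) hj' hl hw
          rw [block_zero_succ, ← block_succ, List.cons_append] at this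
          exact ⟨_, this⟩
        | i + 2, j =>
          exfalso
          rw [block_succ, block_succ] at hpre
          -- The bound i + 2 < p forces p ≥ 3, so the Serre relation is available.
          exact hpre (.serreA m' (by omega)) (List.prefix_append [_, _, _] _)

theorem NF.le_level {p k : ℕ} {w : List Gen} {t : ℕ × ℕ × ℕ} (h : NF p k w t) :
    ∀ x ∈ w, k ≤ x.level := by
  induction h with
  | nil k => simp
  | block k i j l w I J L hi hj hl _ ih =>
    intro x hx
    rcases List.mem_append.mp hx with hx | hx
    · exact (level_of_mem_block hx).ge
    · exact (Nat.le_succ k).trans (ih x hx)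

theorem NF.pairwise_level {p k : ℕ} {w : List Gen} {t : ℕ × ℕ × ℕ} (h : NF p k w t) :
    w.Pairwise fun x y => x.level ≤ y.level := by
  induction h with
  | nil k => exact List.Pairwise.nil
  | block k i j l w I J L hi hj hl h ih =>
    refine List.pairwise_append.mpr ⟨?_, ih, ?_⟩
    · exact List.pairwise_of_forall_mem_list fun x hx y hy => by
        rw [level_of_mem_block hx, level_of_mem_block hy]
    · intro x hx y hy
      rw [level_of_mem_block hx]
      exact (Nat.le_succ k).trans (h.le_level y hy)

theorem NF.filter_level {p k : ℕ} (hp : 0 < p) {w : List Gen} {t : ℕ × ℕ × ℕ} (h : NF p k w t)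
    (m : ℕ) : ∃ i j l, i < p ∧ j < p ∧ l < p ∧
      w.filter (fun x => x.level = m) = Kostant.block m i j l := by
  induction h with
  | nil k => exact ⟨0, 0, 0, hp, hp, hp, rfl⟩
  | block k i j l w I J L hi hj hl h ih =>
    rw [List.filter_append]
    by_cases hm : k = m
    · subst hm
      refine ⟨i, j, l, hi, hj, hl, ?_⟩
      rw [List.filter_eq_self.mpr fun x hx => by simpa using level_of_mem_block hx,
        List.filter_eq_nil_iff.mpr fun x hx => by
          have := h.le_level x hx
          simp; omega, List.append_nil]
    · rw [List.filter_eq_nil_iff.mpr fun x hx => by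
        rw [level_of_mem_block hx]; simpa using hm, List.nil_append]
      exact ih

/-- Leading words with two different levels descend, whereas levels increase weakly along the word.
A leading word with letters of one level m survives deletion of all other levels, hence is a factor
of one block; it is then a prefix of a suffix, and suffixes of blocks are blocks. -/
theorem NF.normal {p k : ℕ} (hp : 1 < p) {w : List Gen} {t : ℕ × ℕ × ℕ} (h : NF p k w t) :
    Normal p w := by
  have hdesc : ∀ x y : Gen, y.level < x.level → ¬ [x, y] <:+: w := by
    intro x y hxy hw
    have := h.pairwise_level.sublist hw.sublist
    simp at this
    omega
  have hpure : ∀ (m : ℕ) (v : List Gen), (∀ x ∈ v, x.level = m) → v <:+: w →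
      ∃ i j l, i < p ∧ j < p ∧ l < p ∧ v <+: Kostant.block m i j l := by
    intro m v hv hvw
    obtain ⟨i, j, l, hi, hj, hl, e⟩ := h.filter_level (by omega) m
    have h1 := hvw.filter (fun x => decide (x.level = m))
    rw [e, List.filter_eq_self.mpr fun x hx => by simpa using hv x hx] at h1
    obtain ⟨s, hs, h2⟩ := List.infix_iff_prefix_suffix.mp h1
    obtain ⟨i', j', l', hi', hj', hl', rfl⟩ := block_of_suffix hp hi hj hl h2
    exact ⟨i', j', l', hi', hj', hl', hs⟩
  intro r hr
  cases r with
  | ab k l hkl => exact hdesc (.a l) (.b k) hkl hr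
  | ba k l hkl => exact hdesc (.b l) (.a k) hkl hr
  | aa k l hkl => exact hdesc (.a l) (.a k) hkl hr
  | bb k l hkl => exact hdesc (.b l) (.b k) hkl hr
  | braid k =>
    obtain ⟨i, j, l, hi, hj, hl, h1⟩ := hpure k _ (by
      intro x hx
      rw [Rel.lead, List.mem_flatten] at hx
      obtain ⟨y, hy, hx⟩ := hx
      rw [(List.mem_replicate.mp hy).2] at hx
      simp at hx
      rcases hx with rfl | rfl <;> rfl) hr
    have h2 := h1
    obtain ⟨q, rfl⟩ := Nat.exists_eq_succ_of_ne_zero (show p ≠ 0 by omega)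
    rw [Rel.lead, List.replicate_succ, List.flatten_cons] at h2
    obtain ⟨rfl, _⟩ := b_prefix_block h2
    have := replicate_ba_prefix_block h1
    omega
  | powA k =>
    obtain ⟨i, j, l, hi, hj, hl, h1⟩ := hpure k _ (by
      intro x hx
      rw [(List.mem_replicate.mp hx).2]; rfl) hr
    have := replicate_a_prefix_block h1
    omega
  | powB k =>
    obtain ⟨i, j, l, hi, hj, hl, h1⟩ := hpure k _ (by
      intro x hx
      rw [(List.mem_replicate.mp hx).2]; rfl) hr
    have h2 := h1
    obtain ⟨q, rfl⟩ := Nat.exists_eq_add_of_le' hp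
    rw [Rel.lead, List.replicate_succ, List.replicate_succ] at h2
    obtain ⟨rfl, ⟨j, rfl, h3⟩ | ⟨rfl, l, rfl, h3⟩⟩ := b_prefix_block h2
    · have := (b_prefix_block h3).1
      omega
    · have := replicate_b_prefix_block h1
      omega
  | serreB k h3 =>
    obtain ⟨i, j, l, hi, hj, hl, h1⟩ := hpure k _ (by
      intro x hx
      simp [Rel.lead] at hx
      rcases hx with rfl | rfl <;> rfl) hr
    obtain ⟨rfl, ⟨j, rfl, h2⟩ | ⟨rfl, l, rfl, h2⟩⟩ := b_prefix_block h1
    · have := (b_prefix_block h2).1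
      omega
    · obtain ⟨_, ⟨j, hj, _⟩ | ⟨_, l, rfl, h4⟩⟩ := b_prefix_block h2
      · omega
      · exact a_not_prefix_block_zero _ _ _ _ h4
  | serreA k h3 =>
    obtain ⟨i, j, l, hi, hj, hl, h1⟩ := hpure k _ (by
      intro x hx
      simp [Rel.lead] at hx
      rcases hx with rfl | rfl <;> rfl) hr
    obtain ⟨rfl, ⟨j, rfl, h2⟩ | ⟨rfl, l, rfl, h2⟩⟩ := b_prefix_block h1
    · rw [block_succ, List.cons_prefix_cons] at h2
      exact a_not_prefix_block_zero _ _ _ _ h2.2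
    · exact a_not_prefix_block_zero _ _ _ _ h2

end Words

end Kostant

/-! ### Words as elements of the free algebra -/

namespace Anick

section Mon

variable {K : Type u} [Field K] {X : Type}

theorem mon_mul (u v : FreeMonoid X) : mon (K := K) (u * v) = mon u * mon v := map_mul _ _ _

theorem mon_one : mon (K := K) (1 : FreeMonoid X) = 1 := map_one _

theorem mon_eq_single (w : FreeMonoid X) : mon (K := K) w = MonoidAlgebra.single w 1 := rfl

theorem coeff_mon (w : FreeMonoid X) : (mon (K := K) w).coeff = Finsupp.single w 1 := rfl

theorem mon_ofList_nil : mon (K := K) (FreeMonoid.ofList ([] : List X)) = 1 := mon_one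

theorem mon_ofList_cons (x : X) (w : List X) :
    mon (K := K) (FreeMonoid.ofList (x :: w)) = mon (FreeMonoid.of x) * mon (FreeMonoid.ofList w) :=
  mon_mul (FreeMonoid.of x) (FreeMonoid.ofList w)

theorem mon_ofList_append (v w : List X) :
    mon (K := K) (FreeMonoid.ofList (v ++ w)) =
      mon (FreeMonoid.ofList v) * mon (FreeMonoid.ofList w) :=
  mon_mul _ _

theorem mon_ofList_flatten_replicate (n : ℕ) (w : List X) :
    mon (K := K) (FreeMonoid.ofList (List.replicate n w).flatten) =
      mon (FreeMonoid.ofList w) ^ n := by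
  induction n with
  | zero => rw [pow_zero]; exact mon_one
  | succ n ih => rw [List.replicate_succ, List.flatten_cons, mon_ofList_append, ih, pow_succ']

theorem mon_ofList_replicate (n : ℕ) (x : X) :
    mon (K := K) (FreeMonoid.ofList (List.replicate n x)) = mon (FreeMonoid.of x) ^ n := by
  induction n with
  | zero => rw [pow_zero]; exact mon_one
  | succ n ih => rw [List.replicate_succ, mon_ofList_cons, ih, pow_succ']

theorem mon_ofList_flatMap {ι : Type} (L : List ι) (f : ι → List X) :
    mon (K := K) (FreeMonoid.ofList (L.flatMap f)) =
      (L.map fun s => mon (FreeMonoid.ofList (f s))).prod := by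
  induction L with
  | nil => exact mon_one
  | cons s L ih => rw [List.flatMap_cons, mon_ofList_append, ih, List.map_cons, List.prod_cons]

variable {A : Type u} [Ring A] [Algebra K A]

theorem proj_mon (gen : X → A) (w : FreeMonoid X) :
    proj gen (mon (K := K) w) = (w.toList.map gen).prod := by
  rw [proj, mon_eq_single, MonoidAlgebra.lift_single, one_smul, FreeMonoid.lift_apply]

theorem proj_mon_of (gen : X → A) (x : X) : proj gen (mon (K := K) (FreeMonoid.of x)) = gen x := by
  rw [proj_mon]; simp

theorem poly_eq_sum (f : Poly K X) : f = ∑ w ∈ f.coeff.support, f.coeff w • mon w := by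
  apply MonoidAlgebra.coeff_injective
  rw [MonoidAlgebra.coeff_sum]
  conv_lhs => rw [← Finsupp.sum_single f.coeff]
  rw [Finsupp.sum]
  refine Finset.sum_congr rfl fun w _ => ?_
  rw [MonoidAlgebra.coeff_smul, coeff_mon]
  simp

end Mon

end Anick

namespace Kostant

open Anick

/-! ### The order on words -/

section Order

/-- The words `v` and `w` differ in some position, and `v` has the smaller letter in the first
such position. -/
def LexLT (v w : List Gen) : Prop :=
  ∃ c x y v' w', v = c ++ x :: v' ∧ w = c ++ y :: w' ∧ x.rank < y.rank

/-- Compatibility with multiplication on the right would fail for a proper prefix; here the words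
differ at an actual position, and nothing after it matters. -/
theorem LexLT.append {v w : List Gen} (h : LexLT v w) (u z : List Gen) :
    LexLT (u ++ v ++ z) (u ++ w ++ z) := by
  obtain ⟨c, x, y, v', w', rfl, rfl, hxy⟩ := h
  exact ⟨u ++ c, x, y, v' ++ z, w' ++ z, by simp, by simp, hxy⟩

theorem LexLT.lex {v w : List Gen} (h : LexLT v w) :
    List.Lex (fun x y : Gen => x.rank < y.rank) v w := by
  obtain ⟨c, x, y, v', w', rfl, rfl, hxy⟩ := h
  exact List.Lex.append_left (fun x y : Gen => x.rank < y.rank) (List.Lex.rel hxy) c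

variable (p : ℕ)

theorem wordDeg_mul (v w : FreeMonoid Gen) : wordDeg p (v * w) = wordDeg p v + wordDeg p w := by
  simp [wordDeg]

theorem wordDeg_of (x : Gen) : wordDeg p (FreeMonoid.of x) = x.deg p := by
  simp [wordDeg]

theorem wordTotalDeg_mul (v w : FreeMonoid Gen) :
    wordTotalDeg p (v * w) = wordTotalDeg p v + wordTotalDeg p w := by
  simp only [wordTotalDeg, wordDeg_mul, Prod.fst_add, Prod.snd_add]; omega

theorem wordLT_of_lexLT {v w : FreeMonoid Gen} (hd : wordDeg p v = wordDeg p w)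
    (h : LexLT v.toList w.toList) : wordLT p v w :=
  Or.inr ⟨by rw [wordTotalDeg, wordTotalDeg, hd], h.lex⟩

theorem lex_trans_rank {u v w : List Gen}
    (h1 : List.Lex (fun x y : Gen => x.rank < y.rank) u v)
    (h2 : List.Lex (fun x y : Gen => x.rank < y.rank) v w) :
    List.Lex (fun x y : Gen => x.rank < y.rank) u w :=
  List.lex_trans (fun h1 h2 => lt_trans h1 h2) h1 h2

theorem wordLT_trans {u v w : FreeMonoid Gen} (h1 : wordLT p u v) (h2 : wordLT p v w) :
    wordLT p u w := by
  rcases h1 with h1 | ⟨e1, h1⟩ <;> rcases h2 with h2 | ⟨e2, h2⟩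
  · exact Or.inl (h1.trans h2)
  · exact Or.inl (h1.trans_eq e2)
  · exact Or.inl (e1.trans_lt h2)
  · exact Or.inr ⟨e1.trans e2, lex_trans_rank h1 h2⟩

theorem wordLT_irrefl (w : FreeMonoid Gen) : ¬ wordLT p w w := by
  rintro (h | ⟨_, h⟩)
  · exact lt_irrefl _ h
  · exact List.lex_irrefl (fun x => lt_irrefl x.rank) _ h

variable {p}

theorem finite_letters (hp : 1 < p) (d : ℕ) :
    {x : Gen | (x.deg p).1 + (x.deg p).2 ≤ d}.Finite := by
  refine (((Set.finite_Iic d).image Gen.a).union ((Set.finite_Iic d).image Gen.b)).subset ?_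
  intro x hx
  cases x with
  | a k =>
    refine Or.inl ⟨k, ?_, rfl⟩
    have h1 : p ^ k ≤ d := by simpa [Gen.deg] using hx
    exact (Nat.lt_pow_self hp).le.trans h1
  | b k =>
    refine Or.inr ⟨k, ?_, rfl⟩
    have h1 : p ^ k ≤ d := by simpa [Gen.deg] using hx
    exact (Nat.lt_pow_self hp).le.trans h1

theorem letter_deg_pos (hp : 0 < p) (x : Gen) : 0 < (x.deg p).1 + (x.deg p).2 := by
  cases x <;> simp [Gen.deg, hp]

theorem finite_words (hp : 1 < p) (d : ℕ) : {w : FreeMonoid Gen | wordTotalDeg p w ≤ d}.Finite := by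
  induction d with
  | zero =>
    refine (Set.finite_singleton (1 : FreeMonoid Gen)).subset ?_
    intro w hw
    induction w using FreeMonoid.casesOn with
    | one => rfl
    | of_mul x w =>
      have h1 : wordTotalDeg p (FreeMonoid.of x) = (x.deg p).1 + (x.deg p).2 := by
        simp [wordTotalDeg, wordDeg_of]
      have h2 := letter_deg_pos (by omega : 0 < p) x
      simp only [Set.mem_ofPred_eq, wordTotalDeg_mul, h1] at hw
      omega
  | succ d ih =>
    refine ((Set.finite_singleton (1 : FreeMonoid Gen)).union
      (Set.Finite.image2 (fun x w => FreeMonoid.of x * w) (finite_letters hp (d + 1)) ih)).subset ?_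
    intro w hw
    induction w using FreeMonoid.casesOn with
    | one => exact Or.inl rfl
    | of_mul x w =>
      have h1 : wordTotalDeg p (FreeMonoid.of x) = (x.deg p).1 + (x.deg p).2 := by
        simp [wordTotalDeg, wordDeg_of]
      have h2 := letter_deg_pos (by omega : 0 < p) x
      simp only [Set.mem_ofPred_eq, wordTotalDeg_mul, h1] at hw
      refine Or.inr ⟨x, ?_, w, ?_, rfl⟩ <;> simp only [Set.mem_ofPred_eq] <;> omega

/-- Letters have positive degree and only finitely many have bounded degree, so a word has finitely
many predecessors; by transitivity and irreflexivity their number strictly decreases along the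
order. -/
theorem wordLT_wellFounded (hp : 1 < p) : WellFounded (wordLT p) := by
  have hfin : ∀ w : FreeMonoid Gen, {v | wordLT p v w}.Finite := fun w =>
    (finite_words hp (wordTotalDeg p w)).subset fun v hv => by
      rcases hv with h | ⟨h, _⟩
      · exact h.le
      · exact h.le
  refine Subrelation.wf (r := InvImage (· < ·) fun w : FreeMonoid Gen => {v | wordLT p v w}.ncard)
    ?_ (InvImage.wf _ wellFounded_lt)
  intro v w h
  refine Set.ncard_lt_ncard ⟨fun u hu => wordLT_trans p hu h, fun hsub => ?_⟩ (hfin w)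
  exact wordLT_irrefl p v (hsub h)

end Order

/-! ### Leading words and tails of the relations -/

section Groebner

variable (K : Type u) [Field K] {p : ℕ}

/-- The non-leading terms of an element of the Gröbner basis, with the opposite sign. -/
def Rel.tailTerms : Rel p → List (ℤ × List Gen)
  | .ab k l _ => [(1, [.b k, .a l]), (-(-1) ^ (l - k), List.replicate (p - 1) (.a k) ++
      (.b k :: .a k :: (List.range' (k + 1) (l - (k + 1))).flatMap fun s =>
        List.replicate (p - 1) (.a s)))]
  | .ba k l _ => [(1, [.a k, .b l]), ((-1) ^ (l - k), .b k :: .a k ::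
      (List.range' k (l - k)).flatMap fun s => List.replicate (p - 1) (.b s))]
  | .aa k l _ => [(1, [.a k, .a l])]
  | .bb k l _ => [(1, [.b k, .b l])]
  | .braid k => [(1, (List.replicate p [Gen.a k, Gen.b k]).flatten)]
  | .powA _ => []
  | .powB _ => []
  | .serreB k _ => [(2, [.b k, .a k, .b k]), (-1, [.a k, .b k, .b k])]
  | .serreA k _ => [(2, [.a k, .b k, .a k]), (-1, [.a k, .a k, .b k])]

/-- The leading word as an element of the free monoid. -/
def Rel.word (r : Rel p) : FreeMonoid Gen := FreeMonoid.ofList r.lead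

/-- The normal form of the leading word. -/
noncomputable def Rel.tail (r : Rel p) : Poly K Gen :=
  (r.tailTerms.map fun x => (x.1 : K) • mon (FreeMonoid.ofList x.2)).sum

/-- With this form the arguments about reduction treat all relations uniformly, through the
combinatorics of words. -/
theorem mem_G_iff (g : Poly K Gen) : g ∈ G K p ↔ ∃ r : Rel p, g = mon r.word - r.tail K := by
  have hneg : ∀ n : ℕ, ((-1 : Poly K Gen) ^ n) = algebraMap K _ ((-1) ^ n) := fun n => by
    rw [map_pow, map_neg, map_one]
  have htwo : (2 : Poly K Gen) = algebraMap K _ 2 := (map_ofNat _ 2).symm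
  have hab : ∀ k l (h : k < l), va K l * vb K k - vb K k * va K l + (-1) ^ (l - k) *
        (va K k ^ (p - 1) * vb K k * va K k * orderedProd K (fun s => va K s ^ (p - 1)) (k + 1) l) =
        mon (Rel.ab (p := p) k l h).word - (Rel.ab (p := p) k l h).tail K := by
    intro k l h
    simp only [Rel.word, Rel.lead, Rel.tail, Rel.tailTerms, List.map_cons, List.map_nil,
      List.sum_cons, List.sum_nil, mon_ofList_cons, mon_ofList_nil, mon_ofList_append,
      mon_ofList_replicate, mon_ofList_flatMap, orderedProd, va, vb, mul_one, hneg,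
      ← Algebra.smul_def, mul_assoc]
    push_cast
    module
  have hba : ∀ k l (h : k < l), vb K l * va K k - va K k * vb K l - (-1) ^ (l - k) *
        (vb K k * va K k * orderedProd K (fun s => vb K s ^ (p - 1)) k l) =
        mon (Rel.ba (p := p) k l h).word - (Rel.ba (p := p) k l h).tail K := by
    intro k l h
    simp only [Rel.word, Rel.lead, Rel.tail, Rel.tailTerms, List.map_cons, List.map_nil,
      List.sum_cons, List.sum_nil, mon_ofList_cons, mon_ofList_nil,
      mon_ofList_replicate, mon_ofList_flatMap, orderedProd, va, vb, mul_one, hneg,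
      ← Algebra.smul_def, mul_assoc]
    push_cast
    module
  have haa : ∀ k l (h : k < l), va K l * va K k - va K k * va K l =
        mon (Rel.aa (p := p) k l h).word - (Rel.aa (p := p) k l h).tail K := by
    intro k l h
    simp only [Rel.word, Rel.lead, Rel.tail, Rel.tailTerms, List.map_cons, List.map_nil,
      List.sum_cons, List.sum_nil, mon_ofList_cons, mon_ofList_nil, va, mul_one]
    push_cast
    module
  have hbb : ∀ k l (h : k < l), vb K l * vb K k - vb K k * vb K l =
        mon (Rel.bb (p := p) k l h).word - (Rel.bb (p := p) k l h).tail K := by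
    intro k l h
    simp only [Rel.word, Rel.lead, Rel.tail, Rel.tailTerms, List.map_cons, List.map_nil,
      List.sum_cons, List.sum_nil, mon_ofList_cons, mon_ofList_nil, vb, mul_one]
    push_cast
    module
  have hbraid : ∀ k, (vb K k * va K k) ^ p - (va K k * vb K k) ^ p =
        mon (Rel.braid (p := p) k).word - (Rel.braid (p := p) k).tail K := by
    intro k
    simp only [Rel.word, Rel.lead, Rel.tail, Rel.tailTerms, List.map_cons, List.map_nil,
      List.sum_cons, List.sum_nil, mon_ofList_cons, mon_ofList_nil,
      mon_ofList_flatten_replicate, va, vb, mul_one]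
    push_cast
    module
  have hpA : ∀ k, va K k ^ p = mon (Rel.powA (p := p) k).word - (Rel.powA (p := p) k).tail K := by
    intro k
    simp [Rel.word, Rel.lead, Rel.tail, Rel.tailTerms, mon_ofList_replicate, va]
  have hpB : ∀ k, vb K k ^ p = mon (Rel.powB (p := p) k).word - (Rel.powB (p := p) k).tail K := by
    intro k
    simp [Rel.word, Rel.lead, Rel.tail, Rel.tailTerms, mon_ofList_replicate, vb]
  have hsB : ∀ k (h : 3 ≤ p),
      vb K k ^ 2 * va K k - 2 * (vb K k * va K k * vb K k) + va K k * vb K k ^ 2 =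
        mon (Rel.serreB (p := p) k h).word - (Rel.serreB (p := p) k h).tail K := by
    intro k h
    simp only [Rel.word, Rel.lead, Rel.tail, Rel.tailTerms, List.map_cons, List.map_nil,
      List.sum_cons, List.sum_nil, mon_ofList_cons, mon_ofList_nil, va, vb, mul_one, htwo,
      ← Algebra.smul_def, mul_assoc, pow_two]
    push_cast
    module
  have hsA : ∀ k (h : 3 ≤ p),
      vb K k * va K k ^ 2 - 2 * (va K k * vb K k * va K k) + va K k ^ 2 * vb K k =
        mon (Rel.serreA (p := p) k h).word - (Rel.serreA (p := p) k h).tail K := by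
    intro k h
    simp only [Rel.word, Rel.lead, Rel.tail, Rel.tailTerms, List.map_cons, List.map_nil,
      List.sum_cons, List.sum_nil, mon_ofList_cons, mon_ofList_nil, va, vb, mul_one, htwo,
      ← Algebra.smul_def, mul_assoc, pow_two]
    push_cast
    module
  constructor
  · rintro (⟨k, l, h⟩ | ⟨k, l, h⟩ | ⟨k, l, h⟩ | ⟨k, l, h⟩ | ⟨k⟩ | ⟨k⟩ | ⟨k⟩ | ⟨k, h⟩ | ⟨k, h⟩)
    · exact ⟨_, hab k l h⟩
    · exact ⟨_, hba k l h⟩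
    · exact ⟨_, haa k l h⟩
    · exact ⟨_, hbb k l h⟩
    · exact ⟨_, hbraid k⟩
    · exact ⟨_, hpA k⟩
    · exact ⟨_, hpB k⟩
    · exact ⟨_, hsB k h⟩
    · exact ⟨_, hsA k h⟩
  · rintro ⟨r, rfl⟩
    cases r with
    | ab k l h => exact hab k l h ▸ G.ab k l h
    | ba k l h => exact hba k l h ▸ G.ba k l h
    | aa k l h => exact haa k l h ▸ G.aa k l h
    | bb k l h => exact hbb k l h ▸ G.bb k l h
    | braid k => exact hbraid k ▸ G.braid k
    | powA k => exact hpA k ▸ G.powA k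
    | powB k => exact hpB k ▸ G.powB k
    | serreB k h => exact hsB k h ▸ G.serreB k h
    | serreA k h => exact hsA k h ▸ G.serreA k h

/-- One inclusion is enough for all uses, so it need not be checked which coefficients survive in
`K`. -/
theorem mem_support_tail {r : Rel p} {v : FreeMonoid Gen} (hv : v ∈ (r.tail K).coeff.support) :
    ∃ x ∈ r.tailTerms, v = FreeMonoid.ofList x.2 := by
  rw [Rel.tail] at hv
  generalize r.tailTerms = L at hv ⊢
  induction L with
  | nil => simp at hv
  | cons x L ih =>
    rw [List.map_cons, List.sum_cons, MonoidAlgebra.coeff_add, Finsupp.mem_support_iff,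
      Finsupp.add_apply] at hv
    by_cases h : ((L.map fun x => (x.1 : K) • mon (K := K) (FreeMonoid.ofList x.2)).sum).coeff v = 0
    · rw [h, add_zero, MonoidAlgebra.coeff_smul, Finsupp.smul_apply, coeff_mon] at hv
      refine ⟨x, List.mem_cons_self, ?_⟩
      by_contra hne
      rw [Finsupp.single_eq_of_ne hne, smul_zero] at hv
      exact hv rfl
    · obtain ⟨y, hy, e⟩ := ih (Finsupp.mem_support_iff.mpr h)
      exact ⟨y, List.mem_cons_of_mem _ hy, e⟩

theorem exists_NF_cons {p : ℕ} {k i j l : ℕ} (hi : i < p) (hj : j < p) (hl : l < p) {w : List Gen}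
    (h : ∃ t, NF p (k + 1) w t) : ∃ t, NF p k (block k i j l ++ w) t := by
  obtain ⟨⟨I, J, L⟩, h⟩ := h
  exact ⟨_, NF.block k i j l w I J L hi hj hl h⟩

theorem exists_NF_block {p : ℕ} {k i j l : ℕ} (hi : i < p) (hj : j < p) (hl : l < p) :
    ∃ t, NF p k (block k i j l) t := by
  have := exists_NF_cons (k := k) hi hj hl ⟨_, NF.nil (p := p) (k + 1)⟩
  rwa [List.append_nil] at this

theorem exists_NF_flatMap_a (hp : 1 < p) (k n : ℕ) :
    ∃ t, NF p k ((List.range' k n).flatMap fun s => List.replicate (p - 1) (.a s)) t := by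
  induction n generalizing k with
  | zero => exact ⟨_, NF.nil k⟩
  | succ n ih =>
    rw [List.range'_succ, List.flatMap_cons]
    have := exists_NF_cons (k := k) (i := p - 1) (j := 0) (l := 0) (by omega) (by omega) (by omega)
      (ih (k + 1))
    simpa [block] using this

theorem exists_NF_flatMap_b (hp : 1 < p) (k n : ℕ) :
    ∃ t, NF p k ((List.range' k n).flatMap fun s => List.replicate (p - 1) (.b s)) t := by
  induction n generalizing k with
  | zero => exact ⟨_, NF.nil k⟩
  | succ n ih =>
    rw [List.range'_succ, List.flatMap_cons]
    have := exists_NF_cons (k := k) (i := 0) (j := 0) (l := p - 1) (by omega) (by omega) (by omega)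
      (ih (k + 1))
    simpa [block] using this

theorem normal_singleton (hp : 1 < p) (x : Gen) : Normal p [x] := by
  cases x with
  | a k => exact (exists_NF_block (k := k) (i := 1) (j := 0) (l := 0) hp (by omega)
      (by omega)).choose_spec.normal hp
  | b k => exact (exists_NF_block (k := k) (i := 0) (j := 0) (l := 1) (by omega) (by omega)
      hp).choose_spec.normal hp

theorem normal_pair (hp : 1 < p) {x y : Gen} (h : x.level < y.level) : Normal p [x, y] := by
  have hy : ∃ t, NF p (x.level + 1) [y] t := by
    obtain ⟨t, ht⟩ := (normal_singleton hp y).exists_NF hp (x.level + 1) (by simpa using h)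
    exact ⟨t, ht⟩
  cases x with
  | a k => exact (exists_NF_cons (k := k) (i := 1) (j := 0) (l := 0) hp (by omega)
      (by omega) hy).choose_spec.normal hp
  | b k => exact (exists_NF_cons (k := k) (i := 0) (j := 0) (l := 1) (by omega) (by omega)
      hp hy).choose_spec.normal hp

theorem normal_block (hp : 1 < p) (k : ℕ) {i j l : ℕ} (hi : i < p) (hj : j < p) (hl : l < p) :
    Normal p (block k i j l) :=
  (exists_NF_block hi hj hl).choose_spec.normal hp

/-- Rebracketing by one letter: (ab)^{n+1} = a (ba)^n b. -/
theorem flatten_ab_eq_block (k n : ℕ) :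
    (List.replicate (n + 1) [Gen.a k, Gen.b k]).flatten = block k 1 n 1 := by
  induction n with
  | zero => rfl
  | succ n ih =>
    rw [List.replicate_succ, List.flatten_cons, ih, block_succ, block_succ, block_zero_succ]
    rfl

/-- Each term is an explicit product of blocks. This makes the tail the normal form of the leading
word, which yields both the reducedness of `G` and the formula for d₁. -/
theorem Rel.normal_tailTerms (hp : 1 < p) (r : Rel p) {x : ℤ × List Gen} (hx : x ∈ r.tailTerms) :
    Normal p x.2 := by
  cases r with
  | ab k l h =>
    simp only [Rel.tailTerms, List.mem_cons, List.not_mem_nil, or_false] at hx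
    rcases hx with rfl | rfl
    · exact normal_pair hp h
    · have := exists_NF_cons (k := k) (i := p - 1) (j := 1) (l := 0) (by omega) (by omega)
        (by omega) (exists_NF_flatMap_a hp (k + 1) (l - (k + 1)))
      obtain ⟨t, ht⟩ := this
      have := ht.normal hp
      simpa [block] using this
  | ba k l h =>
    simp only [Rel.tailTerms, List.mem_cons, List.not_mem_nil, or_false] at hx
    rcases hx with rfl | rfl
    · exact normal_pair hp h
    -- The first factor b_k^{p-1} of the product belongs to the block of level k, so only the
    -- factors from level k + 1 on are left over.
    · have := exists_NF_cons (k := k) (i := 0) (j := 1) (l := p - 1) (by omega) (by omega)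
        (by omega) (exists_NF_flatMap_b hp (k + 1) (l - (k + 1)))
      obtain ⟨t, ht⟩ := this
      have := ht.normal hp
      have e : l - k = l - (k + 1) + 1 := by omega
      simpa [block, e, List.range'_succ] using this
  | aa k l h =>
    simp only [Rel.tailTerms, List.mem_singleton] at hx
    subst hx
    exact normal_pair hp h
  | bb k l h =>
    simp only [Rel.tailTerms, List.mem_singleton] at hx
    subst hx
    exact normal_pair hp h
  | braid k =>
    simp only [Rel.tailTerms, List.mem_singleton] at hx
    subst hx
    obtain ⟨q, rfl⟩ := Nat.exists_eq_add_of_le' hp.le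
    rw [flatten_ab_eq_block]
    exact normal_block hp k (by omega) (by omega) (by omega)
  | powA k => simp [Rel.tailTerms] at hx
  | powB k => simp [Rel.tailTerms] at hx
  | serreB k h =>
    simp only [Rel.tailTerms, List.mem_cons, List.not_mem_nil, or_false] at hx
    rcases hx with rfl | rfl
    · exact normal_block hp k (i := 0) (j := 1) (l := 1) (by omega) (by omega) (by omega)
    · exact normal_block hp k (i := 1) (j := 0) (l := 2) (by omega) (by omega) (by omega)
  | serreA k h =>
    simp only [Rel.tailTerms, List.mem_cons, List.not_mem_nil, or_false] at hx
    rcases hx with rfl | rfl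
    · exact normal_block hp k (i := 1) (j := 1) (l := 0) (by omega) (by omega) (by omega)
    · exact normal_block hp k (i := 2) (j := 0) (l := 1) (by omega) (by omega) (by omega)

theorem Rel.lexLT_tailTerms (hp : 1 < p) (r : Rel p) {x : ℤ × List Gen} (hx : x ∈ r.tailTerms) :
    LexLT x.2 r.lead := by
  have hhead : ∀ {x y : Gen} (v w : List Gen), x.rank < y.rank → LexLT (x :: v) (y :: w) :=
    fun v w h => ⟨[], _, _, v, w, rfl, rfl, h⟩
  -- Writing p = q + 2 shows that a_k^{p-1} is not empty, so that the second tail term of an `ab`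
  -- relation begins with a_k.
  obtain ⟨q, rfl⟩ := Nat.exists_eq_add_of_le' hp
  cases r with
  | ab k l h =>
    simp only [Rel.tailTerms, List.mem_cons, List.not_mem_nil, or_false] at hx
    rcases hx with rfl | rfl
    · exact hhead _ _ (by simp only [Gen.rank]; omega)
    · simp only [Nat.add_succ_sub_one, List.replicate_succ, List.cons_append]
      exact hhead _ _ (by simp only [Gen.rank]; omega)
  | ba k l h =>
    simp only [Rel.tailTerms, List.mem_cons, List.not_mem_nil, or_false] at hx
    rcases hx with rfl | rfl <;> exact hhead _ _ (by simp only [Gen.rank]; omega)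
  | aa k l h =>
    simp only [Rel.tailTerms, List.mem_singleton] at hx
    subst hx
    exact hhead _ _ (by simp only [Gen.rank]; omega)
  | bb k l h =>
    simp only [Rel.tailTerms, List.mem_singleton] at hx
    subst hx
    exact hhead _ _ (by simp only [Gen.rank]; omega)
  | braid k =>
    simp only [Rel.tailTerms, List.mem_singleton] at hx
    subst hx
    exact hhead _ _ (by simp only [Gen.rank]; omega)
  | powA k => simp [Rel.tailTerms] at hx
  | powB k => simp [Rel.tailTerms] at hx
  | serreB k h =>
    simp only [Rel.tailTerms, List.mem_cons, List.not_mem_nil, or_false] at hx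
    rcases hx with rfl | rfl
    -- The words bab and bba share their first letter; this is the only tail term that is not
    -- already smaller there.
    · exact ⟨[.b k], .a k, .b k, _, _, rfl, rfl, by simp only [Gen.rank]; omega⟩
    · exact hhead _ _ (by simp only [Gen.rank]; omega)
  | serreA k h =>
    simp only [Rel.tailTerms, List.mem_cons, List.not_mem_nil, or_false] at hx
    rcases hx with rfl | rfl <;> exact hhead _ _ (by simp only [Gen.rank]; omega)

/-- The sum of (p - 1) p^s for k ≤ s < k + n telescopes; adding p^k avoids a subtraction. -/
theorem sum_deg_flatMap_a (hp : 1 < p) (k n : ℕ) :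
    (((List.range' k n).flatMap fun s => List.replicate (p - 1) (.a s)).map (Gen.deg p)).sum +
      (p ^ k, 0) = (p ^ (k + n), 0) := by
  induction n generalizing k with
  | zero => simp
  | succ n ih =>
    obtain ⟨q, rfl⟩ := Nat.exists_eq_add_of_le' hp.le
    have := ih (k + 1)
    rw [List.range'_succ, List.flatMap_cons, List.map_append, List.sum_append, add_right_comm,
      add_comm _ (List.sum _), show k + (n + 1) = k + 1 + n by omega, ← this]
    congr 1
    simp [Gen.deg]
    ring

theorem sum_deg_flatMap_b (hp : 1 < p) (k n : ℕ) :
    (((List.range' k n).flatMap fun s => List.replicate (p - 1) (.b s)).map (Gen.deg p)).sum +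
      (0, p ^ k) = (0, p ^ (k + n)) := by
  induction n generalizing k with
  | zero => simp
  | succ n ih =>
    obtain ⟨q, rfl⟩ := Nat.exists_eq_add_of_le' hp.le
    have := ih (k + 1)
    rw [List.range'_succ, List.flatMap_cons, List.map_append, List.sum_append, add_right_comm,
      add_comm _ (List.sum _), show k + (n + 1) = k + 1 + n by omega, ← this]
    congr 1
    simp [Gen.deg]
    ring

theorem Rel.deg_tailTerms (hp : 1 < p) (r : Rel p) {x : ℤ × List Gen} (hx : x ∈ r.tailTerms) :
    (x.2.map (Gen.deg p)).sum = (r.lead.map (Gen.deg p)).sum := by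
  cases r with
  | ab k l h =>
    simp only [Rel.tailTerms, List.mem_cons, List.not_mem_nil, or_false] at hx
    rcases hx with rfl | rfl
    · simp [Rel.lead, Gen.deg]
    · have h1 := sum_deg_flatMap_a hp (k + 1) (l - (k + 1))
      rw [show k + 1 + (l - (k + 1)) = l by omega] at h1
      obtain ⟨q, rfl⟩ := Nat.exists_eq_add_of_le' hp.le
      simp only [Rel.lead, List.map_append, List.map_cons, List.map_nil, List.sum_append,
        List.sum_cons, List.sum_nil, List.map_replicate, List.sum_replicate, Gen.deg,
        Nat.add_sub_cancel, add_zero] at h1 ⊢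
      rw [← h1]
      have h3 : (q • ((q + 1) ^ k, 0) : ℕ × ℕ) + ((q + 1) ^ k, 0) = ((q + 1) ^ (k + 1), 0) := by
        simp; ring
      rw [← h3]
      abel
  | ba k l h =>
    simp only [Rel.tailTerms, List.mem_cons, List.not_mem_nil, or_false] at hx
    rcases hx with rfl | rfl
    · simp [Rel.lead, Gen.deg]
    · have h1 := sum_deg_flatMap_b hp k (l - k)
      rw [show k + (l - k) = l by omega] at h1
      simp only [Rel.lead, List.map_cons, List.map_nil, List.sum_cons, List.sum_nil, Gen.deg, add_zero] at h1 ⊢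
      rw [← h1]
      abel
  | aa k l h =>
    simp only [Rel.tailTerms, List.mem_singleton] at hx
    subst hx
    simp [Rel.lead, Gen.deg, add_comm]
  | bb k l h =>
    simp only [Rel.tailTerms, List.mem_singleton] at hx
    subst hx
    simp [Rel.lead, Gen.deg, add_comm]
  | braid k =>
    simp only [Rel.tailTerms, List.mem_singleton] at hx
    subst hx
    simp [Rel.lead, Gen.deg, List.map_flatten, List.sum_flatten]
  | powA k => simp [Rel.tailTerms] at hx
  | powB k => simp [Rel.tailTerms] at hx
  | serreB k h =>
    simp only [Rel.tailTerms, List.mem_cons, List.not_mem_nil, or_false] at hx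
    rcases hx with rfl | rfl <;> simp [Rel.lead, Gen.deg]
  | serreA k h =>
    simp only [Rel.tailTerms, List.mem_cons, List.not_mem_nil, or_false] at hx
    rcases hx with rfl | rfl <;> simp [Rel.lead, Gen.deg]

end Groebner

end Kostant

/-! ### A criterion for gradings -/

namespace Graded

section

variable {Γ : Type} [DecidableEq Γ] {M : Type u} [AddCommGroup M]

/-- The maps `c s` recover the components from a sum, which gives injectivity; generation by
homogeneous elements gives surjectivity. -/
theorem isInternal_of_components {σ : Type*} [SetLike σ M] [AddSubmonoidClass σ M] (ℳ : Γ → σ)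
    (c : Γ → M →+ M) (h1 : ∀ s, ∀ x ∈ ℳ s, c s x = x)
    (h2 : ∀ s t, s ≠ t → ∀ x ∈ ℳ t, c s x = 0)
    (h3 : ∀ x, x ∈ AddSubmonoid.closure (⋃ s, (ℳ s : Set M))) : DirectSum.IsInternal ℳ := by
  constructor
  · intro x y hxy
    have key : ∀ (s : Γ) (z : DirectSum Γ fun s => ℳ s),
        c s (DirectSum.coeAddMonoidHom ℳ z) = z s := by
      intro s z
      induction z using DirectSum.induction_on with
      | zero => simp
      | of t z =>
        rw [DirectSum.coeAddMonoidHom_of]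
        by_cases hst : t = s
        · subst hst
          rw [DirectSum.of_eq_same]
          exact h1 _ _ z.2
        · rw [DirectSum.of_eq_of_ne _ _ _ (Ne.symm hst)]
          exact h2 _ _ (Ne.symm hst) _ z.2
      | add y z hy hz => rw [map_add, map_add, hy, hz]; rfl
    refine DFinsupp.ext fun s => Subtype.ext ?_
    rw [← key s x, ← key s y, hxy]
  · intro x
    have hx : x ∈ AddMonoidHom.mrange (DirectSum.coeAddMonoidHom ℳ) := by
      refine AddSubmonoid.closure_le.mpr ?_ (h3 x)
      intro y hy
      obtain ⟨s, hs⟩ := Set.mem_iUnion.mp hy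
      exact ⟨DirectSum.of (fun s => ℳ s) s ⟨y, hs⟩, DirectSum.coeAddMonoidHom_of _ _ _⟩
    exact hx

end

end Graded

namespace Kostant

open Anick

namespace DivPowBasis

variable {K : Type u} [Field K] {A : Type u} [Ring A] [Algebra K A] (H : DivPowBasis K A)

/-! ## The grading -/

/-- The degree of a basis element. -/
def tripleDeg (t : ℕ × ℕ × ℕ) : ℕ × ℕ := (t.1 + t.2.1, t.2.1 + t.2.2)

/-- The grading of `A`. -/
noncomputable def grading (s : ℕ × ℕ) : Submodule K A :=
  Submodule.span K {x | ∃ i j k : ℕ, (i + j, j + k) = s ∧ x = H.E i j k}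

theorem E_mem_grading (i j k : ℕ) : H.E i j k ∈ H.grading (i + j, j + k) :=
  Submodule.subset_span ⟨i, j, k, rfl, rfl⟩

theorem one_mem_grading : (1 : A) ∈ H.grading 0 := by
  rw [← H.E_zero]; exact H.E_mem_grading 0 0 0

theorem mul_mem_grading {s t : ℕ × ℕ} {x y : A} (hx : x ∈ H.grading s) (hy : y ∈ H.grading t) :
    x * y ∈ H.grading (s + t) := by
  refine Submodule.span_induction₂ (p := fun a b _ _ => a * b ∈ H.grading (s + t))
    ?_ ?_ ?_ ?_ ?_ ?_ ?_ hx hy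
  · rintro _ _ ⟨i, j, k, rfl, rfl⟩ ⟨i', j', k', rfl, rfl⟩
    rw [H.E_mul_E]
    refine Submodule.sum_mem _ fun m hm => Submodule.smul_mem _ _ ?_
    rw [Finset.mem_range] at hm
    convert H.E_mem_grading (i + i' - m) (j + j' + m) (k + k' - m) using 2
    simp only [Prod.mk_add_mk, Prod.mk.injEq]
    omega
  · intro y _; rw [zero_mul]; exact zero_mem _
  · intro y _; rw [mul_zero]; exact zero_mem _
  · intro x y z _ _ _ h1 h2; rw [add_mul]; exact add_mem h1 h2
  · intro x y z _ _ _ h1 h2; rw [mul_add]; exact add_mem h1 h2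
  · intro r x y _ _ h; rw [smul_mul_assoc]; exact Submodule.smul_mem _ _ h
  · intro r x y _ _ h; rw [mul_smul_comm]; exact Submodule.smul_mem _ _ h

/-- The component of degree `s`. -/
noncomputable def component (s : ℕ × ℕ) : A →ₗ[K] A :=
  H.basis.constr K fun t => if tripleDeg t = s then H.basis t else 0

theorem component_basis (s : ℕ × ℕ) (t : ℕ × ℕ × ℕ) :
    H.component s (H.basis t) = if tripleDeg t = s then H.basis t else 0 :=
  H.basis.constr_basis K _ t

theorem component_of_mem {s : ℕ × ℕ} {x : A} (hx : x ∈ H.grading s) : H.component s x = x := by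
  induction hx using Submodule.span_induction with
  | mem x h =>
    obtain ⟨i, j, k, h, rfl⟩ := h
    rw [E, component_basis]
    exact if_pos h
  | zero => exact map_zero _
  | add x y _ _ hx hy => rw [map_add, hx, hy]
  | smul c x _ hx => rw [map_smul, hx]

theorem component_of_mem_ne {s t : ℕ × ℕ} (h : s ≠ t) {x : A} (hx : x ∈ H.grading t) :
    H.component s x = 0 := by
  induction hx using Submodule.span_induction with
  | mem x hx =>
    obtain ⟨i, j, k, rfl, rfl⟩ := hx
    rw [E, component_basis]
    exact if_neg (Ne.symm h)
  | zero => exact map_zero _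
  | add x y _ _ hx hy => rw [map_add, hx, hy, add_zero]
  | smul c x _ hx => rw [map_smul, hx, smul_zero]

theorem basis_mem_grading (t : ℕ × ℕ × ℕ) : H.basis t ∈ H.grading (tripleDeg t) :=
  H.E_mem_grading t.1 t.2.1 t.2.2

theorem basis_induction {P : A → Prop} (h0 : P 0) (hadd : ∀ x y, P x → P y → P (x + y))
    (hE : ∀ (c : K) t, P (c • H.basis t)) (x : A) : P x := by
  have hx : x ∈ Submodule.span K (Set.range H.basis) := by rw [H.basis.span_eq]; trivial
  induction hx using Submodule.closure_induction with
  | zero => exact h0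
  | add x y _ _ hx hy => exact hadd x y hx hy
  | smul_mem c x hx => obtain ⟨t, rfl⟩ := hx; exact hE c t

theorem component_mem (s : ℕ × ℕ) (x : A) : H.component s x ∈ H.grading s := by
  induction x using H.basis_induction with
  | h0 => rw [map_zero]; exact zero_mem _
  | hadd x y hx hy => rw [map_add]; exact add_mem hx hy
  | hE c t =>
    rw [map_smul, component_basis]
    refine Submodule.smul_mem _ _ ?_
    split_ifs with h
    · subst h; exact H.basis_mem_grading t
    · exact zero_mem _

theorem grading_isInternal : DirectSum.IsInternal H.grading :=
  Graded.isInternal_of_components H.grading (fun s => (H.component s).toAddMonoidHom)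
    (fun _ _ hx => H.component_of_mem hx) (fun _ _ h _ hx => H.component_of_mem_ne h hx) (by
      intro x
      induction x using H.basis_induction with
      | h0 => exact zero_mem _
      | hadd x y hx hy => exact add_mem hx hy
      | hE c t => exact AddSubmonoid.subset_closure (Set.mem_iUnion.mpr ⟨tripleDeg t,
          Submodule.smul_mem _ _ (H.basis_mem_grading t)⟩))

theorem isGradedAlgebra : Graded.IsGradedAlgebra H.grading :=
  ⟨{ one_mem := H.one_mem_grading, mul_mem := fun _ _ _ _ hx hy => H.mul_mem_grading hx hy },
    H.grading_isInternal⟩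

theorem eq_zero_of_component_eq_zero {x : A} (h : ∀ s, H.component s x = 0) : x = 0 := by
  have key : ∀ (x : A) t, H.basis.repr (H.component (tripleDeg t) x) t = H.basis.repr x t := by
    intro x t
    induction x using H.basis_induction with
    | h0 => simp
    | hadd x y hx hy => simp [hx, hy]
    | hE c t' =>
      rw [map_smul, component_basis]
      split_ifs with h'
      · rfl
      · rw [smul_zero, map_smul, H.basis.repr_self, map_zero, Finsupp.smul_apply,
          Finsupp.single_eq_of_ne (by rintro rfl; exact h' rfl), smul_zero]
        rfl
  refine H.basis.repr.injective (Finsupp.ext fun t => ?_)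
  rw [← key, h, map_zero]

/-- The degree bounds all three exponents of a basis element. -/
instance finiteDimensional_grading (s : ℕ × ℕ) : FiniteDimensional K (H.grading s) := by
  refine FiniteDimensional.span_of_finite K ?_
  have hfin : ((Finset.Iic s.1 ×ˢ (Finset.Iic s.1 ×ˢ Finset.Iic s.2) : Finset (ℕ × ℕ × ℕ)) :
      Set (ℕ × ℕ × ℕ)).Finite := Finset.finite_toSet _
  refine (hfin.image H.basis).subset ?_
  rintro _ ⟨i, j, k, rfl, rfl⟩
  exact ⟨(i, j, k), by simp, rfl⟩

/-- A surjective linear endomorphism which preserves degrees is injective. -/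
theorem injective_of_surjective_of_graded (T : A →ₗ[K] A)
    (hT : ∀ t, T (H.basis t) ∈ H.grading (tripleDeg t)) (hs : Function.Surjective T) :
    Function.Injective T := by
  have hcomm : ∀ s x, T (H.component s x) = H.component s (T x) := by
    intro s x
    induction x using H.basis_induction with
    | h0 => simp
    | hadd x y hx hy => simp [hx, hy]
    | hE c t =>
      rw [map_smul, map_smul, map_smul, map_smul, component_basis]
      split_ifs with h
      · subst h; rw [H.component_of_mem (hT t)]
      · rw [map_zero, H.component_of_mem_ne (Ne.symm h) (hT t)]
  have hmem : ∀ s, ∀ x ∈ H.grading s, T x ∈ H.grading s := by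
    intro s x hx
    rw [← H.component_of_mem hx, hcomm]
    exact H.component_mem s _
  have hinj : ∀ s, Function.Injective (T.restrict (hmem s)) := by
    intro s
    -- On the finite-dimensional piece of degree s surjectivity suffices, and a preimage in the
    -- piece is the component of any preimage.
    rw [LinearMap.injective_iff_surjective]
    rintro ⟨y, hy⟩
    obtain ⟨z, rfl⟩ := hs y
    refine ⟨⟨H.component s z, H.component_mem s z⟩, Subtype.ext ?_⟩
    change T (H.component s z) = T z
    rw [hcomm, H.component_of_mem hy]
  rw [injective_iff_map_eq_zero]
  intro x hx
  refine H.eq_zero_of_component_eq_zero fun s => ?_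
  have h1 : T.restrict (hmem s) ⟨H.component s x, H.component_mem s x⟩ = 0 := by
    apply Subtype.ext
    change T (H.component s x) = 0
    rw [hcomm, hx, map_zero]
  exact congrArg Subtype.val ((injective_iff_map_eq_zero _).mp (hinj s) _ h1)

/-! ## The generators -/

/-- The images of the generators. -/
noncomputable def gen (p : ℕ) : Gen → A
  | .a k => H.E (p ^ k) 0 0
  | .b k => H.E 0 0 (p ^ k)

theorem gen_mem_grading (p : ℕ) (x : Gen) : H.gen p x ∈ H.grading (x.deg p) := by
  cases x with
  | a k => exact H.E_mem_grading (p ^ k) 0 0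
  | b k => simpa [gen, Gen.deg] using H.E_mem_grading 0 0 (p ^ k)

theorem proj_mon_mem_grading (p : ℕ) (w : FreeMonoid Gen) :
    proj (H.gen p) (mon (K := K) w) ∈ H.grading (wordDeg p w) := by
  induction w using FreeMonoid.inductionOn' with
  | one => rw [mon_one, map_one]; exact H.one_mem_grading
  | of_mul x w ih =>
    rw [mon_mul, map_mul, wordDeg_mul, proj_mon_of, wordDeg_of]
    exact H.mul_mem_grading (H.gen_mem_grading p x) ih

variable (p : ℕ) [hp : Fact p.Prime] [CharP K p]

theorem proj_eq_zero {g : Poly K Gen} (hg : g ∈ G K p) : proj (H.gen p) g = 0 := by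
  have ha : ∀ k, proj (H.gen p) (va K k) = H.E (p ^ k) 0 0 := fun k => proj_mon_of _ _
  have hb : ∀ k, proj (H.gen p) (vb K k) = H.E 0 0 (p ^ k) := fun k => proj_mon_of _ _
  cases hg with
  | ab k l h =>
    have := H.relation_ab p k l h
    simp only [map_add, map_sub, map_mul, map_pow, map_neg, map_one, ha, hb, orderedProd,
      map_list_prod, List.map_map, Function.comp_def]
    rw [this, neg_add_cancel]
  | ba k l h =>
    have := H.relation_ba p k l h
    simp only [map_sub, map_mul, map_pow, map_neg, map_one, ha, hb, orderedProd,
      map_list_prod, List.map_map, Function.comp_def]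
    rw [this, sub_self]
  | aa k l h =>
    simp only [map_sub, map_mul, ha]
    exact sub_eq_zero.mpr (H.isDivPowSeq_alpha.commute _ _)
  | bb k l h =>
    simp only [map_sub, map_mul, hb]
    exact sub_eq_zero.mpr (H.isDivPowSeq_beta.commute _ _)
  | braid k =>
    simp only [map_sub, map_mul, map_pow, ha, hb]
    exact sub_eq_zero.mpr (H.relation_braid p k)
  | powA k =>
    rw [map_pow, ha]
    exact H.isDivPowSeq_alpha.pow_prime p (pow_ne_zero _ hp.out.ne_zero)
  | powB k =>
    rw [map_pow, hb]
    exact H.isDivPowSeq_beta.pow_prime p (pow_ne_zero _ hp.out.ne_zero)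
  | serreB k h =>
    simp only [map_add, map_sub, map_mul, map_pow, ha, hb, map_ofNat]
    exact H.relation_serreB p k
  | serreA k h =>
    simp only [map_add, map_sub, map_mul, map_pow, ha, hb, map_ofNat]
    exact H.relation_serreA p k

/-- Let q be the largest power of p with q ≤ n. Then x_q x_{n-q} = binom(n, q) x_n, and by Lucas'
congruence the coefficient is the leading digit of n, which is invertible in `K`. -/
theorem _root_.Kostant.IsDivPowSeq.mem_of_pow_mem {x : ℕ → A} (hx : IsDivPowSeq K x)
    (S : Subalgebra K A) (h : ∀ k, x (p ^ k) ∈ S) (n : ℕ) : x n ∈ S := by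
  induction n using Nat.strong_induction_on with
  | _ n ih =>
    rcases Nat.eq_zero_or_pos n with rfl | hn
    · rw [hx.zero]; exact one_mem _
    have h1 : p ^ Nat.log p n ≤ n := Nat.pow_log_le_self p hn.ne'
    have h2 : n < p ^ (Nat.log p n + 1) := Nat.lt_pow_succ_log_self hp.out.one_lt n
    generalize Nat.log p n = k at h1 h2
    have hpos : 0 < p ^ k := pow_pos hp.out.pos k
    have h3 := hx.mul (p ^ k) (n - p ^ k)
    rw [Nat.add_sub_cancel' h1] at h3
    have h4 : ((n.choose (p ^ k) : ℕ) : K) = ((n / p ^ k : ℕ) : K) := by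
      have := natCast_choose_pow K p k (n / p ^ k) 1 (n % p ^ k) 0 (Nat.mod_lt _ hpos) hpos
      rw [Nat.div_add_mod'] at this
      simpa using this
    have h5 : ((n / p ^ k : ℕ) : K) ≠ 0 := by
      rw [Ne, CharP.cast_eq_zero_iff K p]
      refine Nat.not_dvd_of_pos_of_lt (Nat.div_pos h1 hpos) ?_
      rw [Nat.div_lt_iff_lt_mul hpos, ← pow_succ']
      exact h2
    have h6 : x n = ((n / p ^ k : ℕ) : K)⁻¹ • (x (p ^ k) * x (n - p ^ k)) := by
      rw [h3, h4, smul_smul, inv_mul_cancel₀ h5, one_smul]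
    rw [h6]
    exact S.smul_mem (S.mul_mem (h k) (ih _ (by omega))) _

/-- Divided powers of e_α and e_β come from their p-power members. The element e_{α+β}^{(n)} is, up
to sign, the last term of e_β^{(n)} e_α^{(n)}, whose other terms involve smaller powers of e_{α+β}.
-/
theorem proj_surjective : Function.Surjective (proj (K := K) (H.gen p)) := by
  let S : Subalgebra K A := (proj (K := K) (H.gen p)).range
  have ha : ∀ n, H.E n 0 0 ∈ S := H.isDivPowSeq_alpha.mem_of_pow_mem p S fun k =>
    ⟨va K k, proj_mon_of _ _⟩
  have hb : ∀ n, H.E 0 0 n ∈ S := H.isDivPowSeq_beta.mem_of_pow_mem p S fun k =>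
    ⟨vb K k, proj_mon_of _ _⟩
  have hc : ∀ n, H.E 0 n 0 ∈ S := by
    intro n
    induction n using Nat.strong_induction_on with
    | _ n ih =>
      have h1 := H.beta_mul_alpha n n
      rw [min_self, Finset.sum_range_succ, Nat.sub_self] at h1
      have h2 : (-1 : K) ^ n • H.E 0 n 0 ∈ S := by
        rw [eq_sub_iff_add_eq'.mpr h1.symm]
        refine S.sub_mem (S.mul_mem (hb n) (ha n)) (S.sum_mem fun m hm => S.smul_mem ?_ _)
        rw [H.E_eq_mul]
        exact S.mul_mem (S.mul_mem (ha _) (ih m (Finset.mem_range.mp hm))) (hb _)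
      have h3 := S.smul_mem h2 ((-1 : K) ^ n)
      rwa [smul_smul, ← mul_pow, neg_one_mul, neg_neg, one_pow, one_smul] at h3
  have hS : ∀ x : A, x ∈ S := by
    intro x
    induction x using H.basis_induction with
    | h0 => exact zero_mem _
    | hadd x y hx hy => exact add_mem hx hy
    | hE c t =>
      refine S.smul_mem ?_ _
      have := H.E_eq_mul t.1 t.2.1 t.2.2
      rw [E] at this
      rw [this]
      exact S.mul_mem (S.mul_mem (ha _) (hc _)) (hb _)
  exact hS

end DivPowBasis

end Kostant

namespace Kostant

open Anick

/-! ### Reduction to normal words, and reducedness of `G` -/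

section ReducedBasis

variable (K : Type u) [Field K] {p : ℕ}

/-- The first, the last, and the second letter of a leading word, and its length. -/
def Rel.signature : Rel p → Gen × Gen × Option Gen × ℕ
  | .ab k l _ => (.a l, .b k, some (.b k), 2)
  | .ba k l _ => (.b l, .a k, some (.a k), 2)
  | .aa k l _ => (.a l, .a k, some (.a k), 2)
  | .bb k l _ => (.b l, .b k, some (.b k), 2)
  | .braid k => (.b k, .a k, some (.a k), 2 * p)
  | .powA k => (.a k, .a k, some (.a k), p)
  | .powB k => (.b k, .b k, some (.b k), p)
  | .serreB k _ => (.b k, .a k, some (.b k), 3)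
  | .serreA k _ => (.b k, .a k, some (.a k), 3)

theorem Rel.signature_eq (hp : 1 < p) (r : Rel p) :
    r.lead.head? = some r.signature.1 ∧ r.lead.getLast? = some r.signature.2.1 ∧
      r.lead[1]? = r.signature.2.2.1 ∧ r.lead.length = r.signature.2.2.2 := by
  obtain ⟨q, rfl⟩ := Nat.exists_eq_add_of_le' hp
  cases r with
  | braid k =>
    refine ⟨rfl, ?_, rfl, ?_⟩
    · rw [Rel.lead, List.replicate_succ', List.flatten_append]
      simp [Rel.signature]
    · simp [Rel.lead, Rel.signature, mul_comm]
  | powA k => simp [Rel.lead, Rel.signature, List.getLast?_replicate, List.head?_replicate]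
  | powB k => simp [Rel.lead, Rel.signature, List.getLast?_replicate, List.head?_replicate]
  | _ => simp [Rel.lead, Rel.signature]

/-- The second letter separates the two Serre words, and the length separates the braid word, of
even length 2p, from baa. -/
theorem Rel.lead_injective (hp : 1 < p) : Function.Injective (Rel.lead (p := p)) := by
  intro r r' h
  have h1 := r.signature_eq hp
  have h2 := r'.signature_eq hp
  rw [h] at h1
  have e1 := Option.some.inj (h1.1.symm.trans h2.1)
  have e2 := Option.some.inj (h1.2.1.symm.trans h2.2.1)
  have e3 := h1.2.2.1.symm.trans h2.2.2.1
  have e4 := h1.2.2.2.symm.trans h2.2.2.2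
  clear h h1 h2
  cases r <;> cases r' <;> simp [Rel.signature] at e1 e2 e3 e4 <;> first | omega | (subst_vars; rfl)

theorem Rel.normal_tail_lead (hp : 1 < p) (r : Rel p) : Normal p r.lead.tail := by
  obtain ⟨q, rfl⟩ := Nat.exists_eq_add_of_le' hp.le
  cases r with
  | ab k l h => exact normal_singleton hp _
  | ba k l h => exact normal_singleton hp _
  | aa k l h => exact normal_singleton hp _
  | bb k l h => exact normal_singleton hp _
  | braid k =>
    have := normal_block hp k (i := 1) (j := q) (l := 0) hp (by omega) (by omega)
    simpa [Rel.lead, block, List.replicate_succ] using this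
  | powA k =>
    have := normal_block hp k (i := q) (j := 0) (l := 0) (by omega) (by omega) (by omega)
    simpa [Rel.lead, block, List.replicate_succ] using this
  | powB k =>
    have := normal_block hp k (i := 0) (j := 0) (l := q) (by omega) (by omega) (by omega)
    simpa [Rel.lead, block, List.replicate_succ] using this
  | serreB k h => exact normal_block hp k (i := 0) (j := 1) (l := 0) (by omega) hp (by omega)
  | serreA k h => exact normal_block hp k (i := 2) (j := 0) (l := 0) (by omega) (by omega) (by omega)

/-- Together with `normal_tail_lead` this makes the leading words minimal non-normal words. It also
shows that no normal form has to be computed in δ₁, which acts on the leading word without its last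
letter. -/
theorem Rel.normal_dropLast_lead (hp : 1 < p) (r : Rel p) : Normal p r.lead.dropLast := by
  obtain ⟨q, rfl⟩ := Nat.exists_eq_add_of_le' hp.le
  cases r with
  | ab k l h => exact normal_singleton hp _
  | ba k l h => exact normal_singleton hp _
  | aa k l h => exact normal_singleton hp _
  | bb k l h => exact normal_singleton hp _
  | braid k =>
    have := normal_block hp k (i := 0) (j := q) (l := 1) (by omega) (by omega) hp
    have e : (Rel.braid (p := q + 1) k).lead = block k 0 q 1 ++ [.a k] := by
      rw [Rel.lead, List.replicate_succ', List.flatten_append]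
      simp [block]
    rwa [e, List.dropLast_concat]
  | powA k =>
    have := normal_block hp k (i := q) (j := 0) (l := 0) (by omega) (by omega) (by omega)
    simpa [Rel.lead, block, List.dropLast_replicate] using this
  | powB k =>
    have := normal_block hp k (i := 0) (j := 0) (l := q) (by omega) (by omega) (by omega)
    simpa [Rel.lead, block, List.dropLast_replicate] using this
  | serreB k h => exact normal_block hp k (i := 0) (j := 0) (l := 2) (by omega) (by omega) (by omega)
  | serreA k h => exact normal_block hp k (i := 0) (j := 1) (l := 0) (by omega) hp (by omega)

theorem Rel.two_le_length_lead (hp : 1 < p) (r : Rel p) : 2 ≤ r.lead.length := by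
  rw [(r.signature_eq hp).2.2.2]
  cases r <;> simp only [Rel.signature] <;> omega

/-- A proper factor misses the first or the last letter, and what remains of the larger word is
normal. -/
theorem Rel.eq_of_infix (hp : 1 < p) {r r' : Rel p} (h : r.lead <:+: r'.lead) : r = r' := by
  apply Rel.lead_injective hp
  have h1 := r'.normal_tail_lead hp r
  have h2 := r'.normal_dropLast_lead hp r
  have hne : r'.lead ≠ [] := List.ne_nil_of_length_pos (by have := r'.two_le_length_lead hp; omega)
  generalize r'.lead = w at h h1 h2 hne
  cases w with
  | nil => exact absurd rfl hne
  | cons x w =>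
    rcases List.infix_cons_iff.mp h with h | h
    · rw [← List.dropLast_append_getLast hne] at h
      rcases List.prefix_concat_iff.mp h with h | h
      · rw [h]; exact List.dropLast_append_getLast hne
      · exact absurd h.isInfix h2
    · exact absurd h h1

theorem Rel.wordLT_of_mem_support (hp : 1 < p) {r : Rel p} {v : FreeMonoid Gen}
    (hv : v ∈ (r.tail K).coeff.support) (u z : FreeMonoid Gen) :
    wordLT p (u * v * z) (u * r.word * z) := by
  obtain ⟨x, hx, rfl⟩ := mem_support_tail K hv
  have hd : wordDeg p (FreeMonoid.ofList x.2) = wordDeg p r.word := r.deg_tailTerms hp hx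
  refine wordLT_of_lexLT p ?_ ((r.lexLT_tailTerms hp hx).append u.toList z.toList)
  rw [wordDeg_mul, wordDeg_mul, wordDeg_mul, wordDeg_mul, hd]

theorem Rel.wordDeg_of_mem_support (hp : 1 < p) {r : Rel p} {v : FreeMonoid Gen}
    (hv : v ∈ (r.tail K).coeff.support) : wordDeg p v = wordDeg p r.word := by
  obtain ⟨x, hx, rfl⟩ := mem_support_tail K hv
  exact r.deg_tailTerms hp hx

theorem Rel.word_not_mem_support (hp : 1 < p) (r : Rel p) : (r.tail K).coeff r.word = 0 := by
  by_contra h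
  have := r.wordLT_of_mem_support K hp (Finsupp.mem_support_iff.mpr h) 1 1
  exact wordLT_irrefl p _ this

theorem Rel.coeff_word (hp : 1 < p) (r : Rel p) : (mon r.word - r.tail K).coeff r.word = 1 := by
  rw [MonoidAlgebra.coeff_sub, Finsupp.sub_apply, r.word_not_mem_support K hp, coeff_mon,
    Finsupp.single_eq_same, sub_zero]

theorem Rel.mem_support (r : Rel p) {v : FreeMonoid Gen}
    (hv : v ∈ (mon r.word - r.tail K).coeff.support) :
    v = r.word ∨ v ∈ (r.tail K).coeff.support := by
  by_contra! h
  rw [Finsupp.mem_support_iff, MonoidAlgebra.coeff_sub, Finsupp.sub_apply,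
    Finsupp.notMem_support_iff.mp h.2, coeff_mon, Finsupp.single_eq_of_ne h.1, sub_zero] at hv
  exact hv rfl

theorem Rel.isLeading_iff (hp : 1 < p) (r : Rel p) (w : FreeMonoid Gen) :
    IsLeading (wordLT p) (mon r.word - r.tail K) w ↔ w = r.word := by
  have hmem : r.word ∈ (mon r.word - r.tail K).coeff.support := by
    rw [Finsupp.mem_support_iff, r.coeff_word K hp]; exact one_ne_zero
  have hlt : ∀ v ∈ (mon r.word - r.tail K).coeff.support, v ≠ r.word → wordLT p v r.word := by
    intro v hv hne
    simpa only [one_mul, mul_one] using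
      r.wordLT_of_mem_support K hp ((r.mem_support K hv).resolve_left hne) 1 1
  constructor
  · intro h
    by_contra hne
    exact wordLT_irrefl p _ (wordLT_trans p (hlt w h.1 hne) (h.2 _ hmem (Ne.symm hne)))
  · rintro rfl
    exact ⟨hmem, hlt⟩

theorem exists_isLeading_iff (hp : 1 < p) (w : FreeMonoid Gen) :
    (∃ g ∈ G K p, IsLeading (wordLT p) g w) ↔ ∃ r : Rel p, w = r.word := by
  constructor
  · rintro ⟨g, hg, hw⟩
    obtain ⟨r, rfl⟩ := (mem_G_iff K g).mp hg
    exact ⟨r, (r.isLeading_iff K hp w).mp hw⟩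
  · rintro ⟨r, rfl⟩
    exact ⟨_, (mem_G_iff K _).mpr ⟨r, rfl⟩, (r.isLeading_iff K hp _).mpr rfl⟩

theorem nonReducible_iff (hp : 1 < p) (f : Poly K Gen) :
    NonReducible (wordLT p) (G K p) f ↔ ∀ w ∈ f.coeff.support, Normal p w.toList := by
  constructor
  · rintro h w hw r ⟨u, v, e⟩
    refine h _ ⟨_, (mem_G_iff K _).mpr ⟨r, rfl⟩, r.word, (r.isLeading_iff K hp _).mpr rfl,
      FreeMonoid.ofList u, FreeMonoid.ofList v, ?_, rfl⟩
    have : FreeMonoid.ofList u * r.word * FreeMonoid.ofList v = w := e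
    rwa [this]
  · rintro h _ ⟨g, hg, m, hm, u, v, huv, rfl⟩
    obtain ⟨r, rfl⟩ := (mem_G_iff K g).mp hg
    rw [r.isLeading_iff K hp] at hm
    subst hm
    exact h _ huv r ⟨u.toList, v.toList, rfl⟩

theorem nonReducible_diff (hp : 1 < p) {g : Poly K Gen} (hg : g ∈ G K p) :
    NonReducible (wordLT p) (G K p \ {g}) g := by
  rintro _ ⟨g', ⟨hg', hne⟩, m, hm, u, v, huv, rfl⟩
  obtain ⟨r, rfl⟩ := (mem_G_iff K g).mp hg
  obtain ⟨r', rfl⟩ := (mem_G_iff K g').mp hg'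
  rw [r'.isLeading_iff K hp] at hm
  subst hm
  rcases r.mem_support K huv with h | h
  · have : r' = r := Rel.eq_of_infix hp ⟨u.toList, v.toList, h⟩
    subst this
    exact hne rfl
  · obtain ⟨x, hx, e⟩ := mem_support_tail K h
    exact r.normal_tailTerms hp hx r' ⟨u.toList, v.toList, e⟩

/-- The span of the normal words. -/
noncomputable def normalSpan (p : ℕ) : Submodule K (Poly K Gen) :=
  Submodule.span K {f | ∃ w : FreeMonoid Gen, Normal p w.toList ∧ f = mon w}

/-- The two-sided ideal generated by the Gröbner basis, as a vector space. -/
noncomputable def relSpan (p : ℕ) : Submodule K (Poly K Gen) :=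
  Submodule.span K {f | ∃ (u v : FreeMonoid Gen) (r : Rel p),
    f = mon u * (mon r.word - r.tail K) * mon v}

theorem mem_normalSpan_iff (f : Poly K Gen) :
    f ∈ normalSpan K p ↔ ∀ w ∈ f.coeff.support, Normal p w.toList := by
  constructor
  · intro h
    induction h using Submodule.span_induction with
    | mem f h =>
      obtain ⟨w, hw, rfl⟩ := h
      intro v hv
      rw [coeff_mon] at hv
      rwa [Finset.mem_singleton.mp (Finsupp.support_single_subset hv)]
    | zero => simp
    | add f g _ _ hf hg =>
      classical
      intro w hw
      rw [MonoidAlgebra.coeff_add] at hw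
      rcases Finset.mem_union.mp (Finsupp.support_add hw) with h | h
      · exact hf w h
      · exact hg w h
    | smul c f _ hf =>
      intro w hw
      rw [MonoidAlgebra.coeff_smul] at hw
      exact hf w (Finsupp.support_smul hw)
  · intro h
    rw [poly_eq_sum f]
    exact Submodule.sum_mem _ fun w hw =>
      Submodule.smul_mem _ _ (Submodule.subset_span ⟨w, h w hw, rfl⟩)

/-- The division algorithm as a well-founded induction: modulo the ideal, a word containing a
leading word is a combination of smaller words. -/
theorem mon_mem_sup (hp : 1 < p) (w : FreeMonoid Gen) :
    mon w ∈ normalSpan K p ⊔ relSpan K p := by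
  induction w using (wordLT_wellFounded hp).induction with
  | _ w ih =>
    by_cases hw : Normal p w.toList
    · exact Submodule.mem_sup_left (Submodule.subset_span ⟨w, hw, rfl⟩)
    · simp only [Normal, not_forall, not_not] at hw
      obtain ⟨r, u, v, e⟩ := hw
      obtain rfl : FreeMonoid.ofList u * r.word * FreeMonoid.ofList v = w := e
      generalize FreeMonoid.ofList u = u at ih
      generalize FreeMonoid.ofList v = v at ih
      have h1 : mon u * (mon r.word - r.tail K) * mon v ∈ normalSpan K p ⊔ relSpan K p :=
        Submodule.mem_sup_right (Submodule.subset_span ⟨u, v, r, rfl⟩)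
      have h2 : mon u * r.tail K * mon v ∈ normalSpan K p ⊔ relSpan K p := by
        rw [poly_eq_sum (r.tail K), Finset.mul_sum, Finset.sum_mul]
        refine Submodule.sum_mem _ fun z hz => ?_
        rw [mul_smul_comm, smul_mul_assoc, ← mon_mul, ← mon_mul]
        exact Submodule.smul_mem _ _ (ih _ (r.wordLT_of_mem_support K hp hz u v))
      have h3 := add_mem h1 h2
      rwa [mul_sub, sub_mul, sub_add_cancel, ← mon_mul, ← mon_mul] at h3

theorem normalSpan_sup_relSpan (hp : 1 < p) : normalSpan K p ⊔ relSpan K p = ⊤ := by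
  rw [eq_top_iff]
  intro f _
  rw [poly_eq_sum f]
  exact Submodule.sum_mem _ fun w _ => Submodule.smul_mem _ _ (mon_mem_sup K hp w)

end ReducedBasis

/-! ### Independence of the normal words and the Gröbner basis property -/

namespace DivPowBasis

variable {K : Type u} [Field K] {A : Type u} [Ring A] [Algebra K A] (H : DivPowBasis K A)
  (p : ℕ) [hp : Fact p.Prime]

open Classical in
/-- The endomorphism of `A` which sends a basis element to the image of the normal word which has
the same digits, if there is one. -/
noncomputable def normalEnd : A →ₗ[K] A :=
  H.basis.constr K fun t => if h : ∃ w, NF p 0 w t then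
    proj (H.gen p) (mon (K := K) (FreeMonoid.ofList h.choose)) else 0

theorem normalEnd_basis {w : List Gen} {t : ℕ × ℕ × ℕ} (h : NF p 0 w t) :
    H.normalEnd p (H.basis t) = proj (H.gen p) (mon (K := K) (FreeMonoid.ofList w)) := by
  have hex : ∃ w, NF p 0 w t := ⟨w, h⟩
  rw [normalEnd, H.basis.constr_basis, dif_pos hex, hex.choose_spec.eq_of_eq hp.out.pos h rfl]

variable [CharP K p]

theorem relSpan_le_ker : relSpan K p ≤ LinearMap.ker (proj (K := K) (H.gen p)).toLinearMap := by
  rw [relSpan, Submodule.span_le]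
  rintro _ ⟨u, v, r, rfl⟩
  change proj (H.gen p) _ = 0
  rw [map_mul, map_mul, H.proj_eq_zero p ((mem_G_iff K _).mpr ⟨r, rfl⟩), mul_zero, zero_mul]

theorem exists_normalSpan_proj_eq (a : A) : ∃ f ∈ normalSpan K p, proj (H.gen p) f = a := by
  obtain ⟨f, rfl⟩ := H.proj_surjective p a
  have hf : f ∈ normalSpan K p ⊔ relSpan K p := by
    rw [normalSpan_sup_relSpan K hp.out.one_lt]; trivial
  obtain ⟨g, hg, h, hh, rfl⟩ := Submodule.mem_sup.mp hf
  refine ⟨g, hg, ?_⟩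
  have : proj (H.gen p) h = 0 := H.relSpan_le_ker p hh
  rw [map_add, this, add_zero]

/-- Surjectivity holds because the images of the normal words span `A`. A surjective endomorphism
preserving degrees is injective on finite-dimensional pieces, so this dimension count replaces the
verification of overlaps. -/
theorem normalEnd_injective : Function.Injective (H.normalEnd p) := by
  refine H.injective_of_surjective_of_graded _ ?_ ?_
  · intro t
    by_cases h : ∃ w, NF p 0 w t
    · obtain ⟨w, hw⟩ := h
      rw [H.normalEnd_basis p hw]
      have := H.proj_mon_mem_grading p (FreeMonoid.ofList w)
      rw [hw.wordDeg] at this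
      simpa [tripleDeg] using this
    · rw [normalEnd, H.basis.constr_basis, dif_neg h]
      exact zero_mem _
  · intro a
    obtain ⟨f, hf, rfl⟩ := H.exists_normalSpan_proj_eq p a
    induction hf using Submodule.span_induction with
    | mem f h =>
      obtain ⟨w, hw, rfl⟩ := h
      obtain ⟨t, ht⟩ := hw.exists_NF hp.out.one_lt 0 (by simp)
      exact ⟨_, H.normalEnd_basis p ht⟩
    | zero => exact ⟨0, by simp⟩
    | add f g _ _ hf hg =>
      obtain ⟨x, hx⟩ := hf
      obtain ⟨y, hy⟩ := hg
      exact ⟨x + y, by rw [map_add, map_add, hx, hy]⟩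
    | smul c f _ hf =>
      obtain ⟨x, hx⟩ := hf
      exact ⟨c • x, by rw [map_smul, map_smul, hx]⟩

theorem eq_zero_of_proj_eq_zero {f : Poly K Gen} (hf : f ∈ normalSpan K p)
    (h0 : proj (H.gen p) f = 0) : f = 0 := by
  have hN := (mem_normalSpan_iff K f).mp hf
  have hex : ∀ w : f.coeff.support, ∃ t, NF p 0 w.1.toList t := fun w =>
    (hN w.1 w.2).exists_NF hp.out.one_lt 0 (by simp)
  choose t ht using hex
  have htinj : Function.Injective t := fun v w h =>
    Subtype.ext ((ht v).eq_of_eq hp.out.pos (ht w) h)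
  -- Distinct normal words have distinct digits, so their images come from distinct basis elements
  -- under an injective map.
  have hind : LinearIndependent K fun w : f.coeff.support => H.normalEnd p (H.basis (t w)) :=
    (H.basis.linearIndependent.comp t htinj).map' (H.normalEnd p)
      (LinearMap.ker_eq_bot.mpr (H.normalEnd_injective p))
  have hsum : ∑ w : f.coeff.support, f.coeff w.1 • H.normalEnd p (H.basis (t w)) = 0 := by
    rw [poly_eq_sum f, map_sum, ← Finset.sum_coe_sort] at h0
    rw [← h0]
    refine Finset.sum_congr rfl fun w _ => ?_
    rw [H.normalEnd_basis p (ht w), map_smul]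
    rfl
  have hz := Fintype.linearIndependent_iff.mp hind _ hsum
  rw [poly_eq_sum f]
  refine Finset.sum_eq_zero fun w hw => ?_
  rw [hz ⟨w, hw⟩, zero_smul]

theorem isReducedGroebnerBasis :
    IsReducedGroebnerBasis (wordLT p) (H.gen p) (G K p) := by
  have hset : ∀ f : Poly K Gen, NonReducible (wordLT p) (G K p) f ↔ f ∈ normalSpan K p := fun f =>
    (nonReducible_iff K hp.out.one_lt f).trans (mem_normalSpan_iff K f).symm
  refine ⟨⟨fun g hg => H.proj_eq_zero p hg, fun _ _ => trivial, ?_, ?_⟩,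
    fun g hg => nonReducible_diff K hp.out.one_lt hg⟩
  · intro f hf g hg hfg
    have hf := (hset f).mp hf
    have hg := (hset g).mp hg
    refine sub_eq_zero.mp (H.eq_zero_of_proj_eq_zero p (sub_mem hf hg) ?_)
    rw [map_sub, hfg, sub_self]
  · intro a _
    obtain ⟨f, hf, e⟩ := H.exists_normalSpan_proj_eq p a
    exact ⟨f, (hset f).mpr hf, e⟩

/-- The normal part of f also projects to zero, hence is zero. This is the input for exactness at
P₀. -/
theorem ker_proj_le_relSpan {f : Poly K Gen} (h0 : proj (H.gen p) f = 0) : f ∈ relSpan K p := by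
  have hf : f ∈ normalSpan K p ⊔ relSpan K p := by
    rw [normalSpan_sup_relSpan K hp.out.one_lt]; trivial
  obtain ⟨g, hg, h, hh, rfl⟩ := Submodule.mem_sup.mp hf
  have h1 : proj (H.gen p) h = 0 := H.relSpan_le_ker p hh
  rw [map_add, h1, add_zero] at h0
  rwa [H.eq_zero_of_proj_eq_zero p hg h0, zero_add]

end DivPowBasis

end Kostant

/-! ### Homogeneous components -/

namespace Graded

section Components

variable {Γ : Type} [DecidableEq Γ] {M : Type u} [AddCommGroup M] {σ : Type*} [SetLike σ M]
  [AddSubmonoidClass σ M] {ℳ : Γ → σ} (h : DirectSum.IsInternal ℳ)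

include h

/-- The homogeneous component of degree `s`. -/
noncomputable def component (s : Γ) : M →+ M :=
  (AddSubmonoidClass.subtype (ℳ s)).comp ((DFinsupp.evalAddMonoidHom s).comp
    (AddEquiv.ofBijective (DirectSum.coeAddMonoidHom ℳ) h).symm.toAddMonoidHom)

theorem component_mem (s : Γ) (x : M) : component h s x ∈ ℳ s := Subtype.property _

theorem component_coe (s : Γ) (z : DirectSum Γ fun s => ℳ s) :
    component h s (DirectSum.coeAddMonoidHom ℳ z) = z s := by
  change (((AddEquiv.ofBijective (DirectSum.coeAddMonoidHom ℳ) h).symm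
    (AddEquiv.ofBijective (DirectSum.coeAddMonoidHom ℳ) h z)) s : M) = z s
  rw [AddEquiv.symm_apply_apply]

theorem component_of_mem {s : Γ} {x : M} (hx : x ∈ ℳ s) : component h s x = x := by
  have := component_coe h s (DirectSum.of (fun s => ℳ s) s ⟨x, hx⟩)
  rwa [DirectSum.coeAddMonoidHom_of, DirectSum.of_eq_same] at this

theorem component_of_mem_ne {s t : Γ} (hst : s ≠ t) {x : M} (hx : x ∈ ℳ t) :
    component h s x = 0 := by
  have := component_coe h s (DirectSum.of (fun s => ℳ s) t ⟨x, hx⟩)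
  rwa [DirectSum.coeAddMonoidHom_of, DirectSum.of_eq_of_ne _ _ _ hst] at this

theorem exists_sum_component (x : M) : ∃ F : Finset Γ, x = ∑ s ∈ F, component h s x := by
  classical
  obtain ⟨z, rfl⟩ := h.2 x
  refine ⟨z.support, ?_⟩
  simp only [component_coe]
  exact DirectSum.coeAddMonoidHom_eq_dfinsuppSum ℳ z

theorem homogeneous_induction {P : M → Prop} (h0 : P 0) (hadd : ∀ x y, P x → P y → P (x + y))
    (hmem : ∀ s, ∀ x ∈ ℳ s, P x) (x : M) : P x := by
  obtain ⟨F, hF⟩ := exists_sum_component h x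
  rw [hF]
  exact Finset.sum_induction _ P hadd h0 fun s _ => hmem s _ (component_mem h s x)

end Components

/-! ### Graded submodules, projective covers and free graded modules -/

section GradedModules

variable {Γ : Type} [AddCancelCommMonoid Γ] [DecidableEq Γ] {K A : Type u} [Field K] [Ring A]
  [Algebra K A] {𝒜 : Γ → Submodule K A}

section Module

variable {M : Type u} [AddCommGroup M] [Module A M] {ℳ : Γ → AddSubgroup M}

theorem component_smul (hM : IsGradedModule 𝒜 ℳ) {s : Γ} {a : A} (ha : a ∈ 𝒜 s) (t : Γ) (x : M) :
    component hM.1 (s + t) (a • x) = a • component hM.1 t x := by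
  induction x using homogeneous_induction hM.1 with
  | h0 => simp
  | hadd x y hx hy => simp only [smul_add, map_add, hx, hy]
  | hmem u x hx =>
    by_cases h : t = u
    · subst h
      rw [component_of_mem hM.1 hx, component_of_mem hM.1 (hM.2 _ _ _ ha _ hx)]
    · rw [component_of_mem_ne hM.1 h hx, smul_zero,
        component_of_mem_ne hM.1 (fun e => h (add_left_cancel e)) (hM.2 _ _ _ ha _ hx)]

theorem component_smul_eq_zero (hM : IsGradedModule 𝒜 ℳ) {s t : Γ} (h : ∀ u, t ≠ s + u) {a : A}
    (ha : a ∈ 𝒜 s) (x : M) : component hM.1 t (a • x) = 0 := by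
  induction x using homogeneous_induction hM.1 with
  | h0 => simp
  | hadd x y hx hy => simp only [smul_add, map_add, hx, hy, add_zero]
  | hmem u x hx => exact component_of_mem_ne hM.1 (h u) (hM.2 _ _ _ ha _ hx)

/-- For the forward direction, a homogeneous scalar shifts components, and by cancellation in `Γ` at
most one component of x contributes to a given degree of a • x. -/
theorem isGradedSubmodule_iff (hA : IsGradedAlgebra 𝒜) (hM : IsGradedModule 𝒜 ℳ)
    (T : Submodule A M) :
    IsGradedSubmodule ℳ T ↔ ∀ x ∈ T, ∀ s, component hM.1 s x ∈ T := by
  constructor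
  · intro h x hx
    rw [h] at hx
    induction hx using Submodule.span_induction with
    | mem x hx =>
      obtain ⟨hxT, t, ht⟩ := hx
      intro s
      by_cases hst : s = t
      · subst hst; rwa [component_of_mem hM.1 ht]
      · rw [component_of_mem_ne hM.1 hst ht]; exact zero_mem _
    | zero => intro s; rw [map_zero]; exact zero_mem _
    | add x y _ _ hx hy => intro s; rw [map_add]; exact add_mem (hx s) (hy s)
    | smul a x _ hx =>
      intro t
      induction a using homogeneous_induction hA.2 with
      | h0 => rw [zero_smul, map_zero]; exact zero_mem _
      | hadd a b ha hb => rw [add_smul, map_add]; exact add_mem ha hb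
      | hmem s a ha =>
        by_cases h : ∃ u, t = s + u
        · obtain ⟨u, rfl⟩ := h
          rw [component_smul hM ha]
          exact T.smul_mem _ (hx u)
        · rw [component_smul_eq_zero hM (not_exists.mp h) ha]
          exact zero_mem _
  · intro h
    refine le_antisymm ?_ (Submodule.span_le.mpr fun x hx => hx.1)
    intro x hx
    obtain ⟨F, hF⟩ := exists_sum_component hM.1 x
    rw [hF]
    exact Submodule.sum_mem _ fun s _ => Submodule.subset_span ⟨h x hx s, s, component_mem _ _ _⟩

/-- Needed to regard a first syzygy as a graded module, whose projective covers can then be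
compared. -/
theorem isGradedModule_comap (hA : IsGradedAlgebra 𝒜) (hM : IsGradedModule 𝒜 ℳ)
    {T : Submodule A M} (hT : IsGradedSubmodule ℳ T) :
    IsGradedModule 𝒜 fun s => (ℳ s).comap T.subtype.toAddMonoidHom := by
  have hT := (isGradedSubmodule_iff hA hM T).mp hT
  refine ⟨isInternal_of_components _
    (fun s => ((component hM.1 s).comp T.subtype.toAddMonoidHom).codRestrict T
      fun x => hT x x.2 s) ?_ ?_ ?_, fun s t a ha x hx => hM.2 s t a ha x hx⟩
  · intro s x hx
    exact Subtype.ext (component_of_mem hM.1 hx)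
  · intro s t hst x hx
    exact Subtype.ext (component_of_mem_ne hM.1 hst hx)
  · intro x
    obtain ⟨F, hF⟩ := exists_sum_component hM.1 (x : M)
    have : x = ∑ s ∈ F, ⟨component hM.1 s x, hT x x.2 s⟩ := by
      apply Subtype.ext
      rw [AddSubmonoidClass.coe_finsetSum]
      exact hF
    rw [this]
    exact sum_mem fun s _ => AddSubmonoid.subset_closure
      (Set.mem_iUnion.mpr ⟨s, component_mem hM.1 s (x : M)⟩)

end Module

section Hom

variable {M N : Type u} [AddCommGroup M] [Module A M] [AddCommGroup N] [Module A N]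
  {ℳ : Γ → AddSubgroup M} {𝒩 : Γ → AddSubgroup N}

omit [AddCancelCommMonoid Γ] in
theorem IsGradedHom.component_apply {f : M →ₗ[A] N} (hf : IsGradedHom ℳ 𝒩 f)
    (hM : DirectSum.IsInternal ℳ) (hN : DirectSum.IsInternal 𝒩) (s : Γ) (x : M) :
    component hN s (f x) = f (component hM s x) := by
  induction x using homogeneous_induction hM with
  | h0 => simp
  | hadd x y hx hy => simp only [map_add, hx, hy]
  | hmem t x hx =>
    by_cases h : s = t
    · subst h
      rw [component_of_mem hM hx, component_of_mem hN (hf _ _ hx)]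
    · rw [component_of_mem_ne hM h hx, component_of_mem_ne hN h (hf _ _ hx), map_zero]

theorem IsGradedHom.isGradedSubmodule_range {f : M →ₗ[A] N} (hf : IsGradedHom ℳ 𝒩 f)
    (hA : IsGradedAlgebra 𝒜) (hM : IsGradedModule 𝒜 ℳ) (hN : IsGradedModule 𝒜 𝒩) :
    IsGradedSubmodule 𝒩 (LinearMap.range f) := by
  rw [isGradedSubmodule_iff hA hN]
  rintro _ ⟨x, rfl⟩ s
  exact ⟨_, (hf.component_apply hM.1 hN.1 s x).symm⟩

/-- Projective covers are unique. -/
theorem exists_equiv_of_isSmall_ker {P Q : Type u} [AddCommGroup P] [Module A P] [AddCommGroup Q]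
    [Module A Q] {𝒰 : Γ → AddSubgroup P} {𝒬 : Γ → AddSubgroup Q} (hA : IsGradedAlgebra 𝒜)
    (hP : IsProjective 𝒜 𝒰) (hQ : IsProjective 𝒜 𝒬) (hN : IsGradedModule 𝒜 𝒩)
    {f : P →ₗ[A] N} {g : Q →ₗ[A] N} (hf : IsGradedHom 𝒰 𝒩 f) (hg : IsGradedHom 𝒬 𝒩 g)
    (hfs : Function.Surjective f) (hgs : Function.Surjective g)
    (hfm : IsSmall 𝒰 (LinearMap.ker f)) (hgm : IsSmall 𝒬 (LinearMap.ker g)) :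
    ∃ e : P ≃ₗ[A] Q, (∀ s x, x ∈ 𝒰 s ↔ e x ∈ 𝒬 s) ∧ ∀ x, g (e x) = f x := by
  obtain ⟨h, hh, hgh⟩ := hP.2 Q N 𝒬 𝒩 hQ.1 hN g f hg hgs hf
  have hgh : ∀ x, g (h x) = f x := fun x => LinearMap.congr_fun hgh x
  -- As g ∘ h = f is onto, the range of h together with the small submodule ker g is everything.
  have hsurj : Function.Surjective h := by
    rw [← LinearMap.range_eq_top]
    refine hgm.2 _ (hh.isGradedSubmodule_range hA hP.1 hQ.1) (eq_top_iff.mpr fun y _ => ?_)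
    obtain ⟨x, hx⟩ := hfs (g y)
    refine Submodule.mem_sup.mpr ⟨h x, ⟨x, rfl⟩, y - h x, ?_, by abel⟩
    rw [LinearMap.mem_ker, map_sub, hgh, hx, sub_self]
  -- Projectivity of Q splits h by a section k. Since x - k (h x) lies in ker f, smallness of ker f
  -- makes k onto, hence a two-sided inverse.
  obtain ⟨k, hk, hhk⟩ := hQ.2 P Q 𝒰 𝒬 hP.1 hQ.1 h LinearMap.id hh hsurj fun _ _ hx => hx
  have hhk : ∀ y, h (k y) = y := fun y => LinearMap.congr_fun hhk y
  have ksurj : Function.Surjective k := by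
    rw [← LinearMap.range_eq_top]
    refine hfm.2 _ (hk.isGradedSubmodule_range hA hQ.1 hP.1) (eq_top_iff.mpr fun x _ => ?_)
    refine Submodule.mem_sup.mpr ⟨k (h x), ⟨h x, rfl⟩, x - k (h x), ?_, by abel⟩
    rw [LinearMap.mem_ker, map_sub, ← hgh, ← hgh, hhk, sub_self]
  have hkh : ∀ x, k (h x) = x := by
    intro x
    obtain ⟨y, rfl⟩ := ksurj x
    rw [hhk]
  refine ⟨LinearEquiv.ofLinearMap h k (LinearMap.ext hhk) (LinearMap.ext hkh),
    fun s x => ⟨hh s x, fun hx => ?_⟩, hgh⟩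
  have := hk s _ hx
  rwa [show k (LinearEquiv.ofLinearMap h k (LinearMap.ext hhk) (LinearMap.ext hkh) x) = x
    from hkh x] at this

end Hom

section Free

omit [DecidableEq Γ] in
-- Cancellation in `Γ` leaves a single summand in the supremum that defines the shifted grading.
theorem mem_shift_iff {d β : Γ} {a : A} :
    a ∈ (⨆ γ : Γ, ⨆ _ : γ + d = β + d, 𝒜 γ) ↔ a ∈ 𝒜 β := by
  have : (⨆ γ : Γ, ⨆ _ : γ + d = β + d, 𝒜 γ) = 𝒜 β := by
    refine le_antisymm (iSup₂_le fun γ h => ?_) (le_iSup₂_of_le β rfl le_rfl)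
    rw [add_right_cancel h]
  rw [this]

omit [DecidableEq Γ] in
theorem eq_zero_of_mem_shift {d s : Γ} (h : ∀ β, β + d ≠ s) {a : A}
    (ha : a ∈ (⨆ γ : Γ, ⨆ _ : γ + d = s, 𝒜 γ)) : a = 0 := by
  have : (⨆ γ : Γ, ⨆ _ : γ + d = s, 𝒜 γ) = ⊥ := by
    refine le_antisymm (iSup₂_le fun γ hγ => absurd hγ (h γ)) bot_le
  rwa [this, Submodule.mem_bot] at ha

omit [DecidableEq Γ] in
theorem shift_induction {d s : Γ} {P : A → Γ → Prop} {a : A}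
    (ha : a ∈ (⨆ γ : Γ, ⨆ _ : γ + d = s, 𝒜 γ)) (h0 : P 0 s)
    (hmem : ∀ β, ∀ a ∈ 𝒜 β, P a (β + d)) : P a s := by
  by_cases h : ∃ β, β + d = s
  · obtain ⟨β, rfl⟩ := h
    exact hmem β a (mem_shift_iff.mp ha)
  · rwa [eq_zero_of_mem_shift (not_exists.mp h) ha]

variable {T : Type} (deg : T → Γ)

omit [DecidableEq Γ] in
theorem single_mem_freeGrading {β : Γ} {a : A} (ha : a ∈ 𝒜 β) (t : T) :
    Finsupp.single t a ∈ freeGrading 𝒜 deg (β + deg t) := by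
  intro u
  by_cases h : t = u
  · subst h; rw [Finsupp.single_eq_same]; exact mem_shift_iff.mpr ha
  · rw [Finsupp.single_eq_of_ne (Ne.symm h)]; exact zero_mem _

open Classical in
/-- The component of degree `s` of `A[d]`. -/
noncomputable def shiftComponent (hA : IsGradedAlgebra 𝒜) (d s : Γ) : A →+ A :=
  if h : ∃ β, β + d = s then component hA.2 h.choose else 0

theorem shiftComponent_add (hA : IsGradedAlgebra 𝒜) (d β : Γ) :
    shiftComponent hA d (β + d) = component hA.2 β := by
  have h : ∃ γ, γ + d = β + d := ⟨β, rfl⟩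
  rw [shiftComponent, dif_pos h, add_right_cancel h.choose_spec]

theorem shiftComponent_of_mem_ne (hA : IsGradedAlgebra 𝒜) {d s β : Γ} (h : s ≠ β + d) {a : A}
    (ha : a ∈ 𝒜 β) : shiftComponent hA d s a = 0 := by
  by_cases h' : ∃ γ, γ + d = s
  · obtain ⟨γ, rfl⟩ := h'
    rw [shiftComponent_add]
    exact component_of_mem_ne hA.2 (by rintro rfl; exact h rfl) ha
  · rw [shiftComponent, dif_neg h']; rfl

/-- The component of degree `s` of a free graded module. -/
noncomputable def freeComponent (hA : IsGradedAlgebra 𝒜) (s : Γ) : (T →₀ A) →+ (T →₀ A) :=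
  Finsupp.liftAddHom fun t => (Finsupp.singleAddHom t).comp (shiftComponent hA (deg t) s)

theorem freeComponent_apply (hA : IsGradedAlgebra 𝒜) (s : Γ) (f : T →₀ A) (t : T) :
    freeComponent deg hA s f t = shiftComponent hA (deg t) s (f t) := by
  classical
  induction f using Finsupp.induction_linear with
  | zero => simp
  | add f g hf hg => simp only [map_add, Finsupp.add_apply, hf, hg]
  | single u a =>
    simp only [freeComponent, Finsupp.liftAddHom_apply_single, AddMonoidHom.comp_apply,
      Finsupp.singleAddHom_apply, Finsupp.single_apply]
    split_ifs with h
    · subst h; rfl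
    · rw [map_zero]

theorem freeGrading_isInternal (hA : IsGradedAlgebra 𝒜) :
    DirectSum.IsInternal (freeGrading 𝒜 deg) := by
  refine isInternal_of_components _ (freeComponent deg hA) ?_ ?_ ?_
  · intro s f hf
    ext t
    rw [freeComponent_apply]
    refine shift_induction (P := fun a s => shiftComponent hA (deg t) s a = a) (hf t) ?_ ?_
    · exact map_zero _
    · intro β a ha
      rw [shiftComponent_add, component_of_mem hA.2 ha]
  · intro s s' hs f hf
    ext t
    rw [freeComponent_apply]
    refine shift_induction (P := fun a s' => s ≠ s' → shiftComponent hA (deg t) s a = 0)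
      (hf t) ?_ ?_ hs
    · intro _; exact map_zero _
    · intro β a ha hne
      exact shiftComponent_of_mem_ne hA hne ha
  · intro f
    induction f using Finsupp.induction_linear with
    | zero => exact zero_mem _
    | add f g hf hg => exact add_mem hf hg
    | single t a =>
      induction a using homogeneous_induction hA.2 with
      | h0 => rw [Finsupp.single_zero]; exact zero_mem _
      | hadd a b ha hb => rw [Finsupp.single_add]; exact add_mem ha hb
      | hmem β a ha =>
        exact AddSubmonoid.subset_closure
          (Set.mem_iUnion.mpr ⟨β + deg t, single_mem_freeGrading deg ha t⟩)

theorem freeGrading_isGradedModule (hA : IsGradedAlgebra 𝒜) :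
    IsGradedModule 𝒜 (freeGrading 𝒜 deg) := by
  refine ⟨freeGrading_isInternal deg hA, fun s s' a ha f hf t => ?_⟩
  refine shift_induction (P := fun b s' => a • b ∈ ⨆ β : Γ, ⨆ _ : β + deg t = s + s', 𝒜 β)
    (hf t) ?_ ?_
  · rw [smul_zero]; exact zero_mem _
  · intro β b hb
    rw [← add_assoc, mem_shift_iff]
    exact hA.1.mul_mem ha hb

theorem single_one_mem_freeGrading (hA : IsGradedAlgebra 𝒜) (t : T) :
    Finsupp.single t (1 : A) ∈ freeGrading 𝒜 deg (deg t) := by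
  have := single_mem_freeGrading deg hA.1.one_mem t
  rwa [zero_add] at this

theorem isGradedHom_linearCombination {M : Type u} [AddCommGroup M] [Module A M]
    {ℳ : Γ → AddSubgroup M} (hM : IsGradedModule 𝒜 ℳ) {m : T → M} (hm : ∀ t, m t ∈ ℳ (deg t)) :
    IsGradedHom (freeGrading 𝒜 deg) ℳ (Finsupp.linearCombination A m) := by
  intro s f hf
  rw [Finsupp.linearCombination_apply]
  refine sum_mem fun t _ => ?_
  refine shift_induction (P := fun a s => a • m t ∈ ℳ s) (hf t) ?_ ?_
  · rw [zero_smul]; exact zero_mem _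
  · intro β a ha
    exact hM.2 _ _ _ ha _ (hm t)

theorem freeGrading_isProjective (hA : IsGradedAlgebra 𝒜) :
    IsProjective 𝒜 (freeGrading 𝒜 deg) := by
  refine ⟨freeGrading_isGradedModule deg hA, ?_⟩
  intro M N _ _ _ _ ℳ 𝒩 hM hN f g hf hfs hg
  choose m hm using fun t => hfs (g (Finsupp.single t 1))
  -- An arbitrary preimage of the image of a basis element need not be homogeneous; its component of
  -- the right degree is still a preimage.
  refine ⟨Finsupp.linearCombination A fun t => component hM.1 (deg t) (m t),
    isGradedHom_linearCombination deg hM fun t => component_mem _ _ _, ?_⟩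
  refine Finsupp.lhom_ext' fun t => LinearMap.ext_ring ?_
  simp only [LinearMap.comp_apply, Finsupp.lsingle_apply, Finsupp.linearCombination_single,
    one_smul]
  rw [← hf.component_apply hM.1 hN.1, hm,
    component_of_mem hN.1 (hg _ _ (single_one_mem_freeGrading deg hA t))]

theorem component_zero_eq_zero_of_mem_iSup (hA : IsGradedAlgebra 𝒜) {a : A}
    (ha : a ∈ ⨆ β : Γ, ⨆ _ : β ≠ 0, 𝒜 β) : component hA.2 0 a = 0 := by
  induction ha using Submodule.iSup_induction' with
  | zero => exact map_zero _
  | add a b _ _ ha hb => rw [map_add, ha, hb, add_zero]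
  | mem β a ha =>
    by_cases h : β = 0
    · rw [iSup_neg (not_not.mpr h), Submodule.mem_bot] at ha
      rw [ha, map_zero]
    · rw [iSup_pos h] at ha
      exact component_of_mem_ne hA.2 (Ne.symm h) ha

/-- The graded Nakayama lemma for free modules. -/
theorem isSmall_of_le_rad (hA : IsGradedAlgebra 𝒜) (size : Γ →+ ℕ)
    (hsize : ∀ β, size β = 0 → β = 0) {N : Submodule A (T →₀ A)}
    (hN : IsGradedSubmodule (freeGrading 𝒜 deg) N) (hrad : ∀ x ∈ N, x ∈ rad 𝒜 T) :
    IsSmall (freeGrading 𝒜 deg) N := by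
  have hF := freeGrading_isGradedModule deg hA
  refine ⟨hN, fun S hS htop => ?_⟩
  rw [isGradedSubmodule_iff hA hF] at hN hS
  -- Basis elements enter S by induction on the size of their degree. Since sizes are natural
  -- numbers, no finiteness of T is required.
  have key : ∀ n t, size (deg t) = n → Finsupp.single t (1 : A) ∈ S := by
    intro n
    induction n using Nat.strong_induction_on with
    | _ n ih =>
      rintro t rfl
      have hmem : Finsupp.single t (1 : A) ∈ S ⊔ N := htop ▸ Submodule.mem_top
      obtain ⟨x, hx, y, hy, hxy⟩ := Submodule.mem_sup.mp hmem
      -- Only the part of degree deg t matters: the component of x stays in S, and that of y stays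
      -- in N, hence in the radical.
      have hxy' := congrArg (component hF.1 (deg t)) hxy
      rw [component_of_mem hF.1 (single_one_mem_freeGrading deg hA t), map_add] at hxy'
      rw [← hxy']
      refine add_mem (hS x hx _) ?_
      have h1 := hrad _ (hN y hy (deg t))
      have h2 := component_mem hF.1 (deg t) y
      generalize component hF.1 (deg t) y = z at h1 h2
      rw [← Finsupp.sum_single z]
      refine Submodule.sum_mem _ fun u hu => ?_
      by_cases hβ : ∃ β, β + deg u = deg t
      · obtain ⟨β, hβ⟩ := hβ
        have h3 := h2 u
        rw [← hβ, mem_shift_iff] at h3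
        -- A coordinate of degree 0 in the radical would vanish. So β has positive size, and the
        -- basis element u is covered by the induction hypothesis.
        have h4 : β ≠ 0 := by
          rintro rfl
          have h5 := component_zero_eq_zero_of_mem_iSup hA (h1 u)
          rw [component_of_mem hA.2 h3] at h5
          exact Finsupp.mem_support_iff.mp hu h5
        have h5 := S.smul_mem (z u) (ih (size (deg u)) (by
          have h6 : size β ≠ 0 := fun h => h4 (hsize β h)
          rw [← hβ, map_add]
          omega) u rfl)
        rwa [Finsupp.smul_single, smul_eq_mul, mul_one] at h5
      · have h3 := eq_zero_of_mem_shift (not_exists.mp hβ) (h2 u)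
        exact absurd h3 (Finsupp.mem_support_iff.mp hu)
  rw [eq_top_iff]
  intro f _
  rw [← Finsupp.sum_single f]
  refine Submodule.sum_mem _ fun t _ => ?_
  have := S.smul_mem (f t) (key _ t rfl)
  rwa [Finsupp.smul_single, smul_eq_mul, mul_one] at this

end Free

end GradedModules

end Graded

/-! ### Fox calculus in the free algebra -/

namespace Anick

section Fox

variable {K : Type u} [Field K] {X : Type}

theorem eq_one_or_eq_mul_of (w : FreeMonoid X) : w = 1 ∨ ∃ u x, w = u * FreeMonoid.of x := by
  rcases List.eq_nil_or_concat' w.toList with h | ⟨u, x, h⟩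
  · exact Or.inl h
  · exact Or.inr ⟨FreeMonoid.ofList u, x, h⟩

theorem linearMap_eq_of_mon {V : Type*} [AddCommGroup V] [Module K V] {φ ψ : Poly K X →ₗ[K] V}
    (h : ∀ w, φ (mon w) = ψ (mon w)) (f : Poly K X) : φ f = ψ f := by
  rw [poly_eq_sum f]
  simp only [map_sum, map_smul, h]

theorem poly_induction {P : Poly K X → Prop} (h0 : P 0) (hadd : ∀ f g, P f → P g → P (f + g))
    (hmon : ∀ (c : K) w, P (c • mon w)) (f : Poly K X) : P f := by
  rw [poly_eq_sum f]
  exact Finset.sum_induction _ P hadd h0 fun w _ => hmon _ w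

/-- The coefficient of a word, as a linear functional. -/
noncomputable def coeffAt (w : FreeMonoid X) : Poly K X →ₗ[K] K :=
  Finsupp.lapply w ∘ₗ (MonoidAlgebra.coeffLinearEquiv K).toLinearMap

variable {A : Type u} [Ring A] [Algebra K A] (gen : X → A)

theorem j0_one : j0 (K := K) gen 1 = 0 := dif_neg (not_not.mpr rfl)

theorem j0_mul_of (u : FreeMonoid X) (x : X) :
    j0 (K := K) gen (u * FreeMonoid.of x) = Finsupp.single x (proj gen (mon (K := K) u)) := by
  have h : (u * FreeMonoid.of x).toList = u.toList ++ [x] := rfl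
  have hne : (u * FreeMonoid.of x).toList ≠ [] := by rw [h]; simp
  rw [j0, dif_pos hne]
  simp only [h, List.getLast_append_singleton, List.dropLast_concat]
  rfl

/-- The linear extension of `j0` to all polynomials. -/
noncomputable def fox : Poly K X →ₗ[K] X →₀ A :=
  Finsupp.linearCombination K (j0 (K := K) gen) ∘ₗ (MonoidAlgebra.coeffLinearEquiv K).toLinearMap

theorem fox_eq_sum (f : Poly K X) :
    fox gen f = f.coeff.sum fun w c => algebraMap K A c • j0 (K := K) gen w := by
  simp only [algebraMap_smul]
  rfl

theorem fox_mon (w : FreeMonoid X) : fox gen (mon (K := K) w) = j0 (K := K) gen w := by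
  rw [fox_eq_sum, coeff_mon, Finsupp.sum_single_index (by simp)]
  simp

theorem fox_one : fox gen (1 : Poly K X) = 0 := by
  rw [← mon_one, fox_mon, j0_one]

theorem fox_mul_of (f : Poly K X) (x : X) :
    fox gen (f * mon (FreeMonoid.of x)) = Finsupp.single x (proj gen f) := by
  have h : ∀ g : Poly K X, (fox gen ∘ₗ LinearMap.mulRight K (mon (FreeMonoid.of x))) g =
      ((Finsupp.lsingle x : A →ₗ[K] X →₀ A) ∘ₗ (proj gen).toLinearMap) g := by
    refine linearMap_eq_of_mon fun w => ?_
    rw [LinearMap.comp_apply, LinearMap.comp_apply, LinearMap.mulRight_apply, ← mon_mul, fox_mon,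
      j0_mul_of]
    rfl
  exact h f

/-- The last letter of a word uw is that of w unless w is empty, so only the constant term of f
disturbs left linearity. -/
theorem fox_mon_mul (u : FreeMonoid X) (f : Poly K X) : fox gen (mon u * f) =
    proj gen (mon (K := K) u) • fox gen f + f.coeff 1 • fox gen (mon (K := K) u) := by
  have key : ∀ w, fox gen (mon u * mon (K := K) w) = proj gen (mon (K := K) u) •
      fox gen (mon (K := K) w) + (mon (K := K) w).coeff 1 • fox gen (mon (K := K) u) := by
    intro w
    rcases eq_one_or_eq_mul_of w with rfl | ⟨v, x, rfl⟩
    · rw [mon_one, mul_one, fox_one, smul_zero, zero_add, ← mon_one, coeff_mon,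
        Finsupp.single_eq_same, one_smul]
    · have h : (1 : FreeMonoid X) ≠ v * FreeMonoid.of x := fun h =>
        absurd (congrArg FreeMonoid.toList h) (by simp)
      rw [coeff_mon, Finsupp.single_eq_of_ne h, zero_smul, add_zero, mon_mul, ← mul_assoc,
        fox_mul_of, fox_mul_of, map_mul, Finsupp.smul_single, smul_eq_mul]
  induction f using poly_induction with
  | h0 => rw [mul_zero, map_zero, smul_zero, MonoidAlgebra.coeff_zero, Finsupp.zero_apply,
      zero_smul, add_zero]
  | hadd f g hf hg =>
    rw [mul_add, map_add, hf, hg, map_add, smul_add, MonoidAlgebra.coeff_add, Finsupp.add_apply,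
      add_smul]
    abel
  | hmon c w =>
    rw [mul_smul_comm, map_smul, map_smul, key, MonoidAlgebra.coeff_smul, Finsupp.smul_apply,
      smul_add, smul_comm c, smul_assoc]

/-- Lifting each coordinate to a polynomial and multiplying by its letter gives a preimage; the
constant term can be removed because `fox` kills 1. -/
theorem exists_fox_eq (hs : Function.Surjective (proj (K := K) gen)) (v : X →₀ A) :
    ∃ f : Poly K X, f.coeff 1 = 0 ∧ fox gen f = v := by
  have h : ∃ f : Poly K X, fox gen f = v := by
    induction v using Finsupp.induction_linear with
    | zero => exact ⟨0, map_zero _⟩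
    | add v w hv hw =>
      obtain ⟨f, rfl⟩ := hv
      obtain ⟨g, rfl⟩ := hw
      exact ⟨f + g, map_add _ _ _⟩
    | single x a =>
      obtain ⟨f, rfl⟩ := hs a
      exact ⟨_, fox_mul_of gen f x⟩
  obtain ⟨f, rfl⟩ := h
  refine ⟨f - f.coeff 1 • 1, ?_, ?_⟩
  · rw [MonoidAlgebra.coeff_sub, MonoidAlgebra.coeff_smul, ← mon_one, coeff_mon]
    simp
  · rw [map_sub, map_smul, fox_one, smul_zero, sub_zero]

/-- Putting the removed last letters back restores every word except the empty one: the fundamental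
formula of Fox calculus. -/
theorem linearCombination_fox (f : Poly K X) :
    Finsupp.linearCombination A (fun x => Finsupp.single () (gen x)) (fox gen f) =
      Finsupp.single () (proj gen f - algebraMap K A (f.coeff 1)) := by
  refine linearMap_eq_of_mon
    (φ := (Finsupp.linearCombination A fun x => Finsupp.single () (gen x)).restrictScalars K ∘ₗ
      fox gen)
    (ψ := (Finsupp.lsingle () : A →ₗ[K] Unit →₀ A) ∘ₗ
      ((proj gen).toLinearMap - Algebra.linearMap K A ∘ₗ coeffAt 1)) (fun w => ?_) f
  change Finsupp.linearCombination A (fun x => Finsupp.single () (gen x)) (fox gen (mon w)) =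
      Finsupp.single () (proj gen (mon w) - algebraMap K A ((mon w).coeff 1))
  rcases eq_one_or_eq_mul_of w with rfl | ⟨v, x, rfl⟩
  · rw [mon_one, fox_one, map_zero, map_one, ← mon_one, coeff_mon, Finsupp.single_eq_same, map_one,
      sub_self, Finsupp.single_zero]
  · have h : (1 : FreeMonoid X) ≠ v * FreeMonoid.of x := fun h =>
      absurd (congrArg FreeMonoid.toList h) (by simp)
    rw [coeff_mon, Finsupp.single_eq_of_ne h, map_zero, sub_zero, mon_mul, fox_mul_of,
      Finsupp.linearCombination_single, Finsupp.smul_single, map_mul, proj_mon_of, smul_eq_mul]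

variable {gen} (ε : A →ₐ[K] K)

theorem augmentation_proj (hε : ∀ x, ε (gen x) = 0) (f : Poly K X) :
    ε (proj gen f) = f.coeff 1 := by
  refine linearMap_eq_of_mon (φ := ε.toLinearMap ∘ₗ (proj gen).toLinearMap) (ψ := coeffAt 1)
    (fun w => ?_) f
  change ε (proj gen (mon w)) = (mon w).coeff 1
  rcases eq_one_or_eq_mul_of w with rfl | ⟨v, x, rfl⟩
  · rw [mon_one, map_one, map_one, ← mon_one, coeff_mon, Finsupp.single_eq_same]
  · have h : (1 : FreeMonoid X) ≠ v * FreeMonoid.of x := fun h =>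
      absurd (congrArg FreeMonoid.toList h) (by simp)
    rw [coeff_mon, Finsupp.single_eq_of_ne h, mon_mul, map_mul, map_mul, proj_mon_of, hε, mul_zero]

/-- A word vx contributes the augmentation of v to the coordinate x, which is non-zero only for
empty v. -/
theorem augmentation_fox (hε : ∀ x, ε (gen x) = 0) (f : Poly K X) (x : X) :
    ε (fox gen f x) = f.coeff (FreeMonoid.of x) := by
  classical
  refine linearMap_eq_of_mon
    (φ := ε.toLinearMap ∘ₗ (Finsupp.lapply x : (X →₀ A) →ₗ[K] A) ∘ₗ fox gen)
    (ψ := coeffAt (FreeMonoid.of x)) (fun w => ?_) f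
  change ε (fox gen (mon w) x) = (mon w).coeff (FreeMonoid.of x)
  rcases eq_one_or_eq_mul_of w with rfl | ⟨v, y, rfl⟩
  · have h : FreeMonoid.of x ≠ 1 := fun h => absurd (congrArg FreeMonoid.toList h) (by simp)
    rw [mon_one, fox_one, ← mon_one, coeff_mon, Finsupp.single_eq_of_ne h, Finsupp.zero_apply,
      map_zero]
  · rw [fox_mon, j0_mul_of, coeff_mon, Finsupp.single_apply, Finsupp.single_apply]
    by_cases hxy : y = x
    · subst hxy
      rw [if_pos rfl, augmentation_proj ε hε, coeff_mon, Finsupp.single_apply]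
      simp
    · have h : v * FreeMonoid.of y ≠ FreeMonoid.of x := by
        intro h
        have h1 : v.toList ++ [y] = [] ++ [x] := congrArg FreeMonoid.toList h
        exact hxy (by simpa using (List.append_inj' h1 rfl).2)
      rw [if_neg hxy, if_neg h, map_zero]

variable {lt : FreeMonoid X → FreeMonoid X → Prop} {G : Set (Poly K X)}

theorem nf_eq_self {f : Poly K X} (h : NonReducible lt G f) : nf lt G f = f := by
  have hex : ∃ f', Relation.ReflTransGen (Step lt G) f f' ∧ NonReducible lt G f' :=
    ⟨f, Relation.ReflTransGen.refl, h⟩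
  rw [nf, dif_pos hex]
  rcases Relation.ReflTransGen.cases_head hex.choose_spec.1 with e | ⟨g, hg, _⟩
  · exact e.symm
  · exact absurd hg (h g)

theorem rep_proj (hG : IsGroebnerBasis lt gen G) {f : Poly K X} (h : NonReducible lt G f) :
    rep lt gen G (proj gen f) = f := by
  have hex : ∃ f', NonReducible lt G f' ∧ proj gen f' = proj gen f := ⟨f, h, rfl⟩
  rw [rep, dif_pos hex]
  exact hG.2.injOn hex.choose_spec.1 h hex.choose_spec.2

variable (gen) in
theorem delta1_eq_fox {t : FreeMonoid X}
    (h : NonReducible lt G (mon (FreeMonoid.ofList t.toList.dropLast))) :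
    delta1 lt gen G t = fox gen (mon (K := K) t) := by
  rw [delta1, nf_eq_self h, fox_mon, j0]

end Fox

end Anick

/-! ### The Anick differentials and exactness -/

namespace Kostant

open Anick

theorem Rel.two_le_length_tailTerms {p : ℕ} (hp : 1 < p) (r : Rel p) {x : ℤ × List Gen}
    (hx : x ∈ r.tailTerms) : 2 ≤ x.2.length := by
  cases r <;> simp only [Rel.tailTerms, List.mem_cons, List.not_mem_nil, or_false] at hx
  case braid => subst hx; simp; omega
  all_goals rcases hx with rfl | rfl <;> simp <;> omega

namespace DivPowBasis

variable {K : Type u} [Field K] {A : Type u} [Ring A] [Algebra K A] (H : DivPowBasis K A)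
  (p : ℕ)

theorem fox_mem_freeGrading {s : ℕ × ℕ} {f : Poly K Gen}
    (hf : ∀ w ∈ f.coeff.support, wordDeg p w = s) :
    fox (H.gen p) f ∈ Graded.freeGrading H.grading (Gen.deg p) s := by
  rw [fox_eq_sum]
  refine sum_mem fun w hw => ?_
  rw [← hf w hw]
  beta_reduce
  rcases eq_one_or_eq_mul_of w with rfl | ⟨u, x, rfl⟩
  · rw [j0_one, smul_zero]; exact zero_mem _
  · rw [j0_mul_of, Finsupp.smul_single, wordDeg_mul, wordDeg_of, algebraMap_smul]
    exact Graded.single_mem_freeGrading _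
      (Submodule.smul_mem _ _ (H.proj_mon_mem_grading p u)) x

theorem delta0_eq (hp : 1 < p) (x : Gen) :
    delta0 (wordLT p) (H.gen p) (G K p) x = Finsupp.single () (H.gen p x) := by
  rw [delta0, nf_eq_self, proj_mon_of]
  rw [nonReducible_iff K hp]
  intro w hw
  rw [coeff_mon] at hw
  rw [Finset.mem_singleton.mp (Finsupp.support_single_subset hw)]
  exact normal_singleton hp x

variable [hp : Fact p.Prime]

theorem d0_eq : d0 (wordLT p) (H.gen p) (G K p) =
    Finsupp.linearCombination A fun x => Finsupp.single () (H.gen p x) := by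
  rw [d0, funext (H.delta0_eq p hp.out.one_lt)]

theorem d0_fox (f : Poly K Gen) : d0 (wordLT p) (H.gen p) (G K p) (fox (H.gen p) f) =
    Finsupp.single () (proj (H.gen p) f - algebraMap K A (f.coeff 1)) := by
  rw [d0_eq, linearCombination_fox]

theorem d0_isGradedHom : Graded.IsGradedHom (Graded.freeGrading H.grading (Gen.deg p))
    (Graded.freeGrading H.grading fun _ : Unit => 0) (d0 (wordLT p) (H.gen p) (G K p)) := by
  rw [d0_eq]
  refine Graded.isGradedHom_linearCombination _
    (Graded.freeGrading_isGradedModule _ H.isGradedAlgebra) fun x => ?_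
  have := Graded.single_mem_freeGrading (fun _ : Unit => (0 : ℕ × ℕ)) (H.gen_mem_grading p x) ()
  rwa [add_zero] at this

section Augmentation

variable {ε : A →ₐ[K] K} (hε : ∀ t, ε (H.basis t) = if t = (0, 0, 0) then 1 else 0)

include hε

theorem augmentation_gen (x : Gen) : ε (H.gen p x) = 0 := by
  have h : p ^ x.level ≠ 0 := pow_ne_zero _ hp.out.ne_zero
  cases x with
  | a k =>
    change ε (H.basis (p ^ k, 0, 0)) = 0
    rw [hε, if_neg (fun e => h (congrArg (fun t => t.1) e))]
  | b k =>
    change ε (H.basis (0, 0, p ^ k)) = 0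
    rw [hε, if_neg (fun e => h (congrArg (fun t => t.2.2) e))]

omit hp in
-- The only basis element of degree 0 is 1, so subtracting ε(a) removes the degree 0 part of a.
-- Membership in the radical can thus be tested by the augmentation.
theorem mem_iSup_of_augmentation_eq_zero {a : A} (ha : ε a = 0) :
    a ∈ ⨆ β : ℕ × ℕ, ⨆ _ : β ≠ 0, H.grading β := by
  have key : ∀ a : A, a - algebraMap K A (ε a) ∈ ⨆ β : ℕ × ℕ, ⨆ _ : β ≠ 0, H.grading β := by
    intro a
    induction a using H.basis_induction with
    | h0 => simp
    | hadd x y hx hy =>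
      rw [map_add, map_add, add_sub_add_comm]
      exact add_mem hx hy
    | hE c t =>
      rw [map_smul, smul_eq_mul, map_mul, ← Algebra.smul_def, ← smul_sub]
      refine Submodule.smul_mem _ _ ?_
      rw [hε]
      by_cases h : t = (0, 0, 0)
      · rw [if_pos h, h, H.one, map_one, sub_self]; exact zero_mem _
      · rw [if_neg h, map_zero, sub_zero]
        have h0 : tripleDeg t ≠ 0 := by
          obtain ⟨i, j, k⟩ := t
          simp only [tripleDeg, ne_eq, Prod.mk_eq_zero, Prod.mk.injEq] at h ⊢
          omega
        exact Submodule.mem_iSup_of_mem _ (Submodule.mem_iSup_of_mem h0 (H.basis_mem_grading t))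
  have := key a
  rwa [ha, map_zero, sub_zero] at this

omit hp in
theorem augmentation_eq_zero_of_mem_grading {s : ℕ × ℕ} (hs : s ≠ 0) {a : A}
    (ha : a ∈ H.grading s) : ε a = 0 := by
  induction ha using Submodule.span_induction with
  | mem a h =>
    obtain ⟨i, j, k, rfl, rfl⟩ := h
    rw [E, hε, if_neg]
    rintro h
    obtain ⟨rfl, rfl, rfl⟩ : i = 0 ∧ j = 0 ∧ k = 0 := by simpa using h
    exact hs rfl
  | zero => exact map_zero _
  | add x y _ _ hx hy => rw [map_add, hx, hy, add_zero]
  | smul c x _ hx => rw [map_smul, hx, smul_zero]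

theorem augmentation_d0 (v : Gen →₀ A) : ε (d0 (wordLT p) (H.gen p) (G K p) v ()) = 0 := by
  rw [d0_eq]
  induction v using Finsupp.induction_linear with
  | zero => simp
  | add v w hv hw => rw [LinearMap.map_add, Finsupp.add_apply, map_add, hv, hw, add_zero]
  | single x a =>
    rw [Finsupp.linearCombination_single, Finsupp.smul_single, Finsupp.single_eq_same, smul_eq_mul,
      map_mul, H.augmentation_gen p hε, mul_zero]

theorem d0_mem_rad (v : Gen →₀ A) :
    d0 (wordLT p) (H.gen p) (G K p) v ∈ Graded.rad H.grading Unit := fun _ =>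
  H.mem_iSup_of_augmentation_eq_zero hε (H.augmentation_d0 p hε v)

variable [CharP K p]

theorem mem_range_d0 {f : Unit →₀ A} (hf : ε (f ()) = 0) :
    f ∈ LinearMap.range (d0 (wordLT p) (H.gen p) (G K p)) := by
  obtain ⟨g, hg⟩ := H.proj_surjective p (f ())
  refine ⟨fox (H.gen p) g, ?_⟩
  rw [← hg, augmentation_proj ε (H.augmentation_gen p hε)] at hf
  rw [d0_fox, hf, map_zero, sub_zero, hg]
  exact (Finsupp.unique_single f).symm

end Augmentation

theorem exists_word_eq (t : T1 (wordLT p) (G K p)) : ∃ r : Rel p, t.1 = r.word :=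
  (exists_isLeading_iff K hp.out.one_lt t.1).mp t.2

theorem coeff_eq_zero_of_length_lt (r : Rel p) {w : FreeMonoid Gen} (hw : w.toList.length < 2) :
    (mon r.word - r.tail K).coeff w = 0 := by
  by_contra h
  rcases r.mem_support K (Finsupp.mem_support_iff.mpr h) with rfl | h
  · exact absurd (r.two_le_length_lead hp.out.one_lt) (not_le.mpr hw)
  · obtain ⟨x, hx, rfl⟩ := mem_support_tail K h
    exact absurd (r.two_le_length_tailTerms hp.out.one_lt hx) (not_le.mpr hw)

variable [CharP K p]

/-- Without its last letter the leading word is normal, so δ₁ is `fox` of the whole word. Its image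
under d₀ is the class of the leading word, whose normal representative is the tail; applying i₀
gives `fox` of the tail. -/
theorem d1_single {t : T1 (wordLT p) (G K p)} {r : Rel p} (h : t.1 = r.word) :
    d1 (wordLT p) (H.gen p) (G K p) (Finsupp.single t 1) =
      fox (H.gen p) (mon r.word - r.tail K) := by
  have h1 : delta1 (wordLT p) (H.gen p) (G K p) r.word = fox (H.gen p) (mon (K := K) r.word) := by
    refine delta1_eq_fox _ ?_
    rw [nonReducible_iff K hp.out.one_lt]
    intro w hw
    rw [coeff_mon] at hw
    rw [Finset.mem_singleton.mp (Finsupp.support_single_subset hw)]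
    exact r.normal_dropLast_lead hp.out.one_lt
  have h2 : (mon (K := K) r.word).coeff 1 = 0 := by
    rw [coeff_mon]
    refine Finsupp.single_eq_of_ne fun e => ?_
    have h3 := r.two_le_length_lead hp.out.one_lt
    have h4 : r.lead = [] := congrArg FreeMonoid.toList e.symm
    rw [h4] at h3
    exact absurd h3 (by simp)
  have h3 : proj (H.gen p) (mon (K := K) r.word) = proj (H.gen p) (r.tail K) := by
    rw [← sub_eq_zero, ← map_sub]
    exact H.proj_eq_zero p ((mem_G_iff K _).mpr ⟨r, rfl⟩)
  have h4 : NonReducible (wordLT p) (G K p) (r.tail K) := by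
    rw [nonReducible_iff K hp.out.one_lt]
    intro w hw
    obtain ⟨x, hx, rfl⟩ := mem_support_tail K hw
    exact r.normal_tailTerms hp.out.one_lt hx
  rw [d1, Finsupp.linearCombination_single, one_smul, h, h1, d0_fox, h2, map_zero, sub_zero, i0,
    Finsupp.single_eq_same, h3, rep_proj (H.isReducedGroebnerBasis p).1 h4, ← fox_eq_sum, map_sub]

theorem d1_isGradedHom : Graded.IsGradedHom
    (Graded.freeGrading H.grading fun t : T1 (wordLT p) (G K p) => wordDeg p t.1)
    (Graded.freeGrading H.grading (Gen.deg p)) (d1 (wordLT p) (H.gen p) (G K p)) := by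
  refine Graded.isGradedHom_linearCombination _
    (Graded.freeGrading_isGradedModule _ H.isGradedAlgebra) fun t => ?_
  obtain ⟨r, hr⟩ := exists_word_eq (K := K) p t
  have h := H.d1_single p hr
  rw [d1, Finsupp.linearCombination_single, one_smul] at h
  rw [h, hr]
  refine H.fox_mem_freeGrading p fun w hw => ?_
  rcases r.mem_support K hw with rfl | hw
  · rfl
  · exact r.wordDeg_of_mem_support K hp.out.one_lt hw

/-- An element of ker d₀ is `fox` of a combination of products u g v. If v ends in a letter, `fox`
projects everything before that letter, including g, and gives 0; if v is empty, it gives a multiple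
of d₁ of a basis element. -/
theorem range_d1 : LinearMap.range (d1 (wordLT p) (H.gen p) (G K p)) =
    LinearMap.ker (d0 (wordLT p) (H.gen p) (G K p)) := by
  apply le_antisymm
  · rintro _ ⟨v, rfl⟩
    induction v using Finsupp.induction_linear with
    | zero => rw [map_zero]; exact zero_mem _
    | add v w hv hw => rw [map_add]; exact add_mem hv hw
    | single t a =>
      obtain ⟨r, hr⟩ := exists_word_eq (K := K) p t
      rw [← mul_one a, ← smul_eq_mul, ← Finsupp.smul_single, map_smul, H.d1_single p hr]
      refine Submodule.smul_mem _ _ ?_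
      rw [LinearMap.mem_ker, d0_fox, H.proj_eq_zero p ((mem_G_iff K _).mpr ⟨r, rfl⟩),
        coeff_eq_zero_of_length_lt p r (by simp), map_zero, sub_zero, Finsupp.single_zero]
  · intro v hv
    obtain ⟨f, hf, rfl⟩ := exists_fox_eq (H.gen p) (H.proj_surjective p) v
    rw [LinearMap.mem_ker, d0_fox, hf, map_zero, sub_zero, Finsupp.single_eq_zero] at hv
    have hrel := H.ker_proj_le_relSpan p hv
    clear hv hf
    induction hrel using Submodule.span_induction with
    | mem f h =>
      obtain ⟨u, w, r, rfl⟩ := h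
      rcases eq_one_or_eq_mul_of w with rfl | ⟨w, x, rfl⟩
      · rw [mon_one, mul_one, fox_mon_mul, coeff_eq_zero_of_length_lt p r (by simp), zero_smul,
          add_zero]
        obtain ht := (exists_isLeading_iff K hp.out.one_lt r.word).mpr ⟨r, rfl⟩
        exact Submodule.smul_mem _ _ ⟨_, H.d1_single p (t := ⟨r.word, ht⟩) rfl⟩
      · rw [mon_mul, ← mul_assoc, fox_mul_of, map_mul, map_mul,
          H.proj_eq_zero p ((mem_G_iff K _).mpr ⟨r, rfl⟩), mul_zero, zero_mul, Finsupp.single_zero]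
        exact zero_mem _
    | zero => rw [map_zero]; exact zero_mem _
    | add f g _ _ hf hg => rw [map_add]; exact add_mem hf hg
    | smul c f _ hf =>
      rw [map_smul, ← algebraMap_smul A c]
      exact Submodule.smul_mem _ _ hf

/-- No relation contains a word of length one, so every coordinate has augmentation zero. -/
theorem d1_mem_rad {ε : A →ₐ[K] K} (hε : ∀ t, ε (H.basis t) = if t = (0, 0, 0) then 1 else 0)
    (v : T1 (wordLT p) (G K p) →₀ A) :
    d1 (wordLT p) (H.gen p) (G K p) v ∈ Graded.rad H.grading Gen := by
  intro x
  refine H.mem_iSup_of_augmentation_eq_zero hε ?_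
  induction v using Finsupp.induction_linear with
  | zero => simp
  | add v w hv hw => rw [map_add, Finsupp.add_apply, map_add, hv, hw, add_zero]
  | single t a =>
    obtain ⟨r, hr⟩ := exists_word_eq (K := K) p t
    rw [← mul_one a, ← smul_eq_mul, ← Finsupp.smul_single, map_smul, H.d1_single p hr,
      Finsupp.smul_apply, smul_eq_mul, map_mul, augmentation_fox ε (H.augmentation_gen p hε),
      coeff_eq_zero_of_length_lt p r (by simp), mul_zero]

end DivPowBasis

end Kostant

/-! ### Application to the Kostant form -/

namespace Kostant

open Anick

section Assembly

variable (K : Type u) [Field K]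

/-- The divided power basis of the Kostant form. -/
noncomputable def divPowBasis : DivPowBasis K (KostantForm K) where
  basis := basisK K
  one := by rw [basisK_apply]; exact basisElt_zero K
  mul i j k i' j' k' := by
    simp only [basisK_apply]
    exact basisElt_mul_basisElt K i j k i' j' k'

theorem divPowBasis_E (i j k : ℕ) : (divPowBasis K).E i j k = basisElt K i j k :=
  basisK_apply K (i, j, k)

theorem grading_eq : grading K = (divPowBasis K).grading := by
  funext s
  simp only [grading, DivPowBasis.grading, divPowBasis_E]

theorem genElt_eq (p : ℕ) : genElt K p = (divPowBasis K).gen p := by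
  funext x
  cases x with
  | a k => exact (divPowBasis_E K _ _ _).symm
  | b k => exact (divPowBasis_E K _ _ _).symm

theorem aug_divPowBasis (t : ℕ × ℕ × ℕ) :
    aug K ((divPowBasis K).basis t) = if t = (0, 0, 0) then 1 else 0 :=
  (congrArg (aug K) (basisK_apply K t)).trans (aug_basisElt K t.1 t.2.1 t.2.2)

theorem smul_trivialModule_eq_zero {a : KostantForm K} (h : aug K a = 0) (x : TrivialModule K) :
    a • x = 0 :=
  (congrArg (fun c : K => Mul.mul (α := K) c x) h).trans (zero_mul (M₀ := K) x)

theorem smul_one_trivialModule (a : KostantForm K) : a • TrivialModule.one K = (aug K a : K) :=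
  mul_one (M := K) _

theorem isGradedModule_trivialGrading : Graded.IsGradedModule (grading K) (trivialGrading K) := by
  refine ⟨Graded.isInternal_of_components _
    (fun s => if s = 0 then AddMonoidHom.id _ else 0) ?_ ?_ ?_, ?_⟩
  · intro s x hx
    by_cases h : s = 0
    · rw [if_pos h]; rfl
    · rw [trivialGrading, if_neg h, AddSubgroup.mem_bot] at hx
      rw [hx, map_zero]
  · intro s t hst x hx
    by_cases h : s = 0
    · rw [trivialGrading, if_neg (fun e => hst (h.trans e.symm)), AddSubgroup.mem_bot] at hx
      rw [hx, map_zero]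
    · rw [if_neg h]; rfl
  · intro x
    refine AddSubmonoid.subset_closure (Set.mem_iUnion.mpr ⟨0, ?_⟩)
    rw [trivialGrading, if_pos rfl]
    trivial
  · intro s t a ha x hx
    by_cases ht : t = 0
    · by_cases hs : s = 0
      · rw [trivialGrading, if_pos (by rw [hs, ht, add_zero])]
        trivial
      · rw [grading_eq] at ha
        have h0 : aug K a = 0 :=
          (divPowBasis K).augmentation_eq_zero_of_mem_grading (aug_divPowBasis K) hs ha
        rw [smul_trivialModule_eq_zero K h0]; exact zero_mem _
    · rw [trivialGrading, if_neg ht, AddSubgroup.mem_bot] at hx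
      rw [hx, smul_zero]; exact zero_mem _

theorem augP_apply (f : Unit →₀ KostantForm K) : augP K f = (aug K (f ()) : K) := by
  have h : f = Finsupp.single () (f ()) := Finsupp.unique_single f
  generalize f () = a at h
  subst h
  rw [augP, Finsupp.linearCombination_single, smul_one_trivialModule]

theorem augP_surjective : Function.Surjective (augP K) := by
  intro c
  refine ⟨Finsupp.single () (algebraMap K _ c), ?_⟩
  rw [augP_apply, Finsupp.single_eq_same]
  exact (aug K).commutes c

theorem mem_ker_augP_iff (f : Unit →₀ KostantForm K) :
    f ∈ LinearMap.ker (augP K) ↔ aug K (f ()) = 0 := by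
  rw [LinearMap.mem_ker, augP_apply]
  exact Iff.rfl

theorem isGradedAlgebra_grading : Graded.IsGradedAlgebra (grading K) := by
  rw [grading_eq]; exact (divPowBasis K).isGradedAlgebra

theorem isGradedHom_augP : Graded.IsGradedHom (grPm1 K) (trivialGrading K) (augP K) := by
  refine Graded.isGradedHom_linearCombination _ (isGradedModule_trivialGrading K) fun _ => ?_
  rw [trivialGrading, if_pos rfl]
  trivial

variable (p : ℕ) [hp : Fact p.Prime]

theorem isGradedHom_anickD0 : Graded.IsGradedHom (grP0 K p) (grPm1 K) (anickD0 K p) := by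
  rw [grP0, grPm1, anickD0, grading_eq, genElt_eq]
  exact (divPowBasis K).d0_isGradedHom p

theorem anickD0_mem_rad (x : Gen →₀ KostantForm K) :
    anickD0 K p x ∈ Graded.rad (grading K) Unit := by
  rw [anickD0, grading_eq, genElt_eq]
  exact (divPowBasis K).d0_mem_rad p (aug_divPowBasis K) x

variable [CharP K p]

theorem isGradedHom_anickD1 : Graded.IsGradedHom (grP1 K p) (grP0 K p) (anickD1 K p) := by
  rw [grP0, grP1, anickD1, grading_eq, genElt_eq]
  exact (divPowBasis K).d1_isGradedHom p

theorem anickD1_mem_rad (x : T1 (wordLT p) (G K p) →₀ KostantForm K) :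
    anickD1 K p x ∈ Graded.rad (grading K) Gen := by
  rw [anickD1, grading_eq, genElt_eq]
  exact (divPowBasis K).d1_mem_rad p (aug_divPowBasis K) x

theorem range_anickD0 : LinearMap.range (anickD0 K p) = LinearMap.ker (augP K) := by
  ext f
  rw [mem_ker_augP_iff, anickD0, genElt_eq]
  constructor
  · rintro ⟨v, rfl⟩
    exact (divPowBasis K).augmentation_d0 p (aug_divPowBasis K) v
  · exact (divPowBasis K).mem_range_d0 p (aug_divPowBasis K)

theorem range_anickD1 : LinearMap.range (anickD1 K p) = LinearMap.ker (anickD0 K p) := by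
  rw [anickD1, anickD0, genElt_eq]
  exact (divPowBasis K).range_d1 p

/-- The total degree. -/
def totalDegree : ℕ × ℕ →+ ℕ := AddMonoidHom.fst ℕ ℕ + AddMonoidHom.snd ℕ ℕ

theorem eq_zero_of_totalDegree_eq_zero (s : ℕ × ℕ) (h : totalDegree s = 0) : s = 0 := by
  have h : s.1 + s.2 = 0 := h
  ext <;> simp <;> omega

omit [CharP K p] in
theorem isSmall_range_anickD0 : Graded.IsSmall (grPm1 K) (LinearMap.range (anickD0 K p)) := by
  have hA := isGradedAlgebra_grading K
  refine Graded.isSmall_of_le_rad _ hA totalDegree eq_zero_of_totalDegree_eq_zero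
    ((isGradedHom_anickD0 K p).isGradedSubmodule_range hA
      (Graded.freeGrading_isGradedModule _ hA) (Graded.freeGrading_isGradedModule _ hA)) ?_
  rintro _ ⟨x, rfl⟩
  exact anickD0_mem_rad K p x

theorem isSmall_range_anickD1 : Graded.IsSmall (grP0 K p) (LinearMap.range (anickD1 K p)) := by
  have hA := isGradedAlgebra_grading K
  refine Graded.isSmall_of_le_rad _ hA totalDegree eq_zero_of_totalDegree_eq_zero
    ((isGradedHom_anickD1 K p).isGradedSubmodule_range hA
      (Graded.freeGrading_isGradedModule _ hA) (Graded.freeGrading_isGradedModule _ hA)) ?_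
  rintro _ ⟨x, rfl⟩
  exact anickD1_mem_rad K p x

end Assembly

end Kostant

/-! ### Comparison with minimal resolutions -/

namespace Graded

/-- Two steps of a projective presentation with small kernels agree with the beginning of every
minimal resolution. -/
theorem MinimalResolution.exists_equiv {Γ : Type} [AddCancelCommMonoid Γ] [DecidableEq Γ]
    {K A : Type u} [Field K] [Ring A] [Algebra K A] {𝒜 : Γ → Submodule K A}
    {M P P' : Type u} [AddCommGroup M] [Module A M] [AddCommGroup P] [Module A P]
    [AddCommGroup P'] [Module A P'] {ℳ : Γ → AddSubgroup M} {𝒰 : Γ → AddSubgroup P}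
    {𝒰' : Γ → AddSubgroup P'} (R : MinimalResolution 𝒜 ℳ)
    (hA : IsGradedAlgebra 𝒜) (hM : IsGradedModule 𝒜 ℳ) (hP : IsProjective 𝒜 𝒰)
    (hP' : IsProjective 𝒜 𝒰') {f : P →ₗ[A] M} {d : P' →ₗ[A] P} (hf : IsGradedHom 𝒰 ℳ f)
    (hd : IsGradedHom 𝒰' 𝒰 d) (hfs : Function.Surjective f)
    (hexact : LinearMap.range d = LinearMap.ker f) (hfm : IsSmall 𝒰 (LinearMap.ker f))
    (hdm : IsSmall 𝒰' (LinearMap.ker d)) :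
    ∃ (φ : P ≃ₗ[A] R.Q 0) (ψ : P' ≃ₗ[A] R.Q 1),
      (∀ s x, x ∈ 𝒰 s ↔ φ x ∈ R.gr 0 s) ∧ (∀ s x, x ∈ 𝒰' s ↔ ψ x ∈ R.gr 1 s) ∧
      (∀ x, R.aug (φ x) = f x) ∧ ∀ x, R.d 0 (ψ x) = φ (d x) := by
  obtain ⟨φ, hφ, hφf⟩ := exists_equiv_of_isSmall_ker hA hP (R.projective 0) hM hf R.aug_graded hfs
    R.aug_surjective hfm R.aug_minimal
  -- The second comparison is between two projective covers of the graded module `LinearMap.ker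
  -- R.aug`, namely `φ ∘ d` and `R.d 0` with restricted codomain. The restriction leaves their
  -- kernels unchanged, so smallness carries over.
  have hN := isGradedModule_comap hA (R.projective 0).1 R.aug_minimal.1
  have h1 : ∀ x, (φ.toLinearMap ∘ₗ d) x ∈ LinearMap.ker R.aug := by
    intro x
    have hx : d x ∈ LinearMap.ker f := hexact ▸ LinearMap.mem_range_self d x
    exact (hφf (d x)).trans hx
  have h2 : ∀ x, R.d 0 x ∈ LinearMap.ker R.aug := by
    intro x
    rw [← R.exact_zero]
    exact LinearMap.mem_range_self _ x
  have hk1 : LinearMap.ker ((φ.toLinearMap ∘ₗ d).codRestrict _ h1) = LinearMap.ker d := by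
    rw [LinearMap.ker_codRestrict]
    exact LinearEquiv.ker_comp φ d
  have hs1 : Function.Surjective ((φ.toLinearMap ∘ₗ d).codRestrict _ h1) := by
    rintro ⟨y, hy⟩
    have h3 : φ.symm y ∈ LinearMap.range d := by
      rw [hexact, LinearMap.mem_ker, ← hφf, φ.apply_symm_apply]
      exact hy
    obtain ⟨x, hx⟩ := h3
    exact ⟨x, Subtype.ext ((congrArg φ hx).trans (φ.apply_symm_apply y))⟩
  have hs2 : Function.Surjective ((R.d 0).codRestrict _ h2) := by
    rintro ⟨y, hy⟩
    have h3 : y ∈ LinearMap.range (R.d 0) := by rw [R.exact_zero]; exact hy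
    obtain ⟨x, hx⟩ := h3
    exact ⟨x, Subtype.ext hx⟩
  obtain ⟨ψ, hψ, hψf⟩ := exists_equiv_of_isSmall_ker hA hP' (R.projective 1) hN
    (fun s x hx => (hφ s _).mp (hd s x hx)) (fun s x hx => R.d_graded 0 s x hx) hs1 hs2
    (hk1.symm ▸ hdm) ((LinearMap.ker_codRestrict _ _ h2).symm ▸ R.d_minimal 0)
  exact ⟨φ, ψ, hφ, hψ, hφf, fun x => congrArg Subtype.val (hψf x)⟩

end Graded

theorem mainTheorem8 (K : Type u) [Field K] (p : ℕ) [Fact p.Prime] [CharP K p] :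
    -- the data are what they are said to be: `A` is graded, `G` is a reduced Gröbner basis
    Graded.IsGradedAlgebra (Kostant.grading K) ∧
    Graded.IsGradedModule (Kostant.grading K) (Kostant.trivialGrading K) ∧
    Anick.IsReducedGroebnerBasis (Kostant.wordLT p) (Kostant.genElt K p) (Kostant.G K p) ∧
    -- `P₁ → P₀ → P₋₁ → K → 0` is an exact sequence of graded modules, with `P₁, P₀, P₋₁` projective
    Graded.IsProjective (Kostant.grading K) (Kostant.grPm1 K) ∧
    Graded.IsProjective (Kostant.grading K) (Kostant.grP0 K p) ∧
    Graded.IsProjective (Kostant.grading K) (Kostant.grP1 K p) ∧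
    Graded.IsGradedHom (Kostant.grPm1 K) (Kostant.trivialGrading K) (Kostant.augP K) ∧
    Graded.IsGradedHom (Kostant.grP0 K p) (Kostant.grPm1 K) (Kostant.anickD0 K p) ∧
    Graded.IsGradedHom (Kostant.grP1 K p) (Kostant.grP0 K p) (Kostant.anickD1 K p) ∧
    Function.Surjective (Kostant.augP K) ∧
    LinearMap.range (Kostant.anickD0 K p) = LinearMap.ker (Kostant.augP K) ∧
    LinearMap.range (Kostant.anickD1 K p) = LinearMap.ker (Kostant.anickD0 K p) ∧
    -- the images of `d₀` and `d₁` are small and lie in the radical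
    Graded.IsSmall (Kostant.grPm1 K) (LinearMap.range (Kostant.anickD0 K p)) ∧
    Graded.IsSmall (Kostant.grP0 K p) (LinearMap.range (Kostant.anickD1 K p)) ∧
    (∀ x, Kostant.anickD0 K p x ∈ Graded.rad (Kostant.grading K) Unit) ∧
    (∀ x, Kostant.anickD1 K p x ∈ Graded.rad (Kostant.grading K) Kostant.Gen) ∧
    -- `P₀ → P₋₁ → K` is the beginning of the minimal graded projective resolution of `K`
    (∀ R : Graded.MinimalResolution (Kostant.grading K) (Kostant.trivialGrading K),
      ∃ (φ : (Unit →₀ Kostant.KostantForm K) ≃ₗ[Kostant.KostantForm K] R.Q 0)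
        (ψ : (Kostant.Gen →₀ Kostant.KostantForm K) ≃ₗ[Kostant.KostantForm K] R.Q 1),
        (∀ s x, x ∈ Kostant.grPm1 K s ↔ φ x ∈ R.gr 0 s) ∧
        (∀ s x, x ∈ Kostant.grP0 K p s ↔ ψ x ∈ R.gr 1 s) ∧
        (∀ x, R.aug (φ x) = Kostant.augP K x) ∧
        (∀ x, R.d 0 (ψ x) = φ (Kostant.anickD0 K p x))) := by
  have hA := Kostant.isGradedAlgebra_grading K
  have hM := Kostant.isGradedModule_trivialGrading K
  have hPm1 : Graded.IsProjective (Kostant.grading K) (Kostant.grPm1 K) :=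
    Graded.freeGrading_isProjective _ hA
  have hP0 : Graded.IsProjective (Kostant.grading K) (Kostant.grP0 K p) :=
    Graded.freeGrading_isProjective _ hA
  have hd0 := Kostant.isSmall_range_anickD0 K p
  have hd1 := Kostant.isSmall_range_anickD1 K p
  have he0 := Kostant.range_anickD0 K p
  have he1 := Kostant.range_anickD1 K p
  refine ⟨hA, hM, ?_, hPm1, hP0, Graded.freeGrading_isProjective _ hA,
    Kostant.isGradedHom_augP K, Kostant.isGradedHom_anickD0 K p, Kostant.isGradedHom_anickD1 K p,
    Kostant.augP_surjective K, he0, he1, hd0, hd1, Kostant.anickD0_mem_rad K p,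
    Kostant.anickD1_mem_rad K p, fun R => ?_⟩
  · rw [Kostant.genElt_eq]
    exact (Kostant.divPowBasis K).isReducedGroebnerBasis p
  · exact R.exists_equiv hA hM hPm1 hP0 (Kostant.isGradedHom_augP K)
      (Kostant.isGradedHom_anickD0 K p) (Kostant.augP_surjective K) he0 (he0 ▸ hd0) (he1 ▸ hd1)
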